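/- **Parameters.** Let $2\le m\le n$, $m-1\le m'\le n-1$, and fix a sign $\varepsilon=\pm1$. Let $\Lambda=(\Lambda_1,\dots,\Lambda_{n+1})$ be a Harish-Chandra parameter of $Spin(2n,2)$ in $\Xi_{m,\varepsilon}$: the $\Lambda_i$ are all integers or all half-integers, $\Lambda_i\pm\Lambda_j\neq0$ for $i\ne j$, and $\Lambda_1>\dots>\Lambda_{m-1}>\varepsilon\Lambda_{n+1}>\Lambda_m>\dots>\Lambda_{n-1}>|\Lambda_n|$ (for $m=n$: $\Lambda_{n-1}>\varepsilon\Lambda_{n+1}>|\Lambda_n|$). Put $\lambda_i=\Lambda_i-n+i+1$ for $i<m$ and $\lambda_i=\Lambda_i-n+i$ for $m\le i\le n$. Let $Q=(q_{i,j})$ $(1\le i\le 2n-1$, $1\le j\le\lfloor (i+1)/2\rfloor)$ be a $\lambda$-Gelfand–Tsetlin pattern for $Spin(2n)$: entries all integers or all half-integers; $q_{2i+1,j}\ge q_{2i,j}\ge q_{2i+1,j+1}$ and $q_{2i,j}\ge q_{2i-1,j}\ge q_{2i,j+1}$ for $j<i$; $q_{2i+1,i}\ge q_{2i,i}\ge|q_{2i+1,i+1}|$;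 $q_{2i,i}\ge q_{2i-1,i}\ge-q_{2i,i}$; and $q_{2n-1,j}=\lambda_j$. Assume: * $q_{2n-2,p}=q_{2n-3,p}=q_{2n-4,p}$ for $1\le p\le m-2$; * $\lambda_k\ge q_{2n-4,k}\ge\lambda_{k+1}$ for $1\le k\le m-2$; $\lambda_{k+1}\ge q_{2n-4,k}\ge\lambda_{k+2}$ for $m-1\le k\le n-3$; and $\lambda_{n-1}\ge q_{2n-4,n-2}\ge|\lambda_n|$ if $m<n$; * $q_{2n-2,p}=\lambda_{p+1}$, $q_{2n-3,p}=q_{2n-4,p}$ for $m-1\le p\le m'-1$; $q_{2n-2,p}=\lambda_p$, $q_{2n-3,p}=q_{2n-4,p-1}$ for $m'+1\le p\le n-1$; and $q_{2n-2,m'}=q_{2n-3,m'}$ lies in $[\lambda_{m'+1},q_{2n-4,m'-1}]$ if $m'\ge m$, in $[\lambda_m,\lambda_{m-1}]$ if $m'=m-1$. For $j>0$ let $l_{2i-1,j}=q_{2i-1,j}+i-j$, $l_{2i-1,-j}=-l_{2i-1,j}$, $l_{2i,j}=q_{2i,j}+i+1-j$, $l_{2i,-j}=-l_{2i,j}+1$.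 Let $K_6$ be the set of $j\in[m-1,m']\cup[-n+1,-m']$ such that adding $\operatorname{sgn} j$ to $q_{2n-2,|j|}$ turns $Q$ into another $\lambda$-Gelfand–Tsetlin pattern. Write $K_6\cap[m,m']=\{j_3<\dots<j_{N_1}\}$ and $K_6\cap[-n+1,-m'-1]=\{k_{N_1+1}<\dots<k_{N_2}\}$ ($N_1=2$, resp. $N_2=N_1$, if the set is empty). Define $$\alpha_p=\varepsilon\Lambda_n+l_{2n-2,j_p}-1,\quad \beta_p=\varepsilon\Lambda_n+l_{2n-3,j_p-1}\qquad(3\le p\le N_1),$$ $$\alpha_p=\varepsilon\Lambda_n+l_{2n-2,k_p}-1,\quad \beta_p=\varepsilon\Lambda_n+l_{2n-3,k_p}\qquad(N_1<p\le N_2),$$ and $\alpha_1=\varepsilon\Lambda_n+\varepsilon\Lambda_{n+1}$, $\alpha_2=\varepsilon\Lambda_n+l_{2n-2,m-1}-1$ if $m'\ge m$, while $\alpha_1$ and $\alpha_2$ are $\varepsilon\Lambda_n$ plus the maximum, resp. the minimum, of $\varepsilon\Lambda_{n+1}$ and $l_{2n-2,m-1}-1$ if $m'=m-1$. **System.** With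 $\partial_{t_i}:=t_i\,\partial/\partial t_i$, consider on $\{t_1t_2\ne0\}\subset\mathbb C^2$ $$(\partial_{t_1}^2-\partial_{t_2}^2-t_1^2)f=0,\qquad \Big\{\prod_{p=1}^{N_2}(\partial_{t_2}+\alpha_p)+\frac{t_2}{t_1}(\partial_{t_1}-\partial_{t_2})\prod_{p=3}^{N_2}(\partial_{t_2}+\beta_p)\Big\}f=0.$$ **Integrals.** For $1\le j\le N_2$ let $C_j$ be a loop which comes from $+\infty$ below the real axis, crosses the real axis upwards at a point $c_j\in(-\alpha_j-1,-\alpha_j)$, and returns to $+\infty$ above the real axis (concretely, the boundary of a half-strip $\operatorname{Re}s\ge c_j$, $|\operatorname{Im}s|\le h_j$, with any $h_j>0$). Put $$\begin{Bmatrix}f_1^K\\ f_1^I\end{Bmatrix}=\frac1{2\pi i}\int_{C_1}\frac{\prod_{p=1}^{N_2}\Gamma(-\alpha_p-s)}{\prod_{p=3}^{N_2}\Gamma(1-\beta_p-s)}\begin{Bmatrix}t_2^sK_{-s}(t_1)\\(-t_2)^sI_{-s}(t_1)\end{Bmatrix}ds$$ and, for $2\le j\le N_2$, $$\begin{Bmatrix}f_j^K\\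 f_j^I\end{Bmatrix}=\frac1{2\pi i}\int_{C_j}\frac{\prod_{p=j}^{N_2}\Gamma(-\alpha_p-s)\prod_{p=3}^{j}\Gamma(\beta_p+s)}{\prod_{p=1}^{j-1}\Gamma(1+\alpha_p+s)\prod_{p=j+1}^{N_2}\Gamma(1-\beta_p-s)}\begin{Bmatrix}(-t_2)^sK_{-s}(t_1)\\t_2^sI_{-s}(t_1)\end{Bmatrix}ds,$$ where products over $p$ of factors involving $\beta_p$ run only over $p\ge3$, and $K_\nu,I_\nu$ are the modified Bessel functions. These are functions of logarithms of $t_1$, $t_2$ and $-t_2$. **Proposition.** 1. All these integrals converge absolutely, for all $t_1,t_2\in\mathbb C\setminus\{0\}$ and all values of the logarithms. 2. On every non-empty connected open set $V\subset\mathbb C^2$ on which continuous branches of $\log t_1$, $\log t_2$ and $\log(-t_2)$ are given, the $2N_2$ functions $f_j^K,f_j^I$ ($1\le j\le N_2$) form a basis of the space of holomorphic solutions of the system on $V$, which thus has dimension $2N_2$. 3. If $\alpha_1\neq\alpha_2$, the leading terms at $t_2=0$ are $$\begin{Bmatrix}f_1^K\\ f_1^I\end{Bmatrix}\ \cdots\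 \frac{\prod_{p=2}^{N_2}\Gamma(\alpha_1-\alpha_p)}{\prod_{p=3}^{N_2}\Gamma(\alpha_1-\beta_p+1)}\begin{Bmatrix}t_2^{-\alpha_1}K_{\alpha_1}(t_1)\\(-t_2)^{-\alpha_1}I_{\alpha_1}(t_1)\end{Bmatrix},$$ $$\begin{Bmatrix}f_j^K\\ f_j^I\end{Bmatrix}\ \cdots\ \frac{\prod_{p=j+1}^{N_2}\Gamma(\alpha_j-\alpha_p)\prod_{p=3}^{j}\Gamma(\beta_p-\alpha_j)}{\prod_{p=1}^{j-1}\Gamma(1+\alpha_p-\alpha_j)\prod_{p=j+1}^{N_2}\Gamma(\alpha_j-\beta_p+1)}\begin{Bmatrix}(-t_2)^{-\alpha_j}K_{\alpha_j}(t_1)\\t_2^{-\alpha_j}I_{\alpha_j}(t_1)\end{Bmatrix}\quad(j\ge2).$$ That is, each function divided by the displayed power of $\pm t_2$ tends to the displayed constant times the Bessel function as $t_2\to0$ with $\arg t_2$ bounded, locally uniformly in $\log t_1$. -/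

import Mathlib

open scoped Topology

noncomputable section

namespace SpinWhittaker

/-! ## Discrete series parameters and Gelfand-Tsetlin patterns

Sequences `Λ₁, …, Λ_{n+1}` and triangular arrays `q_{i,j}` are functions on `ℕ` (and `ℕ × ℕ`);
only the entries whose (1-based) indices lie in the range of the object are ever used. -/

/-- `Λ = ∑ Λᵢ eᵢ ∈ Ξ_{m,ε}` (`ε = ±1`, `m ≤ n`): `Λ` is a Harish-Chandra parameter of `Spin(2n,2)`
(regular, dominant for the compact positive roots, and integral; `ρ` has integral coordinates, so
that integrality of `Λ + ρ` means that the `Λᵢ` are all integers or all half-integers) which is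
dominant for the positive system `Δ⁺_{m,ε}`. -/
structure IsHarishChandra (n m : ℕ) (ε : ℝ) (Λ : ℕ → ℝ) : Prop where
  integral : (∀ i ∈ Finset.Icc 1 (n + 1), ∃ k : ℤ, Λ i = k) ∨
    (∀ i ∈ Finset.Icc 1 (n + 1), ∃ k : ℤ, Λ i = k + 1 / 2)
  regular : ∀ i j : ℕ, 1 ≤ i → i < j → j ≤ n + 1 → Λ i + Λ j ≠ 0 ∧ Λ i - Λ j ≠ 0
  compact_dominant : ∀ i j : ℕ, 1 ≤ i → i < j → j ≤ n → 0 ≤ Λ i + Λ j ∧ 0 ≤ Λ i - Λ j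
  noncompact_lt : ∀ i : ℕ, 1 ≤ i → i < m → 0 ≤ Λ i + Λ (n + 1) ∧ 0 ≤ Λ i - Λ (n + 1)
  noncompact_ge : ∀ i : ℕ, m ≤ i → i ≤ n → 0 ≤ ε * Λ (n + 1) + Λ i ∧ 0 ≤ ε * Λ (n + 1) - Λ i

/-- The coordinates `λ₁, …, λₙ` of the Blattner parameter `Λ - ρ_c + ρ_n` of `Λ ∈ Ξ_{m,±}`. -/
def blattner (n m : ℕ) (Λ : ℕ → ℝ) (i : ℕ) : ℝ :=
  if i < m then Λ i - n + i + 1 else Λ i - n + i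

/-- `q` is a `λ`-Gelfand-Tsetlin pattern for `Spin(2n)`; row `i` (`1 ≤ i ≤ 2n-1`) has the entries
`q i j`, `1 ≤ j ≤ ⌊(i+1)/2⌋`. -/
structure IsGelfandTsetlin (n : ℕ) (lam : ℕ → ℝ) (q : ℕ → ℕ → ℝ) : Prop where
  integral :
    (∀ i ∈ Finset.Icc 1 (2 * n - 1), ∀ j ∈ Finset.Icc 1 ((i + 1) / 2), ∃ k : ℤ, q i j = k) ∨
    (∀ i ∈ Finset.Icc 1 (2 * n - 1), ∀ j ∈ Finset.Icc 1 ((i + 1) / 2),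
      ∃ k : ℤ, q i j = k + 1 / 2)
  odd_even : ∀ i : ℕ, 1 ≤ i → 2 * i + 1 ≤ 2 * n - 1 → ∀ j : ℕ, 1 ≤ j → j < i →
    q (2 * i) j ≤ q (2 * i + 1) j ∧ q (2 * i + 1) (j + 1) ≤ q (2 * i) j
  odd_even_last : ∀ i : ℕ, 1 ≤ i → 2 * i + 1 ≤ 2 * n - 1 →
    q (2 * i) i ≤ q (2 * i + 1) i ∧ |q (2 * i + 1) (i + 1)| ≤ q (2 * i) i
  even_odd : ∀ i : ℕ, 1 ≤ i → 2 * i ≤ 2 * n - 1 → ∀ j : ℕ, 1 ≤ j → j < i →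
    q (2 * i - 1) j ≤ q (2 * i) j ∧ q (2 * i) (j + 1) ≤ q (2 * i - 1) j
  even_odd_last : ∀ i : ℕ, 1 ≤ i → 2 * i ≤ 2 * n - 1 →
    q (2 * i - 1) i ≤ q (2 * i) i ∧ -q (2 * i) i ≤ q (2 * i - 1) i
  top : ∀ j ∈ Finset.Icc 1 n, q (2 * n - 1) j = lam j

/-- The special patterns attached to `m' ∈ [m-1, n-1]`: the conditions on the rows `2n-2`, `2n-3`
and `2n-4` of `q` under which the scalar equations are derived. -/
structure IsSpecial (n m m' : ℕ) (lam : ℕ → ℝ) (q : ℕ → ℕ → ℝ) : Prop where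
  low : ∀ p : ℕ, 1 ≤ p → p + 2 ≤ m →
    q (2 * n - 2) p = q (2 * n - 3) p ∧ q (2 * n - 3) p = q (2 * n - 4) p
  row_low : ∀ k : ℕ, 1 ≤ k → k + 2 ≤ m →
    q (2 * n - 4) k ≤ lam k ∧ lam (k + 1) ≤ q (2 * n - 4) k
  row_mid : ∀ k : ℕ, m ≤ k + 1 → k + 3 ≤ n →
    q (2 * n - 4) k ≤ lam (k + 1) ∧ lam (k + 2) ≤ q (2 * n - 4) k
  row_last : m < n →
    q (2 * n - 4) (n - 2) ≤ lam (n - 1) ∧ |lam n| ≤ q (2 * n - 4) (n - 2)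
  before : ∀ p : ℕ, m ≤ p + 1 → p < m' →
    q (2 * n - 2) p = lam (p + 1) ∧ q (2 * n - 3) p = q (2 * n - 4) p
  after : ∀ p : ℕ, m' < p → p < n →
    q (2 * n - 2) p = lam p ∧ q (2 * n - 3) p = q (2 * n - 4) (p - 1)
  diag : q (2 * n - 2) m' = q (2 * n - 3) m'
  diag_mem : m ≤ m' → q (2 * n - 2) m' ∈ Set.Icc (lam (m' + 1)) (q (2 * n - 4) (m' - 1))
  diag_mem' : m' + 1 = m → q (2 * n - 2) m' ∈ Set.Icc (lam m) (lam (m - 1))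

/-- The shift `σ_{a,b}`: add `sgn b` to the entry in row `a` and column `|b|`. -/
def shift (a : ℕ) (b : ℤ) (q : ℕ → ℕ → ℝ) : ℕ → ℕ → ℝ :=
  fun i k => if i = a ∧ k = b.natAbs then q i k + (b.sign : ℝ) else q i k

/-- `l_{2i-1,j}` for `j ≠ 0`: `q_{2i-1,j} + i - j` for `j > 0`, and `l_{2i-1,-j} = -l_{2i-1,j}`. -/
def lOdd (q : ℕ → ℕ → ℝ) (i : ℕ) (j : ℤ) : ℝ :=
  if 0 < j then q (2 * i - 1) j.natAbs + i - j.natAbs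
  else -(q (2 * i - 1) j.natAbs + i - j.natAbs)

/-- `l_{2i,j}`: `q_{2i,j} + i + 1 - j` for `j > 0`, `l_{2i,-j} = -l_{2i,j} + 1`, `l_{2i,0} = 0`. -/
def lEven (q : ℕ → ℕ → ℝ) (i : ℕ) (j : ℤ) : ℝ :=
  if 0 < j then q (2 * i) j.natAbs + i + 1 - j.natAbs
  else if j < 0 then -(q (2 * i) j.natAbs + i + 1 - j.natAbs) + 1
  else 0

open Classical in
/-- `K₆(m')`: the `j ∈ [m-1, m'] ∪ [-n+1, -m']` such that `σ_{2n-2,j} Q` is again a pattern. -/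
def K6 (n m m' : ℕ) (lam : ℕ → ℝ) (q : ℕ → ℕ → ℝ) : Finset ℤ :=
  (Finset.Icc ((m : ℤ) - 1) m' ∪ Finset.Icc (-(n : ℤ) + 1) (-(m' : ℤ))).filter
    fun j => IsGelfandTsetlin n lam (shift (2 * n - 2) j q)

/-- `{j₃ < ⋯ < j_{N₁}} = K₆(m') ∩ [m, m']`. -/
def posIndices (n m m' : ℕ) (lam : ℕ → ℝ) (q : ℕ → ℕ → ℝ) : Finset ℤ :=
  K6 n m m' lam q ∩ Finset.Icc (m : ℤ) m'

/-- `{k_{N₁+1} < ⋯ < k_{N₂}} = K₆(m') ∩ [-n+1, -m'-1]`. -/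
def negIndices (n m m' : ℕ) (lam : ℕ → ℝ) (q : ℕ → ℕ → ℝ) : Finset ℤ :=
  K6 n m m' lam q ∩ Finset.Icc (-(n : ℤ) + 1) (-(m' : ℤ) - 1)

def N₁ (n m m' : ℕ) (lam : ℕ → ℝ) (q : ℕ → ℕ → ℝ) : ℕ :=
  2 + (posIndices n m m' lam q).card

def N₂ (n m m' : ℕ) (lam : ℕ → ℝ) (q : ℕ → ℕ → ℝ) : ℕ :=
  N₁ n m m' lam q + (negIndices n m m' lam q).card

/-- The index `j_p` (for `3 ≤ p ≤ N₁`), respectively `k_p` (for `N₁ < p ≤ N₂`). -/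
def index (n m m' : ℕ) (lam : ℕ → ℝ) (q : ℕ → ℕ → ℝ) (p : ℕ) : ℤ :=
  ((posIndices n m m' lam q).sort (· ≤ ·) ++ (negIndices n m m' lam q).sort (· ≤ ·)).getD (p - 3) 0

/-- The numbers `α₁, …, α_{N₂}`. -/
def alpha (n m m' : ℕ) (ε : ℝ) (Λ : ℕ → ℝ) (q : ℕ → ℕ → ℝ) (p : ℕ) : ℝ :=
  if p = 1 then
    if m ≤ m' then ε * Λ n + ε * Λ (n + 1)
    else ε * Λ n + max (ε * Λ (n + 1)) (lEven q (n - 1) ((m : ℤ) - 1) - 1)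
  else if p = 2 then
    if m ≤ m' then ε * Λ n + lEven q (n - 1) ((m : ℤ) - 1) - 1
    else ε * Λ n + min (ε * Λ (n + 1)) (lEven q (n - 1) ((m : ℤ) - 1) - 1)
  else ε * Λ n + lEven q (n - 1) (index n m m' (blattner n m Λ) q p) - 1

/-- The numbers `β₃, …, β_{N₂}`. -/
def beta (n m m' : ℕ) (ε : ℝ) (Λ : ℕ → ℝ) (q : ℕ → ℕ → ℝ) (p : ℕ) : ℝ :=
  if p ≤ N₁ n m m' (blattner n m Λ) q then
    ε * Λ n + lOdd q (n - 1) (index n m m' (blattner n m Λ) q p - 1)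
  else ε * Λ n + lOdd q (n - 1) (index n m m' (blattner n m Λ) q p)

/-! ## The system of differential equations -/

/-- The Euler operator `∂_{t₁} = t₁ ∂/∂t₁`. -/
def euler₁ (F : ℂ × ℂ → ℂ) : ℂ × ℂ → ℂ := fun t => t.1 * fderiv ℂ F t (1, 0)

/-- The Euler operator `∂_{t₂} = t₂ ∂/∂t₂`. -/
def euler₂ (F : ℂ × ℂ → ℂ) : ℂ × ℂ → ℂ := fun t => t.2 * fderiv ℂ F t (0, 1)

/-- `∏_{a ∈ as} (∂_{t₂} + a)` applied to `F`. -/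
def eulerProd (as : List ℝ) (F : ℂ × ℂ → ℂ) : ℂ × ℂ → ℂ :=
  as.foldr (fun a G t => euler₂ G t + (a : ℂ) * G t) F

/-- `(∂_{t₁}² - ∂_{t₂}² - t₁²) F`. -/
def firstOp (F : ℂ × ℂ → ℂ) : ℂ × ℂ → ℂ :=
  fun t => euler₁ (euler₁ F) t - euler₂ (euler₂ F) t - t.1 ^ 2 * F t

/-- `{∏_{p=1}^N (∂_{t₂} + α_p) + (t₂/t₁) (∂_{t₁} - ∂_{t₂}) ∏_{p=3}^N (∂_{t₂} + β_p)} F`. -/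
def secondOp (N : ℕ) (α β : ℕ → ℝ) (F : ℂ × ℂ → ℂ) : ℂ × ℂ → ℂ :=
  fun t => eulerProd ((List.range' 1 N).map α) F t +
    t.2 / t.1 * (euler₁ (eulerProd ((List.range' 3 (N - 2)).map β) F) t -
      euler₂ (eulerProd ((List.range' 3 (N - 2)).map β) F) t)

/-- `F` is a holomorphic solution on `V` of the two equations. -/
structure IsSolutionOn (N : ℕ) (α β : ℕ → ℝ) (V : Set (ℂ × ℂ)) (F : ℂ × ℂ → ℂ) : Prop where
  analytic : AnalyticOnNhd ℂ F V
  first : ∀ t ∈ V, firstOp F t = 0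
  second : ∀ t ∈ V, secondOp N α β F t = 0

section Linearity

variable {V : Set (ℂ × ℂ)} {F G F' G' : ℂ × ℂ → ℂ}

theorem analytic_euler₁ (hF : AnalyticOnNhd ℂ F V) : AnalyticOnNhd ℂ (euler₁ F) V := by
  intro t ht
  exact analyticAt_fst.mul
    ((ContinuousLinearMap.apply ℂ ℂ ((1, 0) : ℂ × ℂ)).analyticAt _ |>.comp (hF t ht).fderiv)

theorem analytic_euler₂ (hF : AnalyticOnNhd ℂ F V) : AnalyticOnNhd ℂ (euler₂ F) V := by
  intro t ht
  exact analyticAt_snd.mul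
    ((ContinuousLinearMap.apply ℂ ℂ ((0, 1) : ℂ × ℂ)).analyticAt _ |>.comp (hF t ht).fderiv)

theorem analytic_eulerProd (as : List ℝ) (hF : AnalyticOnNhd ℂ F V) :
    AnalyticOnNhd ℂ (eulerProd as F) V := by
  induction as with
  | nil => exact hF
  | cons a as ih => exact (analytic_euler₂ ih).add (analyticOnNhd_const.mul ih)

theorem euler₁_comb (hV : IsOpen V) (c : ℂ) (hF : AnalyticOnNhd ℂ F V)
    (hG : AnalyticOnNhd ℂ G V) {H : ℂ × ℂ → ℂ} (hH : ∀ t ∈ V, H t = F t + c * G t) :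
    ∀ t ∈ V, euler₁ H t = euler₁ F t + c * euler₁ G t := by
  intro t ht
  have h : H =ᶠ[𝓝 t] fun s => F s + c * G s :=
    Filter.mem_of_superset (hV.mem_nhds ht) fun s hs => hH s hs
  have hF' := (hF t ht).differentiableAt
  have hG' := (hG t ht).differentiableAt
  rw [euler₁, euler₁, euler₁, h.fderiv_eq, fderiv_fun_add hF' (hG'.const_mul c),
    fderiv_const_mul hG']
  simp
  ring

theorem euler₂_comb (hV : IsOpen V) (c : ℂ) (hF : AnalyticOnNhd ℂ F V)
    (hG : AnalyticOnNhd ℂ G V) {H : ℂ × ℂ → ℂ} (hH : ∀ t ∈ V, H t = F t + c * G t) :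
    ∀ t ∈ V, euler₂ H t = euler₂ F t + c * euler₂ G t := by
  intro t ht
  have h : H =ᶠ[𝓝 t] fun s => F s + c * G s :=
    Filter.mem_of_superset (hV.mem_nhds ht) fun s hs => hH s hs
  have hF' := (hF t ht).differentiableAt
  have hG' := (hG t ht).differentiableAt
  rw [euler₂, euler₂, euler₂, h.fderiv_eq, fderiv_fun_add hF' (hG'.const_mul c),
    fderiv_const_mul hG']
  simp
  ring

theorem eulerProd_comb (hV : IsOpen V) (c : ℂ) (as : List ℝ) (hF : AnalyticOnNhd ℂ F V)
    (hG : AnalyticOnNhd ℂ G V) :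
    ∀ t ∈ V, eulerProd as (fun s => F s + c * G s) t = eulerProd as F t + c * eulerProd as G t := by
  induction as with
  | nil => intro t _; rfl
  | cons a as ih =>
    intro t ht
    change euler₂ (eulerProd as _) t + (a : ℂ) * eulerProd as _ t =
      (euler₂ (eulerProd as F) t + (a : ℂ) * eulerProd as F t) +
        c * (euler₂ (eulerProd as G) t + (a : ℂ) * eulerProd as G t)
    rw [euler₂_comb hV c (analytic_eulerProd as hF) (analytic_eulerProd as hG) ih t ht, ih t ht]
    ring

theorem IsSolutionOn.comb {N : ℕ} {α β : ℕ → ℝ} (hV : IsOpen V) (c : ℂ)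
    (hF : IsSolutionOn N α β V F) (hG : IsSolutionOn N α β V G) :
    IsSolutionOn N α β V (fun s => F s + c * G s) where
  analytic := hF.analytic.add (analyticOnNhd_const.mul hG.analytic)
  first := by
    intro t ht
    have h1 := hF.first t ht
    have h2 := hG.first t ht
    simp only [firstOp] at h1 h2 ⊢
    rw [euler₁_comb hV c (analytic_euler₁ hF.analytic) (analytic_euler₁ hG.analytic)
        (euler₁_comb hV c hF.analytic hG.analytic fun _ _ => rfl) t ht,
      euler₂_comb hV c (analytic_euler₂ hF.analytic) (analytic_euler₂ hG.analytic)
        (euler₂_comb hV c hF.analytic hG.analytic fun _ _ => rfl) t ht]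
    linear_combination h1 + c * h2
  second := by
    intro t ht
    have h1 := hF.second t ht
    have h2 := hG.second t ht
    simp only [secondOp] at h1 h2 ⊢
    rw [eulerProd_comb hV c _ hF.analytic hG.analytic t ht,
      euler₁_comb hV c (analytic_eulerProd _ hF.analytic) (analytic_eulerProd _ hG.analytic)
        (eulerProd_comb hV c _ hF.analytic hG.analytic) t ht,
      euler₂_comb hV c (analytic_eulerProd _ hF.analytic) (analytic_eulerProd _ hG.analytic)
        (eulerProd_comb hV c _ hF.analytic hG.analytic) t ht]
    linear_combination h1 + c * h2

theorem euler₁_zero : euler₁ (fun _ => 0) = fun _ => 0 := by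
  funext t; simp [euler₁]

theorem euler₂_zero : euler₂ (fun _ => 0) = fun _ => 0 := by
  funext t; simp [euler₂]

theorem eulerProd_zero (as : List ℝ) : eulerProd as (fun _ => 0) = fun _ => 0 := by
  induction as with
  | nil => rfl
  | cons a as ih =>
    change (fun t => euler₂ (eulerProd as _) t + (a : ℂ) * eulerProd as _ t) = _
    rw [ih, euler₂_zero]
    simp

theorem isSolutionOn_zero (N : ℕ) (α β : ℕ → ℝ) (V : Set (ℂ × ℂ)) :
    IsSolutionOn N α β V (fun _ => 0) where
  analytic := analyticOnNhd_const
  first := by intro t _; simp [firstOp, euler₁_zero, euler₂_zero]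
  second := by intro t _; simp [secondOp, eulerProd_zero, euler₁_zero, euler₂_zero]

end Linearity

/-- The space of holomorphic solutions on the open set `V`, as functions on `V`. -/
def solutionSpace (N : ℕ) (α β : ℕ → ℝ) (V : TopologicalSpace.Opens (ℂ × ℂ)) :
    Submodule ℂ (V → ℂ) where
  carrier := {g | ∃ F : ℂ × ℂ → ℂ, IsSolutionOn N α β V F ∧ ∀ t : V, g t = F t}
  zero_mem' := ⟨fun _ => 0, isSolutionOn_zero N α β V, fun _ => rfl⟩
  add_mem' := by
    rintro a b ⟨F, hF, ha⟩ ⟨G, hG, hb⟩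
    exact ⟨_, hF.comb V.isOpen 1 hG, fun t => by simp [ha, hb]⟩
  smul_mem' := by
    rintro c a ⟨F, hF, ha⟩
    exact ⟨_, (isSolutionOn_zero N α β V).comb V.isOpen c hF, fun t => by simp [ha]⟩

/-! ## Bessel functions and Mellin-Barnes integrals

Multivalued functions of `z ≠ 0` are written as functions of a logarithm `ℓ` of `z`. -/

/-- The modified Bessel function `I_ν(z)`, `z = exp ℓ`, given by
`(z/2)^ν ∑ₖ (z/2)^{2k} / (k! Γ(ν+k+1))`. At the poles of the Gamma function, `1/Γ` has the value
`0` here, as it should. -/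
def besselI (ν ℓ : ℂ) : ℂ :=
  Complex.exp (ν * (ℓ - Real.log 2)) *
    ∑' k : ℕ, (Complex.exp ℓ / 2) ^ (2 * k) / ((k.factorial : ℂ) * Complex.Gamma (ν + k + 1))

/-- The modified Bessel function `K_ν(z)`, `z = exp ℓ`, given by
`(π/2) (I_{-ν}(z) - I_ν(z)) / sin νπ`, and by the limit of this expression at integral `ν`. -/
def besselK (ν ℓ : ℂ) : ℂ :=
  if Complex.sin (ν * Real.pi) = 0 then
    Filter.limUnder (𝓝[≠] ν) fun μ =>
      Real.pi / 2 * ((besselI (-μ) ℓ - besselI μ ℓ) / Complex.sin (μ * Real.pi))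
  else Real.pi / 2 * ((besselI (-ν) ℓ - besselI ν ℓ) / Complex.sin (ν * Real.pi))

/-- The two families of solutions. -/
inductive Kind : Type
  | K : Kind
  | I : Kind

/-- `K_ν(exp ℓ)` or `I_ν(exp ℓ)`. -/
def bessel : Kind → ℂ → ℂ → ℂ
  | Kind.K => besselK
  | Kind.I => besselI

/-- The quotient of Gamma functions in the integrand of `f_j^K`, `f_j^I`. For `j = 1` this is
`∏_{p=1}^N Γ(-α_p-s) / ∏_{p=3}^N Γ(1-β_p-s)`. -/
def gammaQuotient (N : ℕ) (α β : ℕ → ℝ) (j : ℕ) (s : ℂ) : ℂ :=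
  ((∏ p ∈ Finset.Icc j N, Complex.Gamma (-(α p : ℂ) - s)) *
      ∏ p ∈ Finset.Icc 3 j, Complex.Gamma ((β p : ℂ) + s)) /
    ((∏ p ∈ Finset.Icc 1 (j - 1), Complex.Gamma (1 + (α p : ℂ) + s)) *
      ∏ p ∈ Finset.Icc (max 3 (j + 1)) N, Complex.Gamma (1 - (β p : ℂ) - s))

/-- The integrand of `f_j^L`; `ℓ₁` is a logarithm of `t₁`, and `ℓ₂` is a logarithm of the base
(`t₂` or `-t₂`) of the power that occurs in `f_j^L`. -/
def integrand (N : ℕ) (α β : ℕ → ℝ) (j : ℕ) (L : Kind) (ℓ₁ ℓ₂ s : ℂ) : ℂ :=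
  gammaQuotient N α β j s * (Complex.exp (s * ℓ₂) * bessel L (-s) ℓ₁)

/-- Absolute convergence of the integral of `F` over the loop which comes from `+∞ - ih`, runs to
`c - ih`, crosses the real axis upwards at `c`, and returns from `c + ih` to `+∞ + ih`. -/
def LoopIntegrable (c h : ℝ) (F : ℂ → ℂ) : Prop :=
  MeasureTheory.IntegrableOn (fun x : ℝ => F (x - h * Complex.I)) (Set.Ioi c) ∧
  IntervalIntegrable (fun y : ℝ => F (c + y * Complex.I)) MeasureTheory.volume (-h) h ∧
  MeasureTheory.IntegrableOn (fun x : ℝ => F (x + h * Complex.I)) (Set.Ioi c)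

/-- The integral of `F` over that loop, which encircles `[c, +∞)` once in the negative
direction. -/
def loopIntegral (c h : ℝ) (F : ℂ → ℂ) : ℂ :=
  -(∫ x in Set.Ioi c, F (x - h * Complex.I)) +
    Complex.I * (∫ y in (-h)..h, F (c + y * Complex.I)) +
    ∫ x in Set.Ioi c, F (x + h * Complex.I)

/-- `f_j^L`, as a function of `ℓ₁` and `ℓ₂`, with the loop determined by `c` and `h`. -/
def mellinBarnes (N : ℕ) (α β : ℕ → ℝ) (c h : ℝ) (j : ℕ) (L : Kind) (ℓ₁ ℓ₂ : ℂ) : ℂ :=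
  1 / (2 * Real.pi * Complex.I) * loopIntegral c h (integrand N α β j L ℓ₁ ℓ₂)

/-- The logarithm that enters `f_j^L`: given logarithms `a` of `t₂` and `b` of `-t₂`, it is `a` for
`f_1^K` and `f_j^I` (`j ≥ 2`), and `b` for `f_1^I` and `f_j^K` (`j ≥ 2`). -/
def logBase (j : ℕ) (L : Kind) (a b : ℂ) : ℂ :=
  match L with
  | Kind.K => if j = 1 then a else b
  | Kind.I => if j = 1 then b else a

/-- The functions `f_1^K, f_1^I, …, f_N^K, f_N^I` on `V`, for branches `L₁`, `L₂`, `L₂'` of `log t₁`,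
`log t₂`, `log (-t₂)` on `V`; the loop for `f_j` is determined by `c j` and `h j`. -/
def solutionFamily (N : ℕ) (α β c h : ℕ → ℝ) (V : TopologicalSpace.Opens (ℂ × ℂ))
    (L₁ L₂ L₂' : ℂ × ℂ → ℂ) (i : Fin N × Kind) : V → ℂ :=
  fun t => mellinBarnes N α β (c (i.1 + 1)) (h (i.1 + 1)) (i.1 + 1) i.2 (L₁ t)
    (logBase (i.1 + 1) i.2 (L₂ t) (L₂' t))

/-- The constant in the leading term of `f_j^K`, `f_j^I` at `t₂ = 0`. -/
def leadingCoeff (N : ℕ) (α β : ℕ → ℝ) (j : ℕ) : ℝ :=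
  ((∏ p ∈ Finset.Icc (j + 1) N, Real.Gamma (α j - α p)) *
      ∏ p ∈ Finset.Icc 3 j, Real.Gamma (β p - α j)) /
    ((∏ p ∈ Finset.Icc 1 (j - 1), Real.Gamma (1 + α p - α j)) *
      ∏ p ∈ Finset.Icc (max 3 (j + 1)) N, Real.Gamma (α j - β p + 1))

end SpinWhittaker

end

open SpinWhittaker

/-! The representation theory enters through one fact: the exponents are integers with α₁ ≥ α₂ ≥ β₃
> α₃ ≥ β₄ > ⋯ > α_N, where N = N₂ (`interlacing_of_pattern`). This is the interlacing of the rows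
2n-2 and 2n-3 of the pattern, made strict on one side by the shifts in the l-coordinates.

Solutions. Let B be K or I. The function t₂^s B_{-s}(t₁) solves the first equation because of the
modified Bessel equation. On it ∂_{t₂} + a acts as multiplication by s + a, and ∂_{t₁} - ∂_{t₂}
replaces B_{-s} by ±t₁ B_{-s-1}. The second equation therefore becomes a difference equation of
order one for the weight, satisfied by the Gamma quotients (`gammaQuotient_recurrence`). It requires
moving the loop by 1, which crosses no pole because ∏ (s + α_p) cancels the one at -α_j
(`exp_mul_loopIntegral_shift`).

Convergence. The quotient has the size of Γ(1-s)² and the Bessel function that of 1/Γ(1-s), up to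
exponentials. The remaining factor Γ(1-s) decays on the half-strip, away from the integers, faster
than every exponential (`rapidKernel_mbKernel`).

Leading terms. Moving the loop across the simple pole at -α_j picks up the residue, and the new
integral is smaller by a factor |t₂|^{1/2} (`exists_mellinBarnes_asymptotic`).

Upper bound for the dimension. The equations and their first derivatives bound the derivatives of
the 2N-component jet (∂₂^b F, ∂₂^b ∂₁ F), b < N, by the jet itself (`isBigO_euler_jet`). By
Gronwall's inequality a solution on a connected set is determined by its jet at a point
(`finite_solutionSpace`).

Independence. A linear relation on V extends analytically to all values of the logarithms
(`linearIndependent_solutionFamily`). The leading powers of t₂ then separate the indices j, and the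
independence of K_n and I_n separates the two kinds (`coeff_eq_zero_of_lead`). If α₁ = α₂, the
integrand of f₁ has a double pole; instead, the monodromy around t₂ = 0 maps f₁ to f₁ plus a nonzero
multiple of f₂ on another branch, while it fixes the leading terms of the others
(`coeff_first_eq_zero`). Thus 2N independent solutions lie in a space of dimension at most 2N. -/

namespace SpinWhittaker

/-! ### Consequences of the interlacing of the exponents. -/

/-- The interlacing property `α₁ ≥ α₂ ≥ β₃ > α₃ ≥ β₄ > ⋯ > α_N` of integral exponents. -/
structure Interlacing (N : ℕ) (α β : ℕ → ℝ) : Prop where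
  two_le : 2 ≤ N
  int_alpha : ∀ p, 1 ≤ p → p ≤ N → ∃ k : ℤ, α p = k
  int_beta : ∀ p, 3 ≤ p → p ≤ N → ∃ k : ℤ, β p = k
  first : α 2 ≤ α 1
  lt : ∀ p, 3 ≤ p → p ≤ N → α p < β p
  le : ∀ p, 3 ≤ p → p ≤ N → β p ≤ α (p - 1)

namespace Interlacing

variable {N : ℕ} {α β : ℕ → ℝ}

theorem alpha_lt_of_lt (H : Interlacing N α β) {p r : ℕ} (hp : 2 ≤ p) (hpr : p < r) (hr : r ≤ N) :
    α r < α p := by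
  induction r, hpr using Nat.le_induction with
  | base => exact (H.lt (p + 1) (by omega) hr).trans_le (H.le (p + 1) (by omega) hr)
  | succ r hpr ih =>
    exact ((H.lt (r + 1) (by omega) hr).trans_le (H.le (r + 1) (by omega) hr)).trans
      (ih (by omega))

theorem alpha_le_of_le (H : Interlacing N α β) {p r : ℕ} (hp : 1 ≤ p) (hpr : p ≤ r) (hr : r ≤ N) :
    α r ≤ α p := by
  rcases hpr.eq_or_lt with rfl | hlt
  · exact le_rfl
  rcases hp.eq_or_lt with rfl | hp
  · rcases (show 2 ≤ r by omega).eq_or_lt with rfl | h2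
    · exact H.first
    · exact (H.alpha_lt_of_lt le_rfl h2 hr).le.trans H.first
  · exact (H.alpha_lt_of_lt hp hlt hr).le

/-- The first inequality of the chain is the only weak one between consecutive α's, so α₁ = α₂ is
the only possible coincidence. The alternative in the hypothesis excludes exactly this case. -/
theorem alpha_lt_of_lt' (H : Interlacing N α β) {p r : ℕ} (hp : 1 ≤ p) (hpr : p < r) (hr : r ≤ N)
    (h : α 1 ≠ α 2 ∨ 2 ≤ p) : α r < α p := by
  rcases hp.eq_or_lt with rfl | hp
  · have h12 : α 2 < α 1 := lt_of_le_of_ne H.first fun e => by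
      rcases h with h | h
      · exact h e.symm
      · omega
    exact (H.alpha_le_of_le (by omega) (show 2 ≤ r by omega) hr).trans_lt h12
  · exact H.alpha_lt_of_lt hp hpr hr

theorem add_one_le_of_lt {x y : ℝ} (hx : ∃ k : ℤ, x = k) (hy : ∃ k : ℤ, y = k) (h : x < y) :
    x + 1 ≤ y := by
  obtain ⟨a, rfl⟩ := hx
  obtain ⟨b, rfl⟩ := hy
  exact_mod_cast Int.add_one_le_of_lt (by exact_mod_cast h)

theorem alpha_add_one_le (H : Interlacing N α β) {p r : ℕ} (hp : 1 ≤ p) (hpr : p < r)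
    (hr : r ≤ N) (h : α 1 ≠ α 2 ∨ 2 ≤ p) : α r + 1 ≤ α p :=
  add_one_le_of_lt (H.int_alpha r (by omega) hr) (H.int_alpha p hp (by omega))
    (H.alpha_lt_of_lt' hp hpr hr h)

theorem alpha_add_one_le_beta (H : Interlacing N α β) {p r : ℕ} (hp : 3 ≤ p) (hpr : p ≤ r)
    (hr : r ≤ N) : α r + 1 ≤ β p :=
  (add_le_add_left (H.alpha_le_of_le (by omega) hpr hr) 1).trans
    (add_one_le_of_lt (H.int_alpha p (by omega) (by omega)) (H.int_beta p hp (by omega))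
      (H.lt p hp (by omega)))

theorem beta_le_alpha (H : Interlacing N α β) {p r : ℕ} (hp : 1 ≤ p) (hpr : p < r) (h3 : 3 ≤ r)
    (hr : r ≤ N) : β r ≤ α p :=
  (H.le r h3 hr).trans (H.alpha_le_of_le hp (by omega) (by omega))

end Interlacing

/-! ### Interlacing of the exponents that come from a Gelfand-Tsetlin pattern. -/

section Pattern

variable {n m m' : ℕ} {ε : ℝ} {Λ : ℕ → ℝ} {q : ℕ → ℕ → ℝ}

/-- The indices j_p and k_p are stored as two sorted blocks in one list. Only membership and strict
increase within each block are needed of them. -/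
theorem getD_sort_append (s t : Finset ℤ) (i : ℕ) :
    (i < s.card → (s.sort (· ≤ ·) ++ t.sort (· ≤ ·)).getD i 0 ∈ s) ∧
    (s.card ≤ i → i < s.card + t.card → (s.sort (· ≤ ·) ++ t.sort (· ≤ ·)).getD i 0 ∈ t) ∧
    (i + 1 < s.card → (s.sort (· ≤ ·) ++ t.sort (· ≤ ·)).getD i 0 <
      (s.sort (· ≤ ·) ++ t.sort (· ≤ ·)).getD (i + 1) 0) ∧
    (s.card ≤ i → i + 1 < s.card + t.card → (s.sort (· ≤ ·) ++ t.sort (· ≤ ·)).getD i 0 <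
      (s.sort (· ≤ ·) ++ t.sort (· ≤ ·)).getD (i + 1) 0) := by
  refine ⟨fun h => ?_, fun h1 h2 => ?_, fun h => ?_, fun h1 h2 => ?_⟩
  · rw [List.getD_append _ _ _ _ (by simpa using h), List.getD_eq_getElem _ _ (by simpa using h)]
    exact (Finset.mem_sort _).1 (List.getElem_mem _)
  · rw [List.getD_append_right _ _ _ _ (by simpa using h1),
      List.getD_eq_getElem _ _ (by simp; omega)]
    exact (Finset.mem_sort _).1 (List.getElem_mem _)
  · rw [List.getD_append _ _ _ _ (by simp; omega), List.getD_append _ _ _ _ (by simpa using h),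
      List.getD_eq_getElem _ _ (by simp; omega), List.getD_eq_getElem _ _ (by simpa using h)]
    exact (Finset.sortedLT_sort s).strictMono_get (by simp)
  · rw [List.getD_append_right _ _ _ _ (by simp; omega),
      List.getD_append_right _ _ _ _ (by simp; omega),
      List.getD_eq_getElem _ _ (by simp; omega), List.getD_eq_getElem _ _ (by simp; omega)]
    exact (Finset.sortedLT_sort t).strictMono_get (by simp; omega)

theorem index_mem_pos {lam : ℕ → ℝ} {p : ℕ} (hp : 3 ≤ p) (hp' : p ≤ N₁ n m m' lam q) :
    (m : ℤ) ≤ index n m m' lam q p ∧ index n m m' lam q p ≤ m' := by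
  have h := (getD_sort_append (posIndices n m m' lam q) (negIndices n m m' lam q) (p - 3)).1
    (by unfold N₁ at hp'; omega)
  exact Finset.mem_Icc.1 (Finset.mem_inter.1 h).2

theorem index_mem_neg {lam : ℕ → ℝ} {p : ℕ} (hp : N₁ n m m' lam q < p)
    (hp' : p ≤ N₂ n m m' lam q) :
    -(n : ℤ) + 1 ≤ index n m m' lam q p ∧ index n m m' lam q p ≤ -(m' : ℤ) - 1 := by
  have h := (getD_sort_append (posIndices n m m' lam q) (negIndices n m m' lam q) (p - 3)).2.1
    (by unfold N₁ at hp; omega) (by unfold N₂ at hp'; unfold N₁ at hp hp'; omega)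
  exact Finset.mem_Icc.1 (Finset.mem_inter.1 h).2

theorem index_lt_pos {lam : ℕ → ℝ} {p : ℕ} (hp : 4 ≤ p) (hp' : p ≤ N₁ n m m' lam q) :
    index n m m' lam q (p - 1) < index n m m' lam q p := by
  have h := (getD_sort_append (posIndices n m m' lam q) (negIndices n m m' lam q)
    (p - 1 - 3)).2.2.1 (by unfold N₁ at hp'; omega)
  rwa [show p - 1 - 3 + 1 = p - 3 by omega] at h

theorem index_lt_neg {lam : ℕ → ℝ} {p : ℕ} (hp : N₁ n m m' lam q + 1 < p)
    (hp' : p ≤ N₂ n m m' lam q) :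
    index n m m' lam q (p - 1) < index n m m' lam q p := by
  have h := (getD_sort_append (posIndices n m m' lam q) (negIndices n m m' lam q)
    (p - 1 - 3)).2.2.2 (by unfold N₁ at hp; omega) (by unfold N₂ at hp'; unfold N₁ at hp hp'; omega)
  rwa [show p - 1 - 3 + 1 = p - 3 by unfold N₁ at hp; omega] at h

/-- All comparisons of entries below are walks along the chain q_{2n-2,1} ≥ q_{2n-3,1} ≥ q_{2n-2,2}
≥ ⋯ ≥ q_{2n-2,n-1} ≥ |q_{2n-3,n-1}|. -/
theorem rows_chain {lam : ℕ → ℝ} (hn : 2 ≤ n) (hq : IsGelfandTsetlin n lam q) :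
    (∀ j, 1 ≤ j → j < n → q (2 * n - 3) j ≤ q (2 * n - 2) j) ∧
    (∀ j, 1 ≤ j → j + 1 < n → q (2 * n - 2) (j + 1) ≤ q (2 * n - 3) j) ∧
    -q (2 * n - 2) (n - 1) ≤ q (2 * n - 3) (n - 1) := by
  have e1 : 2 * (n - 1) - 1 = 2 * n - 3 := by omega
  have e2 : 2 * (n - 1) = 2 * n - 2 := by omega
  have h1 := hq.even_odd (n - 1) (by omega) (by omega)
  have h2 := hq.even_odd_last (n - 1) (by omega) (by omega)
  rw [e1, e2] at h1 h2
  refine ⟨fun j hj hj' => ?_, fun j hj hj' => (h1 j hj (by omega)).2, h2.2⟩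
  rcases (show j ≤ n - 1 by omega).eq_or_lt with rfl | h
  · exact h2.1
  · exact (h1 j hj h).1

theorem row_even_antitone {lam : ℕ → ℝ} (hn : 2 ≤ n) (hq : IsGelfandTsetlin n lam q) {i j : ℕ}
    (hi : 1 ≤ i) (hij : i ≤ j) (hj : j < n) : q (2 * n - 2) j ≤ q (2 * n - 2) i := by
  obtain ⟨h1, h2, -⟩ := rows_chain hn hq
  induction j, hij using Nat.le_induction with
  | base => exact le_rfl
  | succ j hij ih =>
    exact ((h2 j (by omega) hj).trans (h1 j (by omega) (by omega))).trans (ih (by omega))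

theorem row_odd_le_even {lam : ℕ → ℝ} (hn : 2 ≤ n) (hq : IsGelfandTsetlin n lam q) {i j : ℕ}
    (hi : 1 ≤ i) (hij : i ≤ j) (hj : j < n) : q (2 * n - 3) j ≤ q (2 * n - 2) i :=
  ((rows_chain hn hq).1 j (by omega) hj).trans (row_even_antitone hn hq hi hij hj)

theorem row_even_le_odd {lam : ℕ → ℝ} (hn : 2 ≤ n) (hq : IsGelfandTsetlin n lam q) {i j : ℕ}
    (hi : 1 ≤ i) (hij : i < j) (hj : j < n) : q (2 * n - 2) j ≤ q (2 * n - 3) i :=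
  (row_even_antitone hn hq (by omega) (show i + 1 ≤ j from hij) hj).trans
    ((rows_chain hn hq).2.1 i hi (by omega))

/-- The entry q_{2n-2,n-1} dominates |q_{2n-3,n-1}|, hence is nonnegative; every other entry of the
two rows is at least as large as it. This allows the passage from the positive to the negative
indices. -/
theorem neg_row_odd_le_even {lam : ℕ → ℝ} (hn : 2 ≤ n) (hq : IsGelfandTsetlin n lam q) {i j : ℕ}
    (hi : 1 ≤ i) (hi' : i < n) (hj : 1 ≤ j) (hj' : j < n) :
    -q (2 * n - 3) j ≤ q (2 * n - 2) i := by
  have h1 := (rows_chain hn hq).2.2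
  have h2 := (rows_chain hn hq).1 (n - 1) (by omega) (by omega)
  have h3 := row_even_antitone hn hq hi (show i ≤ n - 1 by omega) (by omega)
  rcases (show j ≤ n - 1 by omega).eq_or_lt with rfl | h
  · linarith
  · have := row_even_le_odd hn hq hj h (by omega)
    linarith

theorem lEven_natCast (hn : 2 ≤ n) {j : ℕ} (hj : 1 ≤ j) :
    lEven q (n - 1) (j : ℤ) = q (2 * n - 2) j + n - j := by
  rw [lEven, if_pos (by omega), Int.natAbs_natCast, show 2 * (n - 1) = 2 * n - 2 by omega,
    Nat.cast_sub (by omega)]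
  push_cast
  ring

theorem lEven_neg_natCast (hn : 2 ≤ n) {j : ℕ} (hj : 1 ≤ j) :
    lEven q (n - 1) (-(j : ℤ)) = -(q (2 * n - 2) j + n - j) + 1 := by
  rw [lEven, if_neg (by omega), if_pos (by omega), Int.natAbs_neg, Int.natAbs_natCast,
    show 2 * (n - 1) = 2 * n - 2 by omega, Nat.cast_sub (by omega)]
  push_cast
  ring

theorem lOdd_natCast (hn : 2 ≤ n) {j : ℕ} (hj : 1 ≤ j) :
    lOdd q (n - 1) (j : ℤ) = q (2 * n - 3) j + n - 1 - j := by
  rw [lOdd, if_pos (by omega), Int.natAbs_natCast, show 2 * (n - 1) - 1 = 2 * n - 3 by omega,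
    Nat.cast_sub (by omega)]
  push_cast
  ring

theorem lOdd_neg_natCast (hn : 2 ≤ n) {j : ℕ} (hj : 1 ≤ j) :
    lOdd q (n - 1) (-(j : ℤ)) = -(q (2 * n - 3) j + n - 1 - j) := by
  rw [lOdd, if_neg (by omega), Int.natAbs_neg, Int.natAbs_natCast,
    show 2 * (n - 1) - 1 = 2 * n - 3 by omega, Nat.cast_sub (by omega)]
  push_cast
  ring

/-- Harish-Chandra parameter and pattern are integral or half-integral simultaneously. -/
theorem exists_common_class (hm : 2 ≤ m) (hmn : m ≤ n) (hΛ : IsHarishChandra n m ε Λ)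
    (hq : IsGelfandTsetlin n (blattner n m Λ) q) :
    ∃ δ : ℝ, (∃ k : ℤ, 2 * δ = k) ∧ (∀ i, 1 ≤ i → i ≤ n + 1 → ∃ k : ℤ, Λ i = k + δ) ∧
      ∀ i j, 1 ≤ i → i ≤ 2 * n - 1 → 1 ≤ j → j ≤ (i + 1) / 2 → ∃ k : ℤ, q i j = k + δ := by
  -- The entry q_{2n-1,1} = λ₁ = Λ₁ - n + 2 links the two integrality classes: if they differed, an
  -- even integer would be equal to 1.
  have htop := hq.top 1 (Finset.mem_Icc.2 ⟨le_rfl, by omega⟩)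
  rw [blattner, if_pos (by omega)] at htop
  have key : ∀ a b : ℤ, q (2 * n - 1) 1 = a → Λ 1 = b + 1 / 2 → False := by
    intro a b ha hb
    rw [ha, hb] at htop
    have h : (2 * (a - b + n - 2) : ℝ) = 1 := by push_cast at htop ⊢; linarith
    have h' : (2 * (a - b + n - 2) : ℤ) = 1 := by exact_mod_cast h
    omega
  have key' : ∀ a b : ℤ, q (2 * n - 1) 1 = a + 1 / 2 → Λ 1 = b → False := by
    intro a b ha hb
    rw [ha, hb] at htop
    have h : (2 * (b - a - n + 2) : ℝ) = 1 := by push_cast at htop ⊢; linarith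
    have h' : (2 * (b - a - n + 2) : ℤ) = 1 := by exact_mod_cast h
    omega
  have m1 : 2 * n - 1 ∈ Finset.Icc 1 (2 * n - 1) := Finset.mem_Icc.2 ⟨by omega, le_rfl⟩
  have m2 : 1 ∈ Finset.Icc 1 ((2 * n - 1 + 1) / 2) := Finset.mem_Icc.2 ⟨le_rfl, by omega⟩
  have m3 : 1 ∈ Finset.Icc 1 (n + 1) := Finset.mem_Icc.2 ⟨le_rfl, by omega⟩
  rcases hΛ.integral with h1 | h1 <;> rcases hq.integral with h2 | h2
  · refine ⟨0, ⟨0, by simp⟩, fun i hi hi' => ?_, fun i j hi hi' hj hj' => ?_⟩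
    · simpa using h1 i (Finset.mem_Icc.2 ⟨hi, hi'⟩)
    · simpa using h2 i (Finset.mem_Icc.2 ⟨hi, hi'⟩) j (Finset.mem_Icc.2 ⟨hj, hj'⟩)
  · obtain ⟨a, ha⟩ := h2 _ m1 _ m2
    obtain ⟨b, hb⟩ := h1 _ m3
    exact (key' a b ha hb).elim
  · obtain ⟨a, ha⟩ := h2 _ m1 _ m2
    obtain ⟨b, hb⟩ := h1 _ m3
    exact (key a b ha hb).elim
  · exact ⟨1 / 2, ⟨1, by norm_num⟩, fun i hi hi' => h1 i (Finset.mem_Icc.2 ⟨hi, hi'⟩),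
      fun i j hi hi' hj hj' => h2 i (Finset.mem_Icc.2 ⟨hi, hi'⟩) j (Finset.mem_Icc.2 ⟨hj, hj'⟩)⟩

theorem exists_int_of_class {δ x y : ℝ} (hδ : ∃ k : ℤ, 2 * δ = k) (hε : ε = 1 ∨ ε = -1)
    (hx : ∃ k : ℤ, x = k + δ) (hy : ∃ k : ℤ, y = k + δ) :
    (∃ k : ℤ, ε * x + y = k) ∧ (∃ k : ℤ, ε * x - y = k) ∧ ∃ k : ℤ, ε * x + ε * y = k := by
  obtain ⟨d, hd⟩ := hδ
  obtain ⟨a, rfl⟩ := hx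
  obtain ⟨b, rfl⟩ := hy
  rcases hε with rfl | rfl
  · exact ⟨⟨a + b + d, by push_cast; linarith⟩, ⟨a - b, by push_cast; linarith⟩,
      ⟨a + b + d, by push_cast; linarith⟩⟩
  · exact ⟨⟨b - a, by push_cast; linarith⟩, ⟨-a - b - d, by push_cast; linarith⟩,
      ⟨-a - b - d, by push_cast; linarith⟩⟩

/-- Away from the start of the chain this is the interlacing of the rows 2n-2 and 2n-3 together with
the l-shifts. The special form of the pattern is needed only where Λ_{n+1} occurs, that is, for α₁ ≥
α₂ and α₂ ≥ β₃. -/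
theorem interlacing_of_pattern (hm : 2 ≤ m) (hmn : m ≤ n) (hmm' : m ≤ m' + 1) (hm'n : m' + 1 ≤ n)
    (hε : ε = 1 ∨ ε = -1) (hΛ : IsHarishChandra n m ε Λ)
    (hq : IsGelfandTsetlin n (blattner n m Λ) q)
    (hQ : IsSpecial n m m' (blattner n m Λ) q) :
    Interlacing (N₂ n m m' (blattner n m Λ) q) (alpha n m m' ε Λ q) (beta n m m' ε Λ q) := by
  have hn : 2 ≤ n := hm.trans hmn
  obtain ⟨δ, hδ, hΛδ, hqδ⟩ := exists_common_class hm hmn hΛ hq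
  have hΛn := hΛδ n (by omega) (by omega)
  have hqa : ∀ j, 1 ≤ j → j < n → ∃ k : ℤ, q (2 * n - 2) j = k + δ := fun j hj hj' =>
    hqδ _ j (by omega) (by omega) hj (by omega)
  have hqb : ∀ j, 1 ≤ j → j < n → ∃ k : ℤ, q (2 * n - 3) j = k + δ := fun j hj hj' =>
    hqδ _ j (by omega) (by omega) hj (by omega)
  have hα3 : ∀ p, 3 ≤ p → alpha n m m' ε Λ q p =
      ε * Λ n + lEven q (n - 1) (index n m m' (blattner n m Λ) q p) - 1 := fun p hp => by
    rw [alpha, if_neg (by omega), if_neg (by omega)]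
  have hm1 : ((m : ℤ) - 1) = ((m - 1 : ℕ) : ℤ) := by omega
  have hcm1 : ((m - 1 : ℕ) : ℝ) = (m : ℝ) - 1 := by
    rw [Nat.cast_sub (by omega)]; simp
  have hL : lEven q (n - 1) ((m : ℤ) - 1) = q (2 * n - 2) (m - 1) + n - m + 1 := by
    rw [hm1, lEven_natCast hn (by omega), hcm1]
    ring
  have hN1 : 2 ≤ N₁ n m m' (blattner n m Λ) q := by unfold N₁; omega
  have hN12 : N₁ n m m' (blattner n m Λ) q ≤ N₂ n m m' (blattner n m Λ) q := by unfold N₂; omega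
  -- the indices
  have hpos : ∀ p, 3 ≤ p → p ≤ N₁ n m m' (blattner n m Λ) q → ∃ k : ℕ, m ≤ k ∧ k ≤ m' ∧
      index n m m' (blattner n m Λ) q p = k ∧
      alpha n m m' ε Λ q p = ε * Λ n + (q (2 * n - 2) k + n - k) - 1 ∧
      beta n m m' ε Λ q p = ε * Λ n + (q (2 * n - 3) (k - 1) + n - k) := by
    intro p hp hp'
    obtain ⟨h1, h2⟩ := index_mem_pos hp hp'
    obtain ⟨k, hk⟩ := Int.eq_ofNat_of_zero_le (show 0 ≤ index n m m' (blattner n m Λ) q p by omega)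
    refine ⟨k, by omega, by omega, hk, ?_, ?_⟩
    · rw [hα3 p hp, hk, lEven_natCast hn (by omega)]
    · rw [beta, if_pos hp', hk, show (k : ℤ) - 1 = ((k - 1 : ℕ) : ℤ) by omega,
        lOdd_natCast hn (by omega), Nat.cast_sub (by omega)]
      push_cast
      ring
  have hneg : ∀ p, N₁ n m m' (blattner n m Λ) q < p → p ≤ N₂ n m m' (blattner n m Λ) q →
      ∃ k : ℕ, m' + 1 ≤ k ∧ k < n ∧
      index n m m' (blattner n m Λ) q p = -(k : ℤ) ∧
      alpha n m m' ε Λ q p = ε * Λ n - (q (2 * n - 2) k + n - k) ∧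
      beta n m m' ε Λ q p = ε * Λ n - (q (2 * n - 3) k + n - 1 - k) := by
    intro p hp hp'
    obtain ⟨h1, h2⟩ := index_mem_neg hp hp'
    obtain ⟨k, hk⟩ := Int.eq_ofNat_of_zero_le
      (show 0 ≤ -index n m m' (blattner n m Λ) q p by omega)
    have hk' : index n m m' (blattner n m Λ) q p = -(k : ℤ) := by omega
    refine ⟨k, by omega, by omega, hk', ?_, ?_⟩
    · rw [hα3 p (by omega), hk', lEven_neg_natCast hn (by omega)]
      ring
    · rw [beta, if_neg (by omega), hk', lOdd_neg_natCast hn (by omega)]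
      ring
  have hcast : ∀ {a b : ℕ}, a ≤ b → (a : ℝ) ≤ b := fun h => by exact_mod_cast h
  -- the first two exponents
  have h21 : alpha n m m' ε Λ q 2 ≤ alpha n m m' ε Λ q 1 := by
    rw [alpha, alpha, if_neg (by omega), if_pos rfl, if_pos rfl]
    split_ifs with h
    -- Here q_{2n-2,m-1} = λ_m, so that l_{2n-2,m-1} - 1 = Λ_m, and this is at most εΛ_{n+1}.
    · have h1 := (hQ.before (m - 1) (by omega) (by omega)).1
      rw [show m - 1 + 1 = m by omega, blattner, if_neg (by omega)] at h1
      have h2 := (hΛ.noncompact_ge m le_rfl hmn).2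
      rw [hL, h1]
      linarith
    · have := min_le_max (a := ε * Λ (n + 1)) (b := lEven q (n - 1) ((m : ℤ) - 1) - 1)
      linarith
  have int1 : ∃ k : ℤ, ε * Λ n + ε * Λ (n + 1) = k :=
    (exists_int_of_class hδ hε hΛn (hΛδ (n + 1) (by omega) le_rfl)).2.2
  have int2 : ∃ k : ℤ, ε * Λ n + (lEven q (n - 1) ((m : ℤ) - 1) - 1) = k := by
    obtain ⟨k, hk⟩ := (exists_int_of_class hδ hε hΛn (hqa (m - 1) (by omega) (by omega))).1
    refine ⟨k + n - m, ?_⟩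
    rw [hL]
    push_cast
    linarith
  -- bounds for the first two exponents from below
  have hβ3 : ∀ p, p = 3 → p ≤ N₂ n m m' (blattner n m Λ) q →
      beta n m m' ε Λ q p ≤ alpha n m m' ε Λ q 2 := by
    intro p hp hp'
    have hb : beta n m m' ε Λ q p ≤ ε * Λ n + (q (2 * n - 2) (m - 1) + n - m) := by
      rcases le_or_gt p (N₁ n m m' (blattner n m Λ) q) with hpN | hpN
      · obtain ⟨k, hk1, hk2, -, -, hk⟩ := hpos p (by omega) hpN
        have h1 := row_odd_le_even hn hq (show 1 ≤ m - 1 by omega) (show m - 1 ≤ k - 1 by omega)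
          (by omega)
        have := hcast hk1
        linarith
      · obtain ⟨k, hk1, hk2, -, -, hk⟩ := hneg p hpN hp'
        have h1 := neg_row_odd_le_even hn hq (show 1 ≤ m - 1 by omega) (by omega)
          (show 1 ≤ k by omega) hk2
        have := hcast hmn
        have := hcast (show k + 1 ≤ n by omega)
        push_cast at this
        linarith
    rw [alpha, if_neg (by omega), if_pos rfl]
    split_ifs with h
    · rw [hL]; linarith
    -- For m' = m - 1 the exponent α₂ is a minimum, and β₃ has to be compared with the Λ_{n+1}-term
    -- as well. The interval [m, m'] is empty, so the index is negative.
    · have hle : beta n m m' ε Λ q p ≤ ε * Λ n + ε * Λ (n + 1) := by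
        have hpN : N₁ n m m' (blattner n m Λ) q < p := by
          by_contra hcon
          obtain ⟨k, hk1, hk2, -⟩ := hpos p (by omega) (by omega)
          omega
        obtain ⟨k, hk1, hk2, -, -, hk⟩ := hneg p hpN hp'
        have hkn := hcast (show k + 1 ≤ n by omega)
        push_cast at hkn
        -- For k = n - 1 the bound passes through q_{2n-2,n-1} = λ_{n-1} = Λ_{n-1} - 1. For k < n -
        -- 1 the entry q_{2n-3,k} is nonnegative, and εΛ_{n+1} ≥ |Λ_n| ≥ 0.
        rcases (show k ≤ n - 1 by omega).eq_or_lt with hkn' | hkn'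
        · have h1 := (rows_chain hn hq).2.2
          have h2 := (hQ.after (n - 1) (by omega) (by omega)).1
          rw [blattner, if_neg (by omega), Nat.cast_sub (by omega)] at h2
          have h3 := (hΛ.noncompact_ge (n - 1) (by omega) (by omega)).2
          rw [hkn'] at hk
          push_cast [Nat.cast_sub (show 1 ≤ n by omega)] at h2 hk
          linarith
        · have h1 := row_even_le_odd hn hq (show 1 ≤ k by omega) hkn' (by omega)
          have h2 := (rows_chain hn hq).2.2
          have h3 := (rows_chain hn hq).1 (n - 1) (by omega) (by omega)
          have h4 := (hΛ.noncompact_ge n hmn le_rfl)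
          linarith [h4.1, h4.2]
      rw [← min_add_add_left, le_min_iff]
      refine ⟨hle, ?_⟩
      rw [hL]; linarith
  refine ⟨hN1.trans hN12, fun p hp hp' => ?_, fun p hp hp' => ?_, h21, fun p hp hp' => ?_,
    fun p hp hp' => ?_⟩
  · rcases (show p = 1 ∨ p = 2 ∨ 3 ≤ p by omega) with rfl | rfl | h3
    · rw [alpha, if_pos rfl]
      split_ifs
      · exact int1
      · rw [← max_add_add_left]
        rcases max_choice (ε * Λ n + ε * Λ (n + 1))
          (ε * Λ n + (lEven q (n - 1) ((m : ℤ) - 1) - 1)) with h | h <;> rw [h]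
        · exact int1
        · exact int2
    · rw [alpha, if_neg (by omega), if_pos rfl]
      split_ifs
      · obtain ⟨k, hk⟩ := int2
        exact ⟨k, by linarith⟩
      · rw [← min_add_add_left]
        rcases min_choice (ε * Λ n + ε * Λ (n + 1))
          (ε * Λ n + (lEven q (n - 1) ((m : ℤ) - 1) - 1)) with h | h <;> rw [h]
        · exact int1
        · exact int2
    · rcases le_or_gt p (N₁ n m m' (blattner n m Λ) q) with hpN | hpN
      · obtain ⟨k, hk1, hk2, -, hk, -⟩ := hpos p h3 hpN
        obtain ⟨a, ha⟩ := (exists_int_of_class hδ hε hΛn (hqa k (by omega) (by omega))).1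
        exact ⟨a + n - k - 1, by push_cast; linarith⟩
      · obtain ⟨k, hk1, hk2, -, hk, -⟩ := hneg p hpN hp'
        obtain ⟨a, ha⟩ := (exists_int_of_class hδ hε hΛn (hqa k (by omega) (by omega))).2.1
        exact ⟨a - n + k, by push_cast; linarith⟩
  · rcases le_or_gt p (N₁ n m m' (blattner n m Λ) q) with hpN | hpN
    · obtain ⟨k, hk1, hk2, -, -, hk⟩ := hpos p hp hpN
      obtain ⟨a, ha⟩ := (exists_int_of_class hδ hε hΛn (hqb (k - 1) (by omega) (by omega))).1
      exact ⟨a + n - k, by push_cast; linarith⟩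
    · obtain ⟨k, hk1, hk2, -, -, hk⟩ := hneg p hpN hp'
      obtain ⟨a, ha⟩ := (exists_int_of_class hδ hε hΛn (hqb k (by omega) (by omega))).2.1
      exact ⟨a - n + 1 + k, by push_cast; linarith⟩
  · rcases le_or_gt p (N₁ n m m' (blattner n m Λ) q) with hpN | hpN
    · obtain ⟨k, hk1, hk2, -, hka, hkb⟩ := hpos p hp hpN
      have := row_even_le_odd hn hq (show 1 ≤ k - 1 by omega) (show k - 1 < k by omega) (by omega)
      linarith
    · obtain ⟨k, hk1, hk2, -, hka, hkb⟩ := hneg p hpN hp'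
      have := row_odd_le_even hn hq (show 1 ≤ k by omega) le_rfl hk2
      linarith
  · rcases (show p = 3 ∨ 4 ≤ p by omega) with h3 | h4
    · have := hβ3 p h3 hp'
      rwa [show p - 1 = 2 by omega]
    rcases le_or_gt p (N₁ n m m' (blattner n m Λ) q) with hpN | hpN
    · obtain ⟨k, hk1, hk2, hki, -, hkb⟩ := hpos p hp hpN
      obtain ⟨l, hl1, hl2, hli, hla, -⟩ := hpos (p - 1) (by omega) (by omega)
      have hlt := index_lt_pos (n := n) (q := q) h4 hpN
      rw [hki, hli] at hlt
      have := row_odd_le_even hn hq (show 1 ≤ l by omega) (show l ≤ k - 1 by omega) (by omega)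
      have := hcast (show l + 1 ≤ k by omega)
      push_cast at this
      linarith
    · obtain ⟨k, hk1, hk2, hki, -, hkb⟩ := hneg p hpN hp'
      have hkn := hcast (show k + 1 ≤ n by omega)
      push_cast at hkn
      rcases (show p - 1 ≤ N₁ n m m' (blattner n m Λ) q ∨
        N₁ n m m' (blattner n m Λ) q + 1 < p by omega) with h | h
      · obtain ⟨l, hl1, hl2, hli, hla, -⟩ := hpos (p - 1) (by omega) h
        have := neg_row_odd_le_even hn hq (show 1 ≤ l by omega) (by omega) (show 1 ≤ k by omega) hk2
        have := hcast (show l + 1 ≤ n by omega)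
        push_cast at this
        linarith
      · obtain ⟨l, hl1, hl2, hli, hla, -⟩ := hneg (p - 1) (by omega) (by omega)
        have hlt := index_lt_neg (n := n) (q := q) h hp'
        rw [hki, hli] at hlt
        have := row_even_le_odd hn hq (show 1 ≤ k by omega) (show k < l by omega) (by omega)
        have := hcast (show k + 1 ≤ l by omega)
        push_cast at this
        linarith

end Pattern
end SpinWhittaker

namespace SpinWhittaker

/-! ### Power series of the modified Bessel functions and their dependence on the order. -/

/-- The regularised confluent hypergeometric limit function `∑ yᵏ / (k! Γ(ν + k + 1))`. -/
noncomputable def hypLimit (ν y : ℂ) : ℂ :=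
  ∑' k : ℕ, y ^ k / ((k.factorial : ℂ) * Complex.Gamma (ν + k + 1))

/-- For k ≥ M ≥ R one has |ν + k + 1| ≥ 1, so |1/Γ(ν + k + 1)| no longer increases with k. The
finitely many smaller k are handled by compactness, as 1/Γ is entire. The uniform bound makes the
series converge like an exponential series, locally uniformly in ν. -/
theorem exists_inv_Gamma_bound (R : ℝ) :
    ∃ C : ℝ, 0 ≤ C ∧ ∀ ν : ℂ, ‖ν‖ ≤ R → ∀ k : ℕ, ‖(Complex.Gamma (ν + k + 1))⁻¹‖ ≤ C := by
  have hc : ∀ k : ℕ, Continuous fun ν : ℂ => (Complex.Gamma (ν + k + 1))⁻¹ := fun k =>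
    Complex.differentiable_one_div_Gamma.continuous.comp (by fun_prop)
  obtain ⟨M, hM⟩ := exists_nat_ge R
  have hfin : ∀ K : ℕ, ∃ C : ℝ, 0 ≤ C ∧ ∀ ν : ℂ, ‖ν‖ ≤ R → ∀ k ≤ K,
      ‖(Complex.Gamma (ν + k + 1))⁻¹‖ ≤ C := by
    intro K
    induction K with
    | zero =>
      obtain ⟨C, hC⟩ := (isCompact_closedBall (0 : ℂ) R).exists_bound_of_continuousOn
        (hc 0).continuousOn
      refine ⟨max C 0, le_max_right _ _, fun ν hν k hk => ?_⟩
      obtain rfl : k = 0 := by omega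
      exact (hC ν (by simpa using hν)).trans (le_max_left _ _)
    | succ K ih =>
      obtain ⟨C', hC0, hC'⟩ := ih
      obtain ⟨C, hC⟩ := (isCompact_closedBall (0 : ℂ) R).exists_bound_of_continuousOn
        (hc (K + 1)).continuousOn
      refine ⟨max C C', le_max_of_le_right hC0, fun ν hν k hk => ?_⟩
      rcases hk.eq_or_lt with rfl | hk
      · exact (hC ν (by simpa using hν)).trans (le_max_left _ _)
      · exact (hC' ν hν k (by omega)).trans (le_max_right _ _)
  obtain ⟨C, hC0, hC⟩ := hfin M
  refine ⟨C, hC0, fun ν hν k => ?_⟩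
  rcases le_total k M with hk | hk
  · exact hC ν hν k hk
  induction k, hk using Nat.le_induction with
  | base => exact hC ν hν M le_rfl
  | succ k hk ih =>
    have h1 : 1 ≤ ‖ν + k + 1‖ := by
      have h2 : ‖((k : ℂ) + 1)‖ = (k : ℝ) + 1 := by
        rw [← Nat.cast_succ, Complex.norm_natCast]; simp
      have h3 := norm_sub_norm_le ((k : ℂ) + 1) (-ν)
      rw [h2, norm_neg] at h3
      have h4 : (M : ℝ) ≤ k := by exact_mod_cast hk
      have h5 : ((k : ℂ) + 1) - -ν = ν + k + 1 := by ring
      rw [h5] at h3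
      linarith
    have h0 : ν + k + 1 ≠ 0 := norm_pos_iff.1 (by linarith)
    have h6 : ν + ((k + 1 : ℕ) : ℂ) + 1 = (ν + k + 1) + 1 := by push_cast; ring
    rw [h6, Complex.Gamma_add_one _ h0, mul_inv, norm_mul, norm_inv]
    calc _ ≤ 1 * C := mul_le_mul (inv_le_one_of_one_le₀ h1) ih (norm_nonneg _) zero_le_one
      _ = C := one_mul C

theorem hypLimit_term_bound {C : ℝ} {ν : ℂ} {k : ℕ}
    (hC : ‖(Complex.Gamma (ν + k + 1))⁻¹‖ ≤ C) {y : ℂ} {r : ℝ} (hy : ‖y‖ ≤ r) :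
    ‖y ^ k / ((k.factorial : ℂ) * Complex.Gamma (ν + k + 1))‖ ≤ C * (r ^ k / k.factorial) := by
  rw [div_eq_mul_inv, mul_inv, norm_mul, norm_mul, norm_pow, norm_inv, Complex.norm_natCast]
  have hC0 : 0 ≤ C := (norm_nonneg _).trans hC
  have hr : 0 ≤ r := (norm_nonneg _).trans hy
  calc ‖y‖ ^ k * ((k.factorial : ℝ)⁻¹ * ‖(Complex.Gamma (ν + k + 1))⁻¹‖)
      ≤ r ^ k * ((k.factorial : ℝ)⁻¹ * C) := by gcongr
    _ = C * (r ^ k / k.factorial) := by ring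

theorem summable_exp_bound (C r : ℝ) : Summable fun k : ℕ => C * (r ^ k / k.factorial) :=
  (Real.summable_pow_div_factorial r).mul_left C

theorem summable_hypLimit (ν y : ℂ) :
    Summable fun k : ℕ => y ^ k / ((k.factorial : ℂ) * Complex.Gamma (ν + k + 1)) := by
  obtain ⟨C, -, hC⟩ := exists_inv_Gamma_bound ‖ν‖
  exact Summable.of_norm_bounded (summable_exp_bound C ‖y‖)
    fun k => hypLimit_term_bound (hC ν le_rfl k) le_rfl

theorem continuous_hypLimit : Continuous fun x : ℂ × ℂ => hypLimit x.1 x.2 := by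
  rw [continuous_iff_continuousAt]
  rintro x
  obtain ⟨C, -, hC⟩ := exists_inv_Gamma_bound (‖x‖ + 1)
  have h : ContinuousOn (fun x : ℂ × ℂ => hypLimit x.1 x.2) (Metric.ball 0 (‖x‖ + 1)) := by
    refine continuousOn_tsum (fun k => ?_) (summable_exp_bound C (‖x‖ + 1)) fun k z hz => ?_
    · have h1 : Continuous fun z : ℂ × ℂ => (Complex.Gamma (z.1 + k + 1))⁻¹ :=
        Complex.differentiable_one_div_Gamma.continuous.comp (by fun_prop)
      have h2 : Continuous fun z : ℂ × ℂ => z.2 ^ k * ((k.factorial : ℂ)⁻¹ *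
          (Complex.Gamma (z.1 + k + 1))⁻¹) := by fun_prop
      simpa only [div_eq_mul_inv, mul_inv] using h2.continuousOn
    · have hz' : ‖z‖ < ‖x‖ + 1 := by simpa using hz
      exact hypLimit_term_bound (hC z.1 ((norm_fst_le z).trans hz'.le) k)
        ((norm_snd_le z).trans hz'.le)
  exact h.continuousAt (Metric.isOpen_ball.mem_nhds (by simp))

theorem differentiable_hypLimit_left (y : ℂ) : Differentiable ℂ fun ν => hypLimit ν y := by
  intro ν
  obtain ⟨C, -, hC⟩ := exists_inv_Gamma_bound (‖ν‖ + 1)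
  have h : DifferentiableOn ℂ (fun ν => hypLimit ν y) (Metric.ball 0 (‖ν‖ + 1)) := by
    refine Complex.differentiableOn_tsum_of_summable_norm (summable_exp_bound C ‖y‖) (fun k => ?_)
      Metric.isOpen_ball fun k z hz => ?_
    · have h1 : Differentiable ℂ fun z : ℂ => (Complex.Gamma (z + k + 1))⁻¹ :=
        Complex.differentiable_one_div_Gamma.comp (by fun_prop)
      have h2 : Differentiable ℂ fun z : ℂ => y ^ k * ((k.factorial : ℂ)⁻¹ *
          (Complex.Gamma (z + k + 1))⁻¹) := by fun_prop
      simpa only [div_eq_mul_inv, mul_inv] using h2.differentiableOn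
    · have hz' : ‖z‖ < ‖ν‖ + 1 := by simpa using hz
      exact hypLimit_term_bound (hC z hz'.le k) le_rfl
  exact h.differentiableAt (Metric.isOpen_ball.mem_nhds (by simp))

theorem hypLimit_shift (ν : ℂ) (k : ℕ) (y : ℂ) :
    ((k + 1 : ℕ) : ℂ) * y ^ k / (((k + 1).factorial : ℂ) * Complex.Gamma (ν + (k + 1 : ℕ) + 1)) =
      y ^ k / ((k.factorial : ℂ) * Complex.Gamma (ν + 1 + k + 1)) := by
  have h1 : ((k + 1 : ℕ) : ℂ) ≠ 0 := Nat.cast_ne_zero.2 (Nat.succ_ne_zero k)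
  rw [Nat.factorial_succ, Nat.cast_mul, mul_assoc, mul_div_mul_left _ _ h1]
  congr 3
  push_cast
  ring

theorem tsum_hypLimit_deriv (ν y : ℂ) :
    ∑' k : ℕ, (k : ℂ) * y ^ (k - 1) / ((k.factorial : ℂ) * Complex.Gamma (ν + k + 1)) =
      hypLimit (ν + 1) y := by
  have hs : Summable fun k : ℕ =>
      (k : ℂ) * y ^ (k - 1) / ((k.factorial : ℂ) * Complex.Gamma (ν + k + 1)) := by
    rw [← summable_nat_add_iff 1]
    refine (summable_hypLimit (ν + 1) y).congr fun k => ?_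
    rw [Nat.add_sub_cancel, hypLimit_shift]
  rw [hs.tsum_eq_zero_add, hypLimit]
  simp only [Nat.add_sub_cancel, hypLimit_shift]
  simp

theorem hasDerivAt_hypLimit (ν y : ℂ) :
    HasDerivAt (fun y => hypLimit ν y) (hypLimit (ν + 1) y) y := by
  obtain ⟨C, hC0, hC⟩ := exists_inv_Gamma_bound ‖ν‖
  rw [← tsum_hypLimit_deriv]
  have hu : Summable fun k : ℕ => C * ((k : ℝ) * (‖y‖ + 1) ^ (k - 1) / k.factorial) := by
    refine Summable.mul_left C ?_
    rw [← summable_nat_add_iff 1]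
    refine (Real.summable_pow_div_factorial (‖y‖ + 1)).congr fun k => ?_
    have h1 : ((k + 1 : ℕ) : ℝ) ≠ 0 := Nat.cast_ne_zero.2 (Nat.succ_ne_zero k)
    rw [Nat.add_sub_cancel, Nat.factorial_succ, Nat.cast_mul, mul_div_mul_left _ _ h1]
  have hy : y ∈ Metric.ball (0 : ℂ) (‖y‖ + 1) := by simp
  refine hasDerivAt_tsum_of_isPreconnected
    (g := fun (k : ℕ) (z : ℂ) => z ^ k / ((k.factorial : ℂ) * Complex.Gamma (ν + k + 1)))
    (g' := fun (k : ℕ) (z : ℂ) =>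
      (k : ℂ) * z ^ (k - 1) / ((k.factorial : ℂ) * Complex.Gamma (ν + k + 1)))
    hu Metric.isOpen_ball (convex_ball _ _).isPreconnected (fun k z _ => ?_) (fun k z hz => ?_)
    hy (summable_hypLimit ν y) hy
  · exact (hasDerivAt_pow k z).div_const _
  · have hz' : ‖z‖ ≤ ‖y‖ + 1 := by
      have : ‖z‖ < ‖y‖ + 1 := by simpa using hz
      exact this.le
    have hk := hC ν le_rfl k
    rw [div_eq_mul_inv, mul_inv, norm_mul, norm_mul, norm_mul, norm_pow, norm_inv,
      Complex.norm_natCast, Complex.norm_natCast]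
    calc (k : ℝ) * ‖z‖ ^ (k - 1) * ((k.factorial : ℝ)⁻¹ * ‖(Complex.Gamma (ν + k + 1))⁻¹‖)
        ≤ (k : ℝ) * (‖y‖ + 1) ^ (k - 1) * ((k.factorial : ℝ)⁻¹ * C) := by gcongr
      _ = C * ((k : ℝ) * (‖y‖ + 1) ^ (k - 1) / k.factorial) := by ring

/-- No exception is needed at the poles: there Γ has the default value 0, and the inverse of 0 is 0,
the true value of 1/Γ. -/
theorem inv_Gamma_eq (z : ℂ) : (Complex.Gamma z)⁻¹ = z * (Complex.Gamma (z + 1))⁻¹ := by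
  rcases eq_or_ne z 0 with rfl | hz
  · simp
  · rw [Complex.Gamma_add_one z hz, mul_inv, mul_inv_cancel_left₀ hz]

/-- Termwise, 1/Γ(ν + k) = (ν + k)/Γ(ν + k + 1). The summand with the factor k gives y times the
derived series. -/
theorem hypLimit_recurrence (ν y : ℂ) :
    hypLimit (ν - 1) y = ν * hypLimit ν y + y * hypLimit (ν + 1) y := by
  have hs : Summable fun k : ℕ =>
      (k : ℂ) * y ^ (k - 1) / ((k.factorial : ℂ) * Complex.Gamma (ν + k + 1)) := by
    rw [← summable_nat_add_iff 1]
    refine (summable_hypLimit (ν + 1) y).congr fun k => ?_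
    rw [Nat.add_sub_cancel, hypLimit_shift]
  rw [← tsum_hypLimit_deriv, hypLimit, hypLimit, ← tsum_mul_left, ← tsum_mul_left,
    ← ((summable_hypLimit ν y).mul_left ν).tsum_add (hs.mul_left y)]
  refine tsum_congr fun k => ?_
  have h1 : ν - 1 + k + 1 = ν + k := by ring
  have h2 : y * y ^ (k - 1) * k = y ^ k * k := by
    rcases k with _ | k
    · simp
    · rw [Nat.add_sub_cancel, pow_succ']
  rw [h1]
  simp only [div_eq_mul_inv, mul_inv]
  rw [inv_Gamma_eq (ν + k)]
  linear_combination -((k.factorial : ℂ)⁻¹ * (Complex.Gamma (ν + k + 1))⁻¹) * h2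

/-- The recurrence has order two, so the induction carries two consecutive orders. -/
theorem hypLimit_neg_natCast (n : ℕ) (y : ℂ) : hypLimit (-n) y = y ^ n * hypLimit n y := by
  have h : hypLimit (-(n : ℂ)) y = y ^ n * hypLimit n y ∧
      hypLimit (-((n + 1 : ℕ) : ℂ)) y = y ^ (n + 1) * hypLimit (n + 1 : ℕ) y := by
    induction n with
    | zero =>
      refine ⟨by simp, ?_⟩
      have := hypLimit_recurrence 0 y
      simpa using this
    | succ n ih =>
      refine ⟨ih.2, ?_⟩
      have h1 := hypLimit_recurrence (-((n + 1 : ℕ) : ℂ)) y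
      have h2 := hypLimit_recurrence (((n + 1 : ℕ) : ℂ)) y
      have e1 : -((n + 1 : ℕ) : ℂ) - 1 = -((n + 1 + 1 : ℕ) : ℂ) := by push_cast; ring
      have e2 : -((n + 1 : ℕ) : ℂ) + 1 = -(n : ℂ) := by push_cast; ring
      have e3 : ((n + 1 : ℕ) : ℂ) - 1 = (n : ℂ) := by push_cast; ring
      have e4 : ((n + 1 : ℕ) : ℂ) + 1 = ((n + 1 + 1 : ℕ) : ℂ) := by push_cast; ring
      rw [e1, e2] at h1
      rw [e3, e4] at h2
      rw [h1, ih.1, ih.2]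
      rw [h2]
      ring
  exact h.1

/-! ### The function `I` -/

theorem besselI_eq (ν ℓ : ℂ) : besselI ν ℓ =
    Complex.exp (ν * (ℓ - Real.log 2)) * hypLimit ν ((Complex.exp ℓ / 2) ^ 2) := by
  rw [besselI, hypLimit]
  simp only [← pow_mul]

theorem exp_log_two : Complex.exp (Real.log 2 : ℂ) = 2 := by
  rw [← Complex.ofReal_exp, Real.exp_log two_pos]
  norm_num

theorem exp_sub_log_two (ν ℓ : ℂ) : Complex.exp ((ν + 1) * (ℓ - Real.log 2)) =
    Complex.exp (ν * (ℓ - Real.log 2)) * (Complex.exp ℓ / 2) := by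
  rw [add_mul, one_mul, Complex.exp_add, Complex.exp_sub, exp_log_two]

theorem hasDerivAt_besselI (ν ℓ : ℂ) :
    HasDerivAt (besselI ν) (ν * besselI ν ℓ + Complex.exp ℓ * besselI (ν + 1) ℓ) ℓ := by
  have h1 : HasDerivAt (fun ℓ : ℂ => (Complex.exp ℓ / 2) ^ 2)
      (2 * (Complex.exp ℓ / 2) ^ 2) ℓ := by
    convert! ((Complex.hasDerivAt_exp ℓ).div_const 2).pow 2 using 1
    ring
  have h2 : HasDerivAt (fun ℓ : ℂ => Complex.exp (ν * (ℓ - Real.log 2)))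
      (Complex.exp (ν * (ℓ - Real.log 2)) * ν) ℓ := by
    convert! (((hasDerivAt_id ℓ).sub_const (Real.log 2 : ℂ)).const_mul ν).cexp using 1
    simp
  have h3 := h2.mul ((hasDerivAt_hypLimit ν ((Complex.exp ℓ / 2) ^ 2)).comp ℓ h1)
  have h4 : besselI ν = fun ℓ => Complex.exp (ν * (ℓ - Real.log 2)) *
      hypLimit ν ((Complex.exp ℓ / 2) ^ 2) := funext fun ℓ => besselI_eq ν ℓ
  rw [h4]
  convert! h3 using 1
  dsimp only [Function.comp_apply]
  rw [besselI_eq (ν + 1), exp_sub_log_two]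
  ring

theorem besselI_recurrence (ν ℓ : ℂ) :
    Complex.exp ℓ * besselI (ν - 1) ℓ =
      2 * ν * besselI ν ℓ + Complex.exp ℓ * besselI (ν + 1) ℓ := by
  have h := exp_sub_log_two (ν - 1) ℓ
  rw [sub_add_cancel] at h
  rw [besselI_eq, besselI_eq, besselI_eq, exp_sub_log_two ν, hypLimit_recurrence, h]
  ring

theorem continuous_besselI : Continuous fun x : ℂ × ℂ => besselI x.1 x.2 := by
  simp only [besselI_eq]
  have h : Continuous fun x : ℂ × ℂ => hypLimit x.1 ((Complex.exp x.2 / 2) ^ 2) :=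
    continuous_hypLimit.comp (f := fun x : ℂ × ℂ => (x.1, (Complex.exp x.2 / 2) ^ 2)) (by fun_prop)
  fun_prop

theorem differentiable_besselI_left (ℓ : ℂ) : Differentiable ℂ fun ν => besselI ν ℓ := by
  simp only [besselI_eq]
  have := differentiable_hypLimit_left ((Complex.exp ℓ / 2) ^ 2)
  fun_prop

theorem besselI_neg_natCast (n : ℕ) (ℓ : ℂ) : besselI (-n) ℓ = besselI n ℓ := by
  rw [besselI_eq, besselI_eq, hypLimit_neg_natCast, ← mul_assoc]
  congr 1
  have h : (Complex.exp ℓ / 2) = Complex.exp (ℓ - Real.log 2) := by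
    rw [Complex.exp_sub, exp_log_two]
  rw [h, ← pow_mul, ← Complex.exp_nat_mul, ← Complex.exp_add]
  congr 1
  push_cast
  ring

theorem besselI_neg_intCast (n : ℤ) (ℓ : ℂ) : besselI (-n) ℓ = besselI n ℓ := by
  obtain ⟨k, rfl | rfl⟩ := n.eq_nat_or_neg
  · exact_mod_cast besselI_neg_natCast k ℓ
  · have := besselI_neg_natCast k ℓ
    push_cast
    rw [neg_neg]
    exact this.symm

theorem besselI_add_two_pi (ν ℓ : ℂ) : besselI ν (ℓ + 2 * Real.pi * Complex.I) =
    Complex.exp (2 * Real.pi * Complex.I * ν) * besselI ν ℓ := by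
  rw [besselI_eq, besselI_eq, Complex.exp_periodic, ← mul_assoc, ← Complex.exp_add]
  congr 2
  ring

end SpinWhittaker

namespace SpinWhittaker

/-! ### The function `K` -/

theorem sin_int_mul_pi_eq_zero_iff (ν : ℂ) : Complex.sin (ν * Real.pi) = 0 ↔ ∃ k : ℤ, ν = k := by
  rw [Complex.sin_eq_zero_iff]
  have hpi : (Real.pi : ℂ) ≠ 0 := by exact_mod_cast Real.pi_ne_zero
  exact exists_congr fun k => ⟨fun h => mul_right_cancel₀ hpi h, fun h => by rw [h]⟩

theorem besselK_of_sin_ne_zero {ν : ℂ} (h : Complex.sin (ν * Real.pi) ≠ 0) (ℓ : ℂ) :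
    besselK ν ℓ = Real.pi / 2 * ((besselI (-ν) ℓ - besselI ν ℓ) / Complex.sin (ν * Real.pi)) :=
  if_neg h

theorem differentiable_besselI_sub (ℓ : ℂ) :
    Differentiable ℂ fun μ => besselI (-μ) ℓ - besselI μ ℓ :=
  ((differentiable_besselI_left ℓ).comp differentiable_neg).sub (differentiable_besselI_left ℓ)

theorem differentiable_sin_mul_pi : Differentiable ℂ fun μ : ℂ => Complex.sin (μ * Real.pi) := by
  fun_prop

theorem Differentiable.dslope {f : ℂ → ℂ} (hf : Differentiable ℂ f) (c : ℂ) :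
    Differentiable ℂ (dslope f c) := by
  rw [← differentiableOn_univ]
  exact (Complex.differentiableOn_dslope Filter.univ_mem).2 hf.differentiableOn

theorem dslope_sin_ne_zero (n : ℤ) :
    dslope (fun μ : ℂ => Complex.sin (μ * Real.pi)) n n ≠ 0 := by
  have hpi : (Real.pi : ℂ) ≠ 0 := by exact_mod_cast Real.pi_ne_zero
  have h : HasDerivAt (fun μ : ℂ => Complex.sin (μ * Real.pi))
      (Complex.cos (n * Real.pi) * Real.pi) (n : ℂ) := by
    convert! ((hasDerivAt_id (n : ℂ)).mul_const (Real.pi : ℂ)).csin using 1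
    simp
  rw [dslope_same, h.deriv]
  refine mul_ne_zero (fun h0 => ?_) hpi
  have h1 := Complex.sin_sq_add_cos_sq (n * Real.pi)
  rw [h0, (sin_int_mul_pi_eq_zero_iff n).2 ⟨n, rfl⟩] at h1
  norm_num at h1

/-- Near an integer, `K_ν` is a quotient of divided differences. -/
theorem besselK_eventuallyEq (n : ℤ) (ℓ : ℂ) :
    ∃ Q : ℂ → ℂ, DifferentiableAt ℂ Q n ∧ (fun ν => besselK ν ℓ) =ᶠ[𝓝 (n : ℂ)] Q ∧
      Filter.Tendsto (fun μ => Real.pi / 2 *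
        ((besselI (-μ) ℓ - besselI μ ℓ) / Complex.sin (μ * Real.pi))) (𝓝[≠] (n : ℂ)) (𝓝 (Q n)) := by
  set f : ℂ → ℂ := fun μ => besselI (-μ) ℓ - besselI μ ℓ with hf
  set g : ℂ → ℂ := fun μ => Complex.sin (μ * Real.pi) with hg
  have hfd : Differentiable ℂ f := differentiable_besselI_sub ℓ
  have hgd : Differentiable ℂ g := differentiable_sin_mul_pi
  have hfn : f n = 0 := by simp [hf, besselI_neg_intCast]
  have hgn : g n = 0 := (sin_int_mul_pi_eq_zero_iff n).2 ⟨n, rfl⟩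
  -- Numerator and denominator both vanish at n, the numerator because I_{-n} = I_n. Dividing each
  -- by μ - n removes the singularity, since the sine has a simple zero.
  set Q : ℂ → ℂ := fun μ => Real.pi / 2 * (dslope f n μ / dslope g n μ) with hQ
  have hQd : DifferentiableAt ℂ Q n :=
    (((hfd.dslope n) n).div ((hgd.dslope n) n) (dslope_sin_ne_zero n)).const_mul _
  have heq : ∀ μ : ℂ, μ ≠ n → Real.pi / 2 * (f μ / g μ) = Q μ := by
    intro μ hμ
    have h1 : μ - n ≠ 0 := sub_ne_zero.2 hμ
    simp only [hQ]
    rw [dslope_of_ne _ hμ, dslope_of_ne _ hμ, slope_def_field, slope_def_field, hfn, hgn,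
      sub_zero, sub_zero, div_div_div_cancel_right₀ h1]
  have hlim : Filter.Tendsto (fun μ => Real.pi / 2 * (f μ / g μ)) (𝓝[≠] (n : ℂ)) (𝓝 (Q n)) := by
    refine (hQd.continuousAt.tendsto.mono_left nhdsWithin_le_nhds).congr' ?_
    filter_upwards [self_mem_nhdsWithin] with μ hμ
    exact (heq μ hμ).symm
  refine ⟨Q, hQd, ?_, hlim⟩
  -- The zeros of sin πμ are the integers, and n is the only one at distance less than 1 from n.
  have hne : ∀ᶠ μ : ℂ in 𝓝 (n : ℂ), μ = n ∨ g μ ≠ 0 := by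
    filter_upwards [Metric.ball_mem_nhds (n : ℂ) one_pos] with μ hμ
    by_contra hcon
    push Not at hcon
    obtain ⟨k, hk⟩ := (sin_int_mul_pi_eq_zero_iff μ).1 hcon.2
    rw [hk, Metric.mem_ball, dist_eq_norm, ← Int.cast_sub, Complex.norm_intCast] at hμ
    have h2 : |k - n| < 1 := by exact_mod_cast hμ
    rw [Int.abs_lt_one_iff, sub_eq_zero] at h2
    exact hcon.1 (by rw [hk, h2])
  filter_upwards [hne] with μ hμ
  rcases hμ with rfl | hμ
  · rw [besselK, if_pos hgn]
    exact hlim.limUnder_eq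
  · rw [besselK_of_sin_ne_zero hμ]
    refine heq μ ?_
    rintro rfl
    exact hμ hgn

theorem differentiable_besselK_left (ℓ : ℂ) : Differentiable ℂ fun ν => besselK ν ℓ := by
  intro ν
  by_cases h : Complex.sin (ν * Real.pi) = 0
  · obtain ⟨n, rfl⟩ := (sin_int_mul_pi_eq_zero_iff ν).1 h
    obtain ⟨Q, hQ, hKQ, -⟩ := besselK_eventuallyEq n ℓ
    exact hKQ.differentiableAt_iff.2 hQ
  · have hev : (fun ν => besselK ν ℓ) =ᶠ[𝓝 ν] fun μ => Real.pi / 2 *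
        ((besselI (-μ) ℓ - besselI μ ℓ) / Complex.sin (μ * Real.pi)) := by
      filter_upwards [differentiable_sin_mul_pi.continuous.continuousAt.eventually_ne h] with μ hμ
      exact besselK_of_sin_ne_zero hμ ℓ
    refine hev.differentiableAt_iff.2 ?_
    exact (((differentiable_besselI_sub ℓ) ν).div (differentiable_sin_mul_pi ν) h).const_mul _

theorem tendsto_besselK_int (n : ℤ) (ℓ : ℂ) :
    Filter.Tendsto (fun μ => Real.pi / 2 *
      ((besselI (-μ) ℓ - besselI μ ℓ) / Complex.sin (μ * Real.pi)))
      (𝓝[≠] (n : ℂ)) (𝓝 (besselK n ℓ)) := by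
  obtain ⟨Q, -, hKQ, hlim⟩ := besselK_eventuallyEq n ℓ
  rwa [← hKQ.self_of_nhds] at hlim

/-- For μ near n the monodromy factors e^{±2πiμ} of I_{±μ} turn the difference of the two values
into -πi (e^{-πiμ} I_{-μ} + e^{πiμ} I_μ), without a denominator; the limit at n is then immediate.
This is the contribution of the logarithm in K_n. -/
theorem besselK_int_add_two_pi (n : ℤ) (ℓ : ℂ) :
    besselK n (ℓ + 2 * Real.pi * Complex.I) =
      besselK n ℓ - 2 * Real.pi * Complex.I * Complex.exp (Real.pi * Complex.I * n) *
        besselI n ℓ := by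
  have h1 := (tendsto_besselK_int n (ℓ + 2 * Real.pi * Complex.I)).sub (tendsto_besselK_int n ℓ)
  have h2 : Filter.Tendsto (fun μ : ℂ => -(Real.pi * Complex.I) *
      (Complex.exp (-(Real.pi * Complex.I * μ)) * besselI (-μ) ℓ +
        Complex.exp (Real.pi * Complex.I * μ) * besselI μ ℓ)) (𝓝[≠] (n : ℂ))
      (𝓝 (-(Real.pi * Complex.I) *
      (Complex.exp (-(Real.pi * Complex.I * n)) * besselI (-n) ℓ +
        Complex.exp (Real.pi * Complex.I * n) * besselI n ℓ))) := by
    have hI := (differentiable_besselI_left ℓ).continuous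
    have hc : Continuous fun μ : ℂ => -(Real.pi * Complex.I) *
      (Complex.exp (-(Real.pi * Complex.I * μ)) * besselI (-μ) ℓ +
        Complex.exp (Real.pi * Complex.I * μ) * besselI μ ℓ) := by fun_prop
    exact (hc.tendsto (n : ℂ)).mono_left nhdsWithin_le_nhds
  have hne : ∀ᶠ μ in 𝓝[≠] (n : ℂ), Complex.sin (μ * Real.pi) ≠ 0 := by
    filter_upwards [self_mem_nhdsWithin,
      mem_nhdsWithin_of_mem_nhds (Metric.ball_mem_nhds (n : ℂ) one_pos)] with μ hμn hμ hcon
    obtain ⟨k, hk⟩ := (sin_int_mul_pi_eq_zero_iff μ).1 hcon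
    rw [hk, Metric.mem_ball, dist_eq_norm, ← Int.cast_sub, Complex.norm_intCast] at hμ
    have h2 : |k - n| < 1 := by exact_mod_cast hμ
    rw [Int.abs_lt_one_iff, sub_eq_zero] at h2
    exact hμn (by rw [hk, h2]; rfl)
  have h3 := tendsto_nhds_unique (h1.congr' (f₂ := fun μ : ℂ => -(Real.pi * Complex.I) *
      (Complex.exp (-(Real.pi * Complex.I * μ)) * besselI (-μ) ℓ +
        Complex.exp (Real.pi * Complex.I * μ) * besselI μ ℓ)) (by
    filter_upwards [hne] with μ hμ
    rw [besselI_add_two_pi, besselI_add_two_pi]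
    have e1 : Complex.exp (2 * Real.pi * Complex.I * μ) =
        Complex.exp (Real.pi * Complex.I * μ) ^ 2 := by
      rw [← Complex.exp_nat_mul]; congr 1; push_cast; ring
    have e2 : Complex.exp (2 * Real.pi * Complex.I * -μ) =
        Complex.exp (-(Real.pi * Complex.I * μ)) ^ 2 := by
      rw [← Complex.exp_nat_mul]; congr 1; push_cast; ring
    have e3 : Complex.exp (-(Real.pi * Complex.I * μ)) *
        Complex.exp (Real.pi * Complex.I * μ) = 1 := by
      rw [← Complex.exp_add]; simp
    have e4 : Complex.sin (μ * Real.pi) = (Complex.exp (-(Real.pi * Complex.I * μ)) -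
        Complex.exp (Real.pi * Complex.I * μ)) * Complex.I / 2 := by
      rw [Complex.sin]
      congr 4 <;> ring_nf
    rw [e1, e2, ← mul_sub, ← sub_div, mul_div_assoc', div_eq_iff hμ, e4]
    set E := Complex.exp (Real.pi * Complex.I * μ)
    set F := Complex.exp (-(Real.pi * Complex.I * μ))
    linear_combination Real.pi / 2 * (F * besselI (-μ) ℓ + E * besselI μ ℓ) * (F - E) * Complex.I_sq +
      (Real.pi / 2 * (besselI (-μ) ℓ - besselI μ ℓ)) * e3)) h2
  have h5 : Complex.exp (-(Real.pi * Complex.I * n)) = Complex.exp (Real.pi * Complex.I * n) := by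
    rw [Complex.exp_eq_exp_iff_exists_int]
    exact ⟨-n, by push_cast; ring⟩
  rw [h5, besselI_neg_intCast] at h3
  linear_combination h3

/-- At argument 0 the series reduces to 1/k!, and (e^ℓ/2)² tends to 0 as ℓ → -∞. -/
theorem exists_besselI_ne_zero (n : ℤ) : ∃ ℓ, besselI n ℓ ≠ 0 := by
  have h : ∀ k : ℕ, ∃ ℓ, besselI k ℓ ≠ 0 := by
    intro k
    have h0 : hypLimit k 0 ≠ 0 := by
      rw [hypLimit, tsum_eq_single 0 (fun j hj => by simp [hj])]
      simp [Complex.Gamma_nat_eq_factorial, Nat.factorial_ne_zero]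
    have hc : Continuous fun y => hypLimit k y :=
      continuous_hypLimit.comp (f := fun y : ℂ => ((k : ℂ), y)) (by fun_prop)
    obtain ⟨r, hr, hball⟩ := Metric.eventually_nhds_iff_ball.1 (hc.continuousAt.eventually_ne h0)
    have hlim : Filter.Tendsto (fun x : ℝ => (Complex.exp x / 2) ^ 2) Filter.atBot (𝓝 0) := by
      have := ((Complex.continuous_ofReal.tendsto 0).comp Real.tendsto_exp_atBot).div_const 2
      have := this.pow 2
      simpa using this
    obtain ⟨x, hx⟩ := (hlim.eventually (Metric.ball_mem_nhds 0 hr)).exists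
    refine ⟨x, ?_⟩
    rw [besselI_eq]
    exact mul_ne_zero (Complex.exp_ne_zero _) (hball _ hx)
  obtain ⟨k, rfl | rfl⟩ := n.eq_nat_or_neg
  · exact_mod_cast h k
  · obtain ⟨ℓ, hℓ⟩ := h k
    refine ⟨ℓ, ?_⟩
    have := besselI_neg_natCast k ℓ
    push_cast
    rwa [this]

/-- `K_n` and `I_n` are linearly independent. -/
theorem besselK_besselI_independent (n : ℤ) (a b : ℂ)
    (h : ∀ ℓ, a * besselK n ℓ + b * besselI n ℓ = 0) : a = 0 ∧ b = 0 := by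
  obtain ⟨ℓ, hℓ⟩ := exists_besselI_ne_zero n
  have h1 := h ℓ
  -- Continuation around t₁ = 0 fixes I_n and adds to K_n a nonzero multiple of I_n, so the
  -- difference of the two relations isolates a.
  have h2 := h (ℓ + 2 * Real.pi * Complex.I)
  have e1 : Complex.exp (2 * Real.pi * Complex.I * n) = 1 := by
    rw [Complex.exp_eq_one_iff]
    exact ⟨n, by ring⟩
  rw [besselK_int_add_two_pi, besselI_add_two_pi, e1] at h2
  have h3 : a * (2 * Real.pi * Complex.I * Complex.exp (Real.pi * Complex.I * n) *
        besselI n ℓ) = 0 := by linear_combination h1 - h2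
  have hpi : (2 * Real.pi * Complex.I : ℂ) ≠ 0 := Complex.two_pi_I_ne_zero
  have ha : a = 0 := by
    rcases mul_eq_zero.1 h3 with h | h
    · exact h
    · exact absurd h (mul_ne_zero (mul_ne_zero hpi (Complex.exp_ne_zero _)) hℓ)
  refine ⟨ha, ?_⟩
  rw [ha, zero_mul, zero_add] at h1
  exact (mul_eq_zero.1 h1).resolve_right hℓ

/-! ### Common properties of both functions -/

/-- The sign in the recurrence relations of `K_{-s}` and `I_{-s}`. -/
def Kind.sign : Kind → ℂ
  | Kind.K => -1
  | Kind.I => 1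

theorem Kind.sign_sq (L : Kind) : L.sign * L.sign = 1 := by
  cases L <;> simp [Kind.sign]

theorem differentiable_bessel_left (L : Kind) (ℓ : ℂ) : Differentiable ℂ fun ν => bessel L ν ℓ :=
  match L with
  | Kind.K => differentiable_besselK_left ℓ
  | Kind.I => differentiable_besselI_left ℓ

theorem sin_add_one_mul_pi (s : ℂ) :
    Complex.sin ((s + 1) * Real.pi) = -Complex.sin (s * Real.pi) := by
  rw [add_mul, one_mul, Complex.sin_add_pi]

theorem sin_neg_mul_pi (s : ℂ) : Complex.sin (-s * Real.pi) = -Complex.sin (s * Real.pi) := by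
  rw [neg_mul, Complex.sin_neg]

theorem besselK_neg {s : ℂ} (h : Complex.sin (s * Real.pi) ≠ 0) (ℓ : ℂ) :
    besselK (-s) ℓ =
      Real.pi / 2 * ((besselI (-s) ℓ - besselI s ℓ) / Complex.sin (s * Real.pi)) := by
  rw [besselK_of_sin_ne_zero (by rw [sin_neg_mul_pi]; exact neg_ne_zero.2 h), sin_neg_mul_pi,
    neg_neg, div_neg, ← neg_div, neg_sub]

theorem besselK_neg_add_one {s : ℂ} (h : Complex.sin (s * Real.pi) ≠ 0) (ℓ : ℂ) :
    besselK (-(s + 1)) ℓ =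
      -(Real.pi / 2 * ((besselI (-(s + 1)) ℓ - besselI (s + 1) ℓ) / Complex.sin (s * Real.pi))) := by
  rw [besselK_neg (by rw [sin_add_one_mul_pi]; exact neg_ne_zero.2 h), sin_add_one_mul_pi]
  ring

theorem besselK_neg_sub_one {s : ℂ} (h : Complex.sin (s * Real.pi) ≠ 0) (ℓ : ℂ) :
    besselK (-(s - 1)) ℓ =
      -(Real.pi / 2 * ((besselI (-(s - 1)) ℓ - besselI (s - 1) ℓ) / Complex.sin (s * Real.pi))) := by
  have h1 := sin_add_one_mul_pi (s - 1)
  rw [sub_add_cancel] at h1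
  rw [besselK_neg (by intro h0; rw [h0, neg_zero] at h1; exact h h1), h1]
  ring

/-- Both kinds satisfy the same relation up to `Kind.sign`. For K the sign comes from sin π(s+1) =
-sin πs. Nonintegral orders suffice, because the loops avoid the integers. -/
theorem hasDerivAt_bessel (L : Kind) {s : ℂ} (h : Complex.sin (s * Real.pi) ≠ 0) (ℓ : ℂ) :
    HasDerivAt (bessel L (-s))
      (s * bessel L (-s) ℓ + L.sign * Complex.exp ℓ * bessel L (-(s + 1)) ℓ) ℓ := by
  have h1 : HasDerivAt (besselI (-s))
      (s * besselI (-s) ℓ + Complex.exp ℓ * besselI (-(s + 1)) ℓ) ℓ := by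
    convert! hasDerivAt_besselI (-s) ℓ using 1
    have := besselI_recurrence (-s) ℓ
    rw [show -(s + 1) = -s - 1 by ring, this]
    ring
  cases L with
  | I => simpa [bessel, Kind.sign] using h1
  | K =>
    have h2 := hasDerivAt_besselI s ℓ
    have h3 : besselK (-s) = fun ℓ => Real.pi / 2 *
        ((besselI (-s) ℓ - besselI s ℓ) / Complex.sin (s * Real.pi)) :=
      funext fun ℓ => besselK_neg h ℓ
    change HasDerivAt (besselK (-s)) (s * besselK (-s) ℓ + -1 * Complex.exp ℓ *
      besselK (-(s + 1)) ℓ) ℓ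
    rw [besselK_neg_add_one h, besselK_neg h, h3]
    convert! ((h1.sub h2).div_const (Complex.sin (s * Real.pi))).const_mul
      ((Real.pi : ℂ) / 2) using 1
    ring

theorem bessel_recurrence (L : Kind) {s : ℂ} (h : Complex.sin (s * Real.pi) ≠ 0) (ℓ : ℂ) :
    L.sign * Complex.exp ℓ * bessel L (-(s - 1)) ℓ =
      2 * s * bessel L (-s) ℓ + L.sign * Complex.exp ℓ * bessel L (-(s + 1)) ℓ := by
  have h1 := besselI_recurrence (-s) ℓ
  rw [show -s - 1 = -(s + 1) by ring, show -s + 1 = -(s - 1) by ring] at h1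
  cases L with
  | I =>
    change 1 * Complex.exp ℓ * besselI (-(s - 1)) ℓ =
      2 * s * besselI (-s) ℓ + 1 * Complex.exp ℓ * besselI (-(s + 1)) ℓ
    linear_combination -h1
  | K =>
    have h2 := besselI_recurrence s ℓ
    change -1 * Complex.exp ℓ * besselK (-(s - 1)) ℓ =
      2 * s * besselK (-s) ℓ + -1 * Complex.exp ℓ * besselK (-(s + 1)) ℓ
    rw [besselK_neg_add_one h, besselK_neg_sub_one h, besselK_neg h]
    linear_combination (Real.pi / 2 / Complex.sin (s * Real.pi)) * (-h1 - h2)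

end SpinWhittaker

namespace SpinWhittaker

open MeasureTheory

/-! ### Osgood's lemma -/

-- A Cauchy kernel is regarded as the inverse of an element of the Banach algebra of bounded
-- continuous functions. On the half-size disc the denominator is at least 1/2.
open scoped BoundedContinuousFunction in
theorem exists_inverse_sub_const {g : ℝ × ℝ → ℂ} (hg : Continuous g) {z₀ z : ℂ}
    (h1 : ∀ x, ‖g x - z₀‖ = 1) (hz : ‖z - z₀‖ ≤ 1 / 2) (a : (ℝ × ℝ) →ᵇ ℂ) (ha : ∀ x, a x = g x) :
    ∃ b : (ℝ × ℝ) →ᵇ ℂ, (a - z • 1) * b = 1 ∧ ∀ x, b x = (g x - z)⁻¹ := by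
  have h2 : ∀ x, 1 / 2 ≤ ‖g x - z‖ := fun x => by
    have h3 := norm_sub_norm_le (g x - z₀) (z - z₀)
    rw [h1, sub_sub_sub_cancel_right] at h3
    linarith
  have h0 : ∀ x, g x - z ≠ 0 := fun x => norm_pos_iff.1 (lt_of_lt_of_le (by norm_num) (h2 x))
  refine ⟨BoundedContinuousFunction.ofNormedAddCommGroup (fun x => (g x - z)⁻¹)
    ((hg.sub continuous_const).inv₀ h0) 2 fun x => ?_, ?_, fun x => rfl⟩
  · rw [norm_inv]
    exact inv_le_of_inv_le₀ (by norm_num) (by simpa using h2 x)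
  · ext x
    simp [ha, h0 x]

-- The integral is a continuous linear functional applied to the inverse of an element that depends
-- polynomially on p. Inversion in a Banach algebra is analytic at units, which gives joint
-- analyticity without expanding a double series.
open scoped BoundedContinuousFunction in
theorem analyticAt_cauchyKernel_integral (z₀ w₀ : ℂ) {K : ℝ × ℝ → ℂ} (hK : Continuous K) :
    AnalyticAt ℂ (fun p : ℂ × ℂ => ∫ x in Set.Ioc 0 (2 * Real.pi) ×ˢ Set.Ioc 0 (2 * Real.pi),
      K x * ((circleMap z₀ 1 x.1 - p.1)⁻¹ * (circleMap w₀ 1 x.2 - p.2)⁻¹)) (z₀, w₀) := by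
  set S : Set (ℝ × ℝ) := Set.Ioc 0 (2 * Real.pi) ×ˢ Set.Ioc 0 (2 * Real.pi) with hS
  have hKS : IntegrableOn K S :=
    (hK.continuousOn.integrableOn_compact (isCompact_Icc.prod isCompact_Icc)).mono_set
      (Set.prod_mono Set.Ioc_subset_Icc_self Set.Ioc_subset_Icc_self)
  have hint : ∀ g : (ℝ × ℝ) →ᵇ ℂ, IntegrableOn (fun x => K x * g x) S := fun g =>
    Integrable.mul_bdd (c := ‖g‖) hKS g.continuous.aestronglyMeasurable
      (Filter.Eventually.of_forall fun x => g.norm_coe_le_norm x)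
  let Λ : ((ℝ × ℝ) →ᵇ ℂ) →L[ℂ] ℂ := LinearMap.mkContinuous
    { toFun := fun g => ∫ x in S, K x * g x
      map_add' := fun f g => by
        rw [← integral_add (hint f) (hint g)]
        simp [mul_add]
      map_smul' := fun c g => by
        rw [RingHom.id_apply, smul_eq_mul, ← integral_const_mul]
        simp [mul_left_comm] }
    (∫ x in S, ‖K x‖) fun g => by
      refine (norm_integral_le_integral_norm _).trans ?_
      rw [← integral_mul_const]
      refine integral_mono (hint g).norm (hKS.norm.mul_const _) fun x => ?_
      simp only [norm_mul]
      exact mul_le_mul_of_nonneg_left (g.norm_coe_le_norm x) (norm_nonneg _)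
  have hb : ∀ c : ℂ, ∀ θ : ℝ, ‖circleMap c 1 θ‖ ≤ ‖c‖ + 1 := fun c θ => by
    refine (norm_add_le _ _).trans ?_
    simp
  let a₁ : (ℝ × ℝ) →ᵇ ℂ := BoundedContinuousFunction.ofNormedAddCommGroup
    (fun x => circleMap z₀ 1 x.1) ((continuous_circleMap z₀ 1).comp continuous_fst) (‖z₀‖ + 1)
    fun x => hb _ _
  let a₂ : (ℝ × ℝ) →ᵇ ℂ := BoundedContinuousFunction.ofNormedAddCommGroup
    (fun x => circleMap w₀ 1 x.2) ((continuous_circleMap w₀ 1).comp continuous_snd) (‖w₀‖ + 1)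
    fun x => hb _ _
  have hinv : ∀ p : ℂ × ℂ, ‖p.1 - z₀‖ ≤ 1 / 2 → ‖p.2 - w₀‖ ≤ 1 / 2 →
      ∃ u : ((ℝ × ℝ) →ᵇ ℂ)ˣ, (u : (ℝ × ℝ) →ᵇ ℂ) = (a₁ - p.1 • 1) * (a₂ - p.2 • 1) ∧
        ∀ x, (↑u⁻¹ : (ℝ × ℝ) →ᵇ ℂ) x =
          (circleMap z₀ 1 x.1 - p.1)⁻¹ * (circleMap w₀ 1 x.2 - p.2)⁻¹ := by
    intro p h1 h2
    obtain ⟨b₁, hb₁, hb₁'⟩ := exists_inverse_sub_const (g := fun x => circleMap z₀ 1 x.1)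
      ((continuous_circleMap z₀ 1).comp continuous_fst) (fun x => by simp) h1 a₁ fun x => rfl
    obtain ⟨b₂, hb₂, hb₂'⟩ := exists_inverse_sub_const (g := fun x => circleMap w₀ 1 x.2)
      ((continuous_circleMap w₀ 1).comp continuous_snd) (fun x => by simp) h2 a₂ fun x => rfl
    have hprod : (a₁ - p.1 • 1) * (a₂ - p.2 • 1) * (b₁ * b₂) = 1 := by
      rw [mul_mul_mul_comm, hb₁, hb₂, one_mul]
    refine ⟨⟨_, b₁ * b₂, hprod, by rw [mul_comm]; exact hprod⟩, rfl, fun x => ?_⟩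
    change (b₁ * b₂) x = _
    rw [BoundedContinuousFunction.mul_apply, hb₁', hb₂']
  obtain ⟨u₀, hu₀, -⟩ := hinv (z₀, w₀) (by simp) (by simp)
  have hA : AnalyticAt ℂ (fun p : ℂ × ℂ => Λ (Ring.inverse ((a₁ - p.1 • 1) * (a₂ - p.2 • 1))))
      (z₀, w₀) := by
    have h1 : AnalyticAt ℂ (fun p : ℂ × ℂ => (a₁ - p.1 • 1) * (a₂ - p.2 • 1)) (z₀, w₀) :=
      (analyticAt_const.sub (analyticAt_fst.smul analyticAt_const)).mul
        (analyticAt_const.sub (analyticAt_snd.smul analyticAt_const))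
    have h2 : AnalyticAt ℂ (Ring.inverse : ((ℝ × ℝ) →ᵇ ℂ) → _)
        ((a₁ - (z₀, w₀).1 • 1) * (a₂ - (z₀, w₀).2 • 1)) := by
      rw [← hu₀]
      exact analyticAt_inverse u₀
    exact (Λ.analyticAt _).comp (h2.comp_of_eq h1 rfl)
  refine hA.congr ?_
  filter_upwards [Metric.ball_mem_nhds (z₀, w₀) (show (0 : ℝ) < 1 / 2 by norm_num)] with p hp
  rw [Metric.mem_ball, dist_eq_norm] at hp
  obtain ⟨u, hu, hu'⟩ := hinv p ((norm_fst_le (p - (z₀, w₀))).trans hp.le)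
    ((norm_snd_le (p - (z₀, w₀))).trans hp.le)
  rw [← hu, Ring.inverse_unit]
  change ∫ x in S, K x * _ = _
  simp only [hu']

/-- **Osgood's lemma** for entire functions of two variables. -/
theorem analyticOnNhd_of_separately {f : ℂ × ℂ → ℂ} (hf : Continuous f)
    (h1 : ∀ w, Differentiable ℂ fun z => f (z, w)) (h2 : ∀ z, Differentiable ℂ fun w => f (z, w)) :
    AnalyticOnNhd ℂ f Set.univ := by
  rintro ⟨z₀, w₀⟩ -
  have hd : ∀ c : ℂ, Continuous (deriv (circleMap c 1)) := fun c => by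
    have : deriv (circleMap c 1) = fun θ => circleMap 0 1 θ * Complex.I :=
      funext fun θ => deriv_circleMap c 1 θ
    rw [this]
    fun_prop
  -- This is the density of the iterated Cauchy formula on the torus of radius 1 around (z₀, w₀),
  -- with the two Cauchy kernels split off.
  set K : ℝ × ℝ → ℂ := fun x => (2 * Real.pi * Complex.I)⁻¹ * (2 * Real.pi * Complex.I)⁻¹ *
    (deriv (circleMap z₀ 1) x.1 * deriv (circleMap w₀ 1) x.2 *
      f (circleMap z₀ 1 x.1, circleMap w₀ 1 x.2)) with hKdef
  have hK : Continuous K := by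
    have := hd z₀
    have := hd w₀
    fun_prop
  refine (analyticAt_cauchyKernel_integral z₀ w₀ hK).congr ?_
  filter_upwards [Metric.ball_mem_nhds (z₀, w₀) one_pos] with p hp
  have hp1 : p.1 ∈ Metric.ball z₀ 1 := by
    rw [Metric.mem_ball, dist_eq_norm] at hp ⊢
    exact (norm_fst_le (p - (z₀, w₀))).trans_lt hp
  have hp2 : p.2 ∈ Metric.ball w₀ 1 := by
    rw [Metric.mem_ball, dist_eq_norm] at hp ⊢
    exact (norm_snd_le (p - (z₀, w₀))).trans_lt hp
  have e1 := fun w => Complex.two_pi_I_inv_smul_circleIntegral_sub_inv_smul_of_differentiable_on_off_countable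
    Set.countable_empty hp1 (h1 w).continuous.continuousOn fun x _ => h1 w x
  have e2 := fun z => Complex.two_pi_I_inv_smul_circleIntegral_sub_inv_smul_of_differentiable_on_off_countable
    Set.countable_empty hp2 (h2 z).continuous.continuousOn fun x _ => h2 z x
  have h2pi : (0 : ℝ) ≤ 2 * Real.pi := by positivity
  have hint : IntegrableOn (fun x : ℝ × ℝ => K x * ((circleMap z₀ 1 x.1 - p.1)⁻¹ *
      (circleMap w₀ 1 x.2 - p.2)⁻¹))
      (Set.Ioc 0 (2 * Real.pi) ×ˢ Set.Ioc 0 (2 * Real.pi)) := by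
    have hne : ∀ {c z : ℂ}, z ∈ Metric.ball c 1 → ∀ θ, circleMap c 1 θ - z ≠ 0 := by
      intro c z hz θ h0
      rw [sub_eq_zero] at h0
      rw [← h0] at hz
      simp [dist_eq_norm] at hz
    have hc : Continuous (fun x : ℝ × ℝ => K x * ((circleMap z₀ 1 x.1 - p.1)⁻¹ *
      (circleMap w₀ 1 x.2 - p.2)⁻¹)) :=
      hK.mul (((((continuous_circleMap z₀ 1).comp continuous_fst).sub continuous_const).inv₀
        fun x => hne hp1 _).mul ((((continuous_circleMap w₀ 1).comp continuous_snd).sub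
        continuous_const).inv₀ fun x => hne hp2 _))
    exact (hc.continuousOn.integrableOn_compact (isCompact_Icc.prod isCompact_Icc)).mono_set
      (Set.prod_mono Set.Ioc_subset_Icc_self Set.Ioc_subset_Icc_self)
  rw [Measure.volume_eq_prod, setIntegral_prod _ hint, ← e1 p.2]
  simp only [circleIntegral, intervalIntegral.integral_of_le h2pi, smul_eq_mul] at e2 ⊢
  rw [← integral_const_mul]
  refine integral_congr_ae (Filter.Eventually.of_forall fun θ => ?_)
  dsimp only
  rw [← e2 (circleMap z₀ 1 θ), ← integral_const_mul, ← integral_const_mul, ← integral_const_mul,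
    ← integral_const_mul]
  refine integral_congr_ae (Filter.Eventually.of_forall fun φ => ?_)
  simp only [hKdef]
  ring

end SpinWhittaker

namespace SpinWhittaker

open MeasureTheory

/-! ### Loop integrals depending on a parameter -/

/-- A kernel which decays on `S` faster than every exponential, locally uniformly in `p`. -/
structure RapidKernel {E : Type*} [NormedAddCommGroup E] (S : Set ℂ) (k : ℂ → E → ℂ) : Prop where
  cont : ContinuousOn (fun x : ℂ × E => k x.1 x.2) (S ×ˢ Set.univ)
  bound : ∀ ρ A : ℝ, ∃ C : ℝ, ∀ s ∈ S, ∀ p, ‖p‖ ≤ ρ → ‖k s p‖ ≤ C * Real.exp (-A * s.re)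

/-- A kernel which grows on `S` at most exponentially, locally uniformly in `p`. -/
structure ModerateKernel {E : Type*} [NormedAddCommGroup E] (S : Set ℂ) (k : ℂ → E → ℂ) :
    Prop where
  cont : ContinuousOn (fun x : ℂ × E => k x.1 x.2) (S ×ˢ Set.univ)
  bound : ∀ ρ : ℝ, ∃ A C : ℝ, ∀ s ∈ S, ∀ p, ‖p‖ ≤ ρ → ‖k s p‖ ≤ C * Real.exp (A * s.re)

section Kernels

variable {E : Type*} [NormedAddCommGroup E] {S : Set ℂ} {k k' : ℂ → E → ℂ}

theorem ModerateKernel.mul (hk : ModerateKernel S k) (hk' : ModerateKernel S k') :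
    ModerateKernel S fun s p => k s p * k' s p where
  cont := hk.cont.mul hk'.cont
  bound ρ := by
    obtain ⟨A, C, hC⟩ := hk.bound ρ
    obtain ⟨A', C', hC'⟩ := hk'.bound ρ
    refine ⟨A + A', C * C', fun s hs p hp => ?_⟩
    rw [norm_mul, add_mul, Real.exp_add, mul_mul_mul_comm]
    exact mul_le_mul (hC s hs p hp) (hC' s hs p hp) (norm_nonneg _)
      ((norm_nonneg _).trans (hC s hs p hp))

theorem RapidKernel.mul_moderate (hk : RapidKernel S k) (hk' : ModerateKernel S k') :
    RapidKernel S fun s p => k s p * k' s p where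
  cont := hk.cont.mul hk'.cont
  bound ρ A := by
    obtain ⟨A', C', hC'⟩ := hk'.bound ρ
    obtain ⟨C, hC⟩ := hk.bound ρ (A + A')
    refine ⟨C * C', fun s hs p hp => ?_⟩
    rw [norm_mul, show -A * s.re = -(A + A') * s.re + A' * s.re by ring, Real.exp_add,
      mul_mul_mul_comm]
    exact mul_le_mul (hC s hs p hp) (hC' s hs p hp) (norm_nonneg _)
      ((norm_nonneg _).trans (hC s hs p hp))

theorem RapidKernel.congr (hk : RapidKernel S k) (h : ∀ s ∈ S, ∀ p, k' s p = k s p) :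
    RapidKernel S k' where
  cont := hk.cont.congr fun x hx => h x.1 hx.1 x.2
  bound ρ A := by
    obtain ⟨C, hC⟩ := hk.bound ρ A
    exact ⟨C, fun s hs p hp => by rw [h s hs p]; exact hC s hs p hp⟩

theorem ModerateKernel.congr (hk : ModerateKernel S k) (h : ∀ s ∈ S, ∀ p, k' s p = k s p) :
    ModerateKernel S k' where
  cont := hk.cont.congr fun x hx => h x.1 hx.1 x.2
  bound ρ := by
    obtain ⟨A, C, hC⟩ := hk.bound ρ
    exact ⟨A, C, fun s hs p hp => by rw [h s hs p]; exact hC s hs p hp⟩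

theorem moderateKernel_of_continuous [ProperSpace E] {g : E → ℂ} (hg : Continuous g) :
    ModerateKernel S fun _ p => g p where
  cont := (hg.comp continuous_snd).continuousOn
  bound ρ := by
    obtain ⟨C, hC⟩ := (isCompact_closedBall (0 : E) ρ).exists_bound_of_continuousOn hg.continuousOn
    exact ⟨0, C, fun s hs p hp => by simpa using hC p (by simpa using hp)⟩

theorem moderateKernel_const (a : ℂ) : ModerateKernel S fun _ (_ : E) => a where
  cont := continuousOn_const
  bound ρ := ⟨0, ‖a‖, fun s hs p hp => by simp⟩

theorem ModerateKernel.prod {ι : Type*} {u : ι → ℂ → E → ℂ} (I : Finset ι)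
    (h : ∀ i ∈ I, ModerateKernel S (u i)) : ModerateKernel S fun s p => ∏ i ∈ I, u i s p := by
  classical
  induction I using Finset.induction_on with
  | empty => simpa using moderateKernel_const (1 : ℂ)
  | insert i I hi ih =>
    simp only [Finset.prod_insert hi]
    exact (h i (Finset.mem_insert_self i I)).mul
      (ih fun j hj => h j (Finset.mem_insert_of_mem hj))

theorem RapidKernel.comp_param {E' : Type*} [NormedAddCommGroup E'] (hk : RapidKernel S k)
    {g : E' → E} (hg : Continuous g) (hb : ∀ ρ : ℝ, ∃ ρ' : ℝ, ∀ p, ‖p‖ ≤ ρ → ‖g p‖ ≤ ρ') :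
    RapidKernel S fun s p => k s (g p) where
  cont := hk.cont.comp (f := fun x : ℂ × E' => (x.1, g x.2)) (by fun_prop)
    fun x hx => ⟨hx.1, trivial⟩
  bound ρ A := by
    obtain ⟨ρ', hρ'⟩ := hb ρ
    obtain ⟨C, hC⟩ := hk.bound ρ' A
    exact ⟨C, fun s hs p hp => hC s hs _ (hρ' p hp)⟩

end Kernels

section Pieces

variable {E : Type*} [NormedAddCommGroup E] {S : Set ℂ} {k k' : ℂ → E → ℂ} {T : Set ℝ} {γ : ℝ → ℂ}

theorem RapidKernel.continuousOn_left (hk : RapidKernel S k) (hγ : Continuous γ)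
    (hγS : Set.MapsTo γ T S) (p : E) : ContinuousOn (fun x => k (γ x) p) T :=
  hk.cont.comp (f := fun x : ℝ => (γ x, p)) (by fun_prop) fun _ hx => ⟨hγS hx, trivial⟩

theorem RapidKernel.integrableOn (hk : RapidKernel S k) (hT : MeasurableSet T) (hγ : Continuous γ)
    (hγS : Set.MapsTo γ T S) (hint : IntegrableOn (fun x => Real.exp (-(γ x).re)) T) (p : E) :
    IntegrableOn (fun x => k (γ x) p) T := by
  obtain ⟨C, hC⟩ := hk.bound ‖p‖ 1
  refine Integrable.mono' (hint.const_mul C)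
    ((hk.continuousOn_left hγ hγS p).aestronglyMeasurable hT) ?_
  filter_upwards [ae_restrict_mem hT] with x hx
  simpa using hC (γ x) (hγS hx) p le_rfl

theorem RapidKernel.continuous_integral (hk : RapidKernel S k) (hT : MeasurableSet T)
    (hγ : Continuous γ) (hγS : Set.MapsTo γ T S)
    (hint : IntegrableOn (fun x => Real.exp (-(γ x).re)) T) :
    Continuous fun p => ∫ x in T, k (γ x) p := by
  rw [continuous_iff_continuousAt]
  intro p₀
  obtain ⟨C, hC⟩ := hk.bound (‖p₀‖ + 1) 1
  refine continuousAt_of_dominated (bound := fun x => C * Real.exp (-(γ x).re))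
    (Filter.Eventually.of_forall fun p =>
      (hk.continuousOn_left hγ hγS p).aestronglyMeasurable hT) ?_ (hint.const_mul C) ?_
  · have hb : ∀ᶠ p in 𝓝 p₀, ‖p‖ ≤ ‖p₀‖ + 1 := by
      filter_upwards [continuous_norm.continuousAt.eventually_lt continuousAt_const
        (show ‖p₀‖ < ‖p₀‖ + 1 by linarith)] with p hp using hp.le
    filter_upwards [hb] with p hp
    filter_upwards [ae_restrict_mem hT] with x hx
    simpa using hC (γ x) (hγS hx) p hp
  · filter_upwards [ae_restrict_mem hT] with x hx
    have h1 : Continuous fun p => k (γ x) p := by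
      rw [← continuousOn_univ]
      exact hk.cont.comp (f := fun p : E => (γ x, p)) (by fun_prop) fun _ _ => ⟨hγS hx, trivial⟩
    exact h1.continuousAt

theorem RapidKernel.hasDerivAt_integral {k k' : ℂ → ℂ → ℂ} (hk : RapidKernel S k)
    (hk' : RapidKernel S k') (hd : ∀ s ∈ S, ∀ z, HasDerivAt (k s) (k' s z) z)
    (hT : MeasurableSet T) (hγ : Continuous γ) (hγS : Set.MapsTo γ T S)
    (hint : IntegrableOn (fun x => Real.exp (-(γ x).re)) T) (z : ℂ) :
    HasDerivAt (fun z => ∫ x in T, k (γ x) z) (∫ x in T, k' (γ x) z) z := by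
  obtain ⟨C, hC⟩ := hk'.bound (‖z‖ + 1) 1
  refine (hasDerivAt_integral_of_dominated_loc_of_deriv_le (s := Metric.ball z 1)
    (bound := fun x => C * Real.exp (-(γ x).re)) (F := fun z x => k (γ x) z)
    (F' := fun z x => k' (γ x) z) (Metric.ball_mem_nhds z one_pos)
    (Filter.Eventually.of_forall fun p =>
      (hk.continuousOn_left hγ hγS p).aestronglyMeasurable hT)
    (hk.integrableOn hT hγ hγS hint z)
    ((hk'.continuousOn_left hγ hγS z).aestronglyMeasurable hT) ?_ (hint.const_mul C) ?_).2
  · filter_upwards [ae_restrict_mem hT] with x hx w hw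
    have hw' : ‖w‖ ≤ ‖z‖ + 1 := by
      have h1 := norm_sub_norm_le w z
      rw [Metric.mem_ball, dist_eq_norm] at hw
      linarith
    simpa using hC (γ x) (hγS hx) w hw'
  · filter_upwards [ae_restrict_mem hT] with x hx w _
    exact hd (γ x) (hγS hx) w

end Pieces

/-- The loop with parameters `c`, `h` runs in `S`. -/
structure LoopIn (c h : ℝ) (S : Set ℂ) : Prop where
  pos : 0 < h
  bottom : Set.MapsTo (fun x : ℝ => (x - h * Complex.I : ℂ)) (Set.Ioi c) S
  left : Set.MapsTo (fun y : ℝ => (c + y * Complex.I : ℂ)) (Set.Icc (-h) h) S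
  top : Set.MapsTo (fun x : ℝ => (x + h * Complex.I : ℂ)) (Set.Ioi c) S

section Loops

variable {E : Type*} [NormedAddCommGroup E] {S : Set ℂ} {c h : ℝ}

theorem loopIntegral_congr {F G : ℂ → ℂ} (hl : LoopIn c h S) (hFG : ∀ s ∈ S, F s = G s) :
    loopIntegral c h F = loopIntegral c h G := by
  have hle : -h ≤ h := by linarith [hl.pos]
  simp only [loopIntegral]
  refine congrArg₂ _ (congrArg₂ _ (congrArg _ ?_) (congrArg _ ?_)) ?_
  · exact setIntegral_congr_fun measurableSet_Ioi fun x hx => hFG _ (hl.bottom hx)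
  · refine intervalIntegral.integral_congr fun y hy => hFG _ (hl.left ?_)
    rwa [Set.uIcc_of_le hle] at hy
  · exact setIntegral_congr_fun measurableSet_Ioi fun x hx => hFG _ (hl.top hx)

theorem loopIntegral_const_mul (a : ℂ) (F : ℂ → ℂ) :
    loopIntegral c h (fun s => a * F s) = a * loopIntegral c h F := by
  simp only [loopIntegral, integral_const_mul, intervalIntegral.integral_const_mul]
  ring

theorem loopIntegral_add {F G : ℂ → ℂ} (hF : LoopIntegrable c h F) (hG : LoopIntegrable c h G) :
    loopIntegral c h (fun s => F s + G s) = loopIntegral c h F + loopIntegral c h G := by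
  simp only [loopIntegral]
  rw [integral_add hF.1 hG.1, integral_add hF.2.2 hG.2.2,
    intervalIntegral.integral_add hF.2.1 hG.2.1]
  ring

theorem integrableOn_exp_neg_re_sub (c h : ℝ) :
    IntegrableOn (fun x : ℝ => Real.exp (-((x - h * Complex.I : ℂ)).re)) (Set.Ioi c) := by
  simpa using integrableOn_exp_neg_Ioi c

theorem integrableOn_exp_neg_re_add (c h : ℝ) :
    IntegrableOn (fun x : ℝ => Real.exp (-((x + h * Complex.I : ℂ)).re)) (Set.Ioi c) := by
  simpa using integrableOn_exp_neg_Ioi c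

theorem integrableOn_exp_neg_re_left (c h : ℝ) :
    IntegrableOn (fun y : ℝ => Real.exp (-((c + y * Complex.I : ℂ)).re)) (Set.Ioc (-h) h) := by
  simp

theorem RapidKernel.loopIntegrable {k : ℂ → E → ℂ} (hk : RapidKernel S k) (hl : LoopIn c h S)
    (p : E) : LoopIntegrable c h fun s => k s p := by
  refine ⟨hk.integrableOn measurableSet_Ioi (by fun_prop) hl.bottom
    (integrableOn_exp_neg_re_sub c h) p, ?_, hk.integrableOn measurableSet_Ioi (by fun_prop) hl.top
    (integrableOn_exp_neg_re_add c h) p⟩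
  rw [intervalIntegrable_iff_integrableOn_Ioc_of_le (by linarith [hl.pos])]
  exact hk.integrableOn measurableSet_Ioc (by fun_prop)
    (hl.left.mono_left Set.Ioc_subset_Icc_self) (integrableOn_exp_neg_re_left c h) p

theorem RapidKernel.continuous_loopIntegral {k : ℂ → E → ℂ} (hk : RapidKernel S k)
    (hl : LoopIn c h S) : Continuous fun p => loopIntegral c h fun s => k s p := by
  have h1 := hk.continuous_integral measurableSet_Ioi (by fun_prop) hl.bottom
    (integrableOn_exp_neg_re_sub c h)
  have h2 := hk.continuous_integral measurableSet_Ioi (by fun_prop) hl.top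
    (integrableOn_exp_neg_re_add c h)
  have h3 := hk.continuous_integral measurableSet_Ioc (by fun_prop)
    (hl.left.mono_left Set.Ioc_subset_Icc_self) (integrableOn_exp_neg_re_left c h)
  simp only [loopIntegral, intervalIntegral.integral_of_le (show -h ≤ h by linarith [hl.pos])]
  exact (h1.neg.add (continuous_const.mul h3)).add h2

theorem RapidKernel.hasDerivAt_loopIntegral {k k' : ℂ → ℂ → ℂ} (hk : RapidKernel S k)
    (hk' : RapidKernel S k') (hd : ∀ s ∈ S, ∀ z, HasDerivAt (k s) (k' s z) z)
    (hl : LoopIn c h S) (z : ℂ) :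
    HasDerivAt (fun z => loopIntegral c h fun s => k s z) (loopIntegral c h fun s => k' s z) z := by
  have h1 := hk.hasDerivAt_integral hk' hd measurableSet_Ioi (by fun_prop) hl.bottom
    (integrableOn_exp_neg_re_sub c h) z
  have h2 := hk.hasDerivAt_integral hk' hd measurableSet_Ioi (by fun_prop) hl.top
    (integrableOn_exp_neg_re_add c h) z
  have h3 := hk.hasDerivAt_integral hk' hd measurableSet_Ioc (by fun_prop)
    (hl.left.mono_left Set.Ioc_subset_Icc_self) (integrableOn_exp_neg_re_left c h) z
  simp only [loopIntegral, intervalIntegral.integral_of_le (show -h ≤ h by linarith [hl.pos])]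
  exact (h1.neg.add (h3.const_mul _)).add h2

/-- Partial derivatives and analyticity of a loop integral that depends on two variables. -/
theorem RapidKernel.hasDerivAt_fst {k k' : ℂ → ℂ × ℂ → ℂ} (hk : RapidKernel S k)
    (hk' : RapidKernel S k') (hd : ∀ s ∈ S, ∀ z w, HasDerivAt (fun z => k s (z, w)) (k' s (z, w)) z)
    (hl : LoopIn c h S) (z w : ℂ) :
    HasDerivAt (fun z => loopIntegral c h fun s => k s (z, w))
      (loopIntegral c h fun s => k' s (z, w)) z := by
  have hb : ∀ ρ : ℝ, ∃ ρ' : ℝ, ∀ z : ℂ, ‖z‖ ≤ ρ → ‖(z, w)‖ ≤ ρ' := fun ρ =>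
    ⟨max ρ ‖w‖, fun z hz => by rw [Prod.norm_def]; exact max_le_max_right _ hz⟩
  exact (hk.comp_param (g := fun z => (z, w)) (by fun_prop) hb).hasDerivAt_loopIntegral
    (hk'.comp_param (g := fun z => (z, w)) (by fun_prop) hb) (fun s hs z => hd s hs z w) hl z

theorem RapidKernel.hasDerivAt_snd {k k' : ℂ → ℂ × ℂ → ℂ} (hk : RapidKernel S k)
    (hk' : RapidKernel S k') (hd : ∀ s ∈ S, ∀ z w, HasDerivAt (fun w => k s (z, w)) (k' s (z, w)) w)
    (hl : LoopIn c h S) (z w : ℂ) :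
    HasDerivAt (fun w => loopIntegral c h fun s => k s (z, w))
      (loopIntegral c h fun s => k' s (z, w)) w := by
  have hb : ∀ ρ : ℝ, ∃ ρ' : ℝ, ∀ w : ℂ, ‖w‖ ≤ ρ → ‖(z, w)‖ ≤ ρ' := fun ρ =>
    ⟨max ‖z‖ ρ, fun w hw => by rw [Prod.norm_def]; exact max_le_max_left _ hw⟩
  exact (hk.comp_param (g := fun w => (z, w)) (by fun_prop) hb).hasDerivAt_loopIntegral
    (hk'.comp_param (g := fun w => (z, w)) (by fun_prop) hb) (fun s hs w => hd s hs z w) hl w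

theorem RapidKernel.analyticOnNhd {k k₁ k₂ : ℂ → ℂ × ℂ → ℂ} (hk : RapidKernel S k)
    (hk₁ : RapidKernel S k₁) (hk₂ : RapidKernel S k₂)
    (hd₁ : ∀ s ∈ S, ∀ z w, HasDerivAt (fun z => k s (z, w)) (k₁ s (z, w)) z)
    (hd₂ : ∀ s ∈ S, ∀ z w, HasDerivAt (fun w => k s (z, w)) (k₂ s (z, w)) w)
    (hl : LoopIn c h S) :
    AnalyticOnNhd ℂ (fun p => loopIntegral c h fun s => k s p) Set.univ :=
  analyticOnNhd_of_separately (hk.continuous_loopIntegral hl)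
    (fun w z => (hk.hasDerivAt_fst hk₁ hd₁ hl z w).differentiableAt)
    (fun z w => (hk.hasDerivAt_snd hk₂ hd₂ hl z w).differentiableAt)

end Loops

end SpinWhittaker

namespace SpinWhittaker

open MeasureTheory

/-! ### Deformation of loops -/

/-- A half-strip with discs around the integers removed. -/
def contourRegion (c h δ : ℝ) : Set ℂ :=
  {s | c ≤ s.re ∧ |s.im| ≤ h ∧ ∀ n : ℤ, δ ≤ ‖s - n‖}

/-- All poles of the kernels are integers. The horizontal sides stay at distance h from the real
axis, and the vertical side at the distance of c from the nearest integer. -/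
theorem exists_loopIn {c h : ℝ} (hc : ∀ n : ℤ, c ≠ n) (hh : 0 < h) :
    ∃ δ, 0 < δ ∧ LoopIn c h (contourRegion c h δ) := by
  have h1 : (⌊c⌋ : ℝ) < c := lt_of_le_of_ne (Int.floor_le c) fun e => hc _ e.symm
  have h2 : c < ⌊c⌋ + 1 := Int.lt_floor_add_one c
  have hre : ∀ n : ℤ, min (c - ⌊c⌋) (⌊c⌋ + 1 - c) ≤ |c - n| := by
    intro n
    rcases le_or_gt n ⌊c⌋ with hn | hn
    · have : (n : ℝ) ≤ ⌊c⌋ := by exact_mod_cast hn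
      exact (min_le_left _ _).trans ((by linarith : c - ⌊c⌋ ≤ c - n).trans (le_abs_self _))
    · have : (⌊c⌋ : ℝ) + 1 ≤ n := by exact_mod_cast hn
      exact (min_le_right _ _).trans ((by linarith : ⌊c⌋ + 1 - c ≤ -(c - n)).trans (neg_le_abs _))
  have him : ∀ s : ℂ, |s.im| = h → ∀ n : ℤ, h ≤ ‖s - n‖ := fun s hs n => by
    have := Complex.abs_im_le_norm (s - n)
    simpa [hs] using this
  refine ⟨min h (min (c - ⌊c⌋) (⌊c⌋ + 1 - c)), lt_min hh (lt_min (by linarith) (by linarith)), hh,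
    fun x hx => ?_, fun y hy => ?_, fun x hx => ?_⟩
  · refine ⟨?_, ?_, fun n => (min_le_left _ _).trans (him _ ?_ n)⟩
    · simpa using (le_of_lt hx : c ≤ x)
    · simp [abs_of_pos hh]
    · simp [abs_of_pos hh]
  · refine ⟨by simp, ?_, fun n => (min_le_right _ _).trans ((hre n).trans ?_)⟩
    · simpa [abs_le] using hy
    · have := Complex.abs_re_le_norm (c + y * Complex.I - n : ℂ)
      simpa using this
  · refine ⟨?_, ?_, fun n => (min_le_left _ _).trans (him _ ?_ n)⟩
    · simpa using (le_of_lt hx : c ≤ x)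
    · simp [abs_of_pos hh]
    · simp [abs_of_pos hh]

theorem ne_int_of_mem_contourRegion {c h δ : ℝ} (hδ : 0 < δ) {s : ℂ}
    (hs : s ∈ contourRegion c h δ) (n : ℤ) : s ≠ n := fun e => by
  have := hs.2.2 n
  rw [e, sub_self, norm_zero] at this
  linarith

/-- The integral over the boundary of the rectangle `[c, c'] × [-h, h]`. -/
noncomputable def rectIntegral (c c' h : ℝ) (F : ℂ → ℂ) : ℂ :=
  (∫ x in c..c', F (x - h * Complex.I)) - (∫ x in c..c', F (x + h * Complex.I)) +
    Complex.I * (∫ y in (-h)..h, F (c' + y * Complex.I)) -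
    Complex.I * (∫ y in (-h)..h, F (c + y * Complex.I))

/-- The closed rectangle `[c, c'] × [-h, h]`. -/
def closedRect (c c' h : ℝ) : Set ℂ := {s | s.re ∈ Set.Icc c c' ∧ s.im ∈ Set.Icc (-h) h}

/-- The horizontal rays coincide to the right of c'. What remains is the boundary of the rectangle,
traversed clockwise. -/
theorem loopIntegral_sub_loopIntegral {c c' h : ℝ} {F : ℂ → ℂ}
    (h1 : LoopIntegrable c h F) (h2 : LoopIntegrable c' h F) :
    loopIntegral c h F - loopIntegral c' h F = -rectIntegral c c' h F := by
  have e1 := intervalIntegral.integral_interval_add_Ioi h1.1 h2.1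
  have e2 := intervalIntegral.integral_interval_add_Ioi h1.2.2 h2.2.2
  simp only [loopIntegral, rectIntegral]
  rw [← e1, ← e2]
  ring

theorem rectIntegral_eq_zero {c c' h : ℝ} (hc : c ≤ c') (hh : 0 < h) {F : ℂ → ℂ}
    (hF : DifferentiableOn ℂ F (closedRect c c' h)) : rectIntegral c c' h F = 0 := by
  have h1 := Complex.integral_boundary_rect_eq_zero_of_differentiableOn F ⟨c, -h⟩ ⟨c', h⟩
    (hF.mono fun s hs => by
      rw [Complex.mem_reProdIm] at hs
      simpa [Set.uIcc_of_le hc, Set.uIcc_of_le (show -h ≤ h by linarith), closedRect] using hs)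
  simp only [smul_eq_mul] at h1
  rw [← h1, rectIntegral]
  simp [sub_eq_add_neg]

/-- Every boundary point satisfies the stated alternative. Thus an integrand may be replaced by an
analytic extension that differs from it at integers inside the rectangle, where Gamma factors take
default values. -/
theorem rectIntegral_congr {c c' h : ℝ} (hc : c ≤ c') (hh : 0 < h) {F G : ℂ → ℂ}
    (hFG : ∀ s ∈ closedRect c c' h, s.re = c ∨ s.re = c' ∨ s.im ≠ 0 → F s = G s) :
    rectIntegral c c' h F = rectIntegral c c' h G := by
  have hle : -h ≤ h := by linarith
  simp only [rectIntegral]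
  refine congrArg₂ _ (congrArg₂ _ (congrArg₂ _ ?_ ?_) (congrArg _ ?_)) (congrArg _ ?_)
  all_goals refine intervalIntegral.integral_congr fun x hx => hFG _ ?_ ?_
  all_goals first | rw [Set.uIcc_of_le hle] at hx | rw [Set.uIcc_of_le hc] at hx
  · simpa [closedRect, hh.le] using hx
  · simp [hh.ne']
  · simpa [closedRect, hle] using hx
  · simp [hh.ne']
  · simpa [closedRect, hc] using hx
  · simp
  · simpa [closedRect, hc] using hx
  · simp

theorem log_sub_log_neg_of_im_pos {z : ℂ} (hz : 0 < z.im) :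
    Complex.log z - Complex.log (-z) = Real.pi * Complex.I := by
  rw [Complex.log, Complex.log, Complex.arg_neg_eq_arg_sub_pi_of_im_pos hz, norm_neg]
  push_cast
  ring

theorem log_neg_sub_log_of_im_neg {z : ℂ} (hz : z.im < 0) :
    Complex.log (-z) - Complex.log z = Real.pi * Complex.I := by
  rw [Complex.log, Complex.log, Complex.arg_neg_eq_arg_add_pi_of_im_neg hz, norm_neg]
  push_cast
  ring

theorem rectIntegral_inv {c c' h : ℝ} {a : ℝ} (hca : c < a) (hac : a < c') (hh : 0 < h) :
    rectIntegral c c' h (fun s => (s - a)⁻¹) = 2 * Real.pi * Complex.I := by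
  have hor : ∀ η : ℝ, η ≠ 0 → ∫ x in c..c', ((x + η * Complex.I : ℂ) - a)⁻¹ =
      Complex.log (c' + η * Complex.I - a) - Complex.log (c + η * Complex.I - a) := by
    intro η hη
    have hne : ∀ x : ℝ, (x + η * Complex.I - a : ℂ) ∈ Complex.slitPlane := fun x =>
      Complex.mem_slitPlane_iff.2 (Or.inr (by simpa using hη))
    refine intervalIntegral.integral_eq_sub_of_hasDerivAt
      (f := fun x : ℝ => Complex.log (x + η * Complex.I - a)) (fun x _ => ?_) ?_
    · have h1 : HasDerivAt (fun x : ℝ => (x + η * Complex.I - a : ℂ)) 1 x := by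
        simpa using ((Complex.ofRealCLM.hasDerivAt (x := x)).add_const (η * Complex.I)).sub_const
          (a : ℂ)
      simpa using h1.clog_real (hne x)
    · exact (Continuous.inv₀ (by fun_prop) fun x =>
        Complex.slitPlane_ne_zero (hne x)).intervalIntegrable _ _
  have vert : ∀ b : ℝ, ∀ σ : ℂ, σ ≠ 0 → (∀ y : ℝ, σ * (b + y * Complex.I - a) ∈
      Complex.slitPlane) → Complex.I * ∫ y in (-h)..h, ((b + y * Complex.I : ℂ) - a)⁻¹ =
      Complex.log (σ * (b + h * Complex.I - a)) -
        Complex.log (σ * (b + (-h : ℝ) * Complex.I - a)) := by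
    intro b σ hσ hne
    rw [← intervalIntegral.integral_const_mul]
    refine intervalIntegral.integral_eq_sub_of_hasDerivAt
      (f := fun y : ℝ => Complex.log (σ * (b + y * Complex.I - a))) (fun x _ => ?_) ?_
    · have h1 : HasDerivAt (fun y : ℝ => (σ * (b + y * Complex.I - a) : ℂ)) (σ * Complex.I) x := by
        simpa using! ((((Complex.ofRealCLM.hasDerivAt (x := x)).mul_const Complex.I).const_add
          (b : ℂ)).sub_const (a : ℂ)).const_mul σ
      convert! h1.clog_real (hne x) using 1
      rw [mul_div_mul_left _ _ hσ, div_eq_mul_inv]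
    · refine (continuous_const.mul (Continuous.inv₀ (by fun_prop) fun x => ?_)).intervalIntegrable _ _
      exact right_ne_zero_of_mul (Complex.slitPlane_ne_zero (hne x))
  have v1 := vert c' 1 one_ne_zero fun y => by
    left
    simpa using hac
  -- The left edge crosses the cut of the logarithm, so log(-z) is the primitive there. The two left
  -- corners, where the branches meet, contribute πi each.
  have v2 := vert c (-1) (by norm_num) fun y => by
    left
    simpa using hca
  have b1 := hor (-h) (by linarith)
  have b2 := hor h hh.ne'
  have l1 := log_sub_log_neg_of_im_pos (z := c + h * Complex.I - a) (by simpa using hh)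
  have l2 := log_neg_sub_log_of_im_neg (z := c + (-h : ℝ) * Complex.I - a) (by simpa using hh)
  have e : ∀ x : ℝ, (x - h * Complex.I : ℂ) = x + (-h : ℝ) * Complex.I := fun x => by
    push_cast; ring
  simp only [rectIntegral, e]
  rw [v1, v2, b1, b2]
  simp only [one_mul, neg_one_mul]
  linear_combination l1 + l2

theorem isOpen_strip (a b : ℝ) : IsOpen {s : ℂ | a < s.re ∧ s.re < b} :=
  (isOpen_lt continuous_const Complex.continuous_re).inter
    (isOpen_lt Complex.continuous_re continuous_const)

theorem rectIntegral_residue {c c' h a b₁ b₂ : ℝ} (hca : c < a) (hac : a < c') (hh : 0 < h)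
    (hb₁ : b₁ < c) (hb₂ : c' < b₂) {r : ℂ → ℂ}
    (hr : DifferentiableOn ℂ r {s : ℂ | b₁ < s.re ∧ s.re < b₂}) :
    rectIntegral c c' h (fun s => r s * (s - a)⁻¹) = 2 * Real.pi * Complex.I * r a := by
  have hU : {s : ℂ | b₁ < s.re ∧ s.re < b₂} ∈ 𝓝 (a : ℂ) :=
    (isOpen_strip b₁ b₂).mem_nhds ⟨by simp; linarith, by simp; linarith⟩
  -- The divided difference splits r(s)/(s - a) into an analytic function and r(a)/(s - a).
  have hd : DifferentiableOn ℂ (dslope r a) {s : ℂ | b₁ < s.re ∧ s.re < b₂} :=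
    (Complex.differentiableOn_dslope hU).2 hr
  have hsub : closedRect c c' h ⊆ {s : ℂ | b₁ < s.re ∧ s.re < b₂} := fun s hs =>
    ⟨hb₁.trans_le hs.1.1, hs.1.2.trans_lt hb₂⟩
  have hne : ∀ s ∈ closedRect c c' h, s.re = c ∨ s.re = c' ∨ s.im ≠ 0 → s ≠ a := by
    rintro s - h rfl
    rcases h with h | h | h
    · exact hca.ne' h
    · exact hac.ne h
    · exact h (by simp)
  have h0 := rectIntegral_eq_zero (hca.trans hac).le hh (hd.mono hsub)
  have h1 := rectIntegral_inv hca hac hh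
  rw [rectIntegral_congr (G := fun s => dslope r a s + r a * (s - a)⁻¹) (hca.trans hac).le hh
    fun s hs hs' => ?_]
  · have hle : -h ≤ h := by linarith
    have hI : ∀ {u : ℝ → ℂ} {p q : ℝ}, Continuous u → p ≤ q →
        (∀ x ∈ Set.Icc p q, u x ∈ closedRect c c' h ∧ u x ≠ a) →
        (∫ x in p..q, (dslope r a (u x) + r a * (u x - a)⁻¹)) =
          (∫ x in p..q, dslope r a (u x)) + r a * ∫ x in p..q, (u x - a)⁻¹ := by
      intro u p q hu hpq hux
      rw [← intervalIntegral.integral_const_mul, ← intervalIntegral.integral_add]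
      · refine ContinuousOn.intervalIntegrable ?_
        rw [Set.uIcc_of_le hpq]
        exact (hd.mono hsub).continuousOn.comp hu.continuousOn fun x hx => (hux x hx).1
      · refine ContinuousOn.intervalIntegrable ?_
        rw [Set.uIcc_of_le hpq]
        exact continuousOn_const.mul ((hu.continuousOn.sub continuousOn_const).inv₀
          fun x hx => sub_ne_zero.2 (hux x hx).2)
    have i1 := hI (u := fun x : ℝ => (x - h * Complex.I : ℂ)) (by fun_prop) (hca.trans hac).le
      fun x hx => by
        have : (x - h * Complex.I : ℂ) ∈ closedRect c c' h := by
          simpa [closedRect, hle, hh.le] using hx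
        exact ⟨this, hne _ this (by simp [hh.ne'])⟩
    have i2 := hI (u := fun x : ℝ => (x + h * Complex.I : ℂ)) (by fun_prop) (hca.trans hac).le
      fun x hx => by
        have : (x + h * Complex.I : ℂ) ∈ closedRect c c' h := by
          simpa [closedRect, hle, hh.le] using hx
        exact ⟨this, hne _ this (by simp [hh.ne'])⟩
    have i3 := hI (u := fun y : ℝ => (c' + y * Complex.I : ℂ)) (by fun_prop) hle
      fun x hx => by
        have : (c' + x * Complex.I : ℂ) ∈ closedRect c c' h := by
          simpa [closedRect, (hca.trans hac).le] using hx
        exact ⟨this, hne _ this (by simp)⟩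
    have i4 := hI (u := fun y : ℝ => (c + y * Complex.I : ℂ)) (by fun_prop) hle
      fun x hx => by
        have : (c + x * Complex.I : ℂ) ∈ closedRect c c' h := by
          simpa [closedRect, (hca.trans hac).le] using hx
        exact ⟨this, hne _ this (by simp)⟩
    simp only [rectIntegral] at h0 h1 ⊢
    rw [i1, i2, i3, i4]
    linear_combination h0 + r a * h1
  · have h2 := hne s hs hs'
    rw [dslope_of_ne _ h2, slope_def_field, div_eq_mul_inv]
    ring

theorem setIntegral_Ioi_add_one (f : ℝ → ℂ) (c : ℝ) :
    ∫ x in Set.Ioi c, f (x + 1) = ∫ x in Set.Ioi (c + 1), f x := by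
  have h := (measurePreserving_add_right volume (1 : ℝ)).setIntegral_preimage_emb
    (measurableEmbedding_addRight 1) f (Set.Ioi (c + 1))
  rw [← h]
  congr 2
  ext x
  simp

theorem loopIntegral_add_one (c h : ℝ) (F : ℂ → ℂ) :
    loopIntegral c h (fun s => F (s + 1)) = loopIntegral (c + 1) h F := by
  simp only [loopIntegral]
  rw [← setIntegral_Ioi_add_one, ← setIntegral_Ioi_add_one]
  refine congrArg₂ _ (congrArg₂ _ (congrArg _ ?_) (congrArg _ ?_)) ?_
  · congr 1; ext x; congr 1; push_cast; ring
  · congr 1; ext x; congr 1; push_cast; ring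
  · congr 1; ext x; congr 1; push_cast; ring

end SpinWhittaker

namespace SpinWhittaker

open MeasureTheory

/-! ### Growth on half-strips -/

section Growth

variable {E : Type*} [NormedAddCommGroup E] {c h δ : ℝ}

theorem add_one_mem_contourRegion {s : ℂ} (hs : s ∈ contourRegion c h δ) :
    s + 1 ∈ contourRegion c h δ := by
  refine ⟨by simpa using hs.1.trans (by linarith), by simpa using hs.2.1, fun n => ?_⟩
  have := hs.2.2 (n - 1)
  convert! this using 2
  push_cast
  ring

theorem sub_one_mem_contourRegion {s : ℂ} (hs : s ∈ contourRegion c h δ) (h1 : c + 1 ≤ s.re) :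
    s - 1 ∈ contourRegion c h δ := by
  refine ⟨by simpa using by linarith, by simpa using hs.2.1, fun n => ?_⟩
  have := hs.2.2 (n + 1)
  convert! this using 2
  push_cast
  ring

theorem isClosed_contourRegion : IsClosed (contourRegion c h δ) := by
  refine (isClosed_le continuous_const Complex.continuous_re).inter
    ((isClosed_le Complex.continuous_im.abs continuous_const).inter ?_)
  have : {s : ℂ | ∀ n : ℤ, δ ≤ ‖s - n‖} = ⋂ n : ℤ, {s : ℂ | δ ≤ ‖s - n‖} := by
    ext; simp
  have h2 : IsClosed {s : ℂ | ∀ n : ℤ, δ ≤ ‖s - n‖} := by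
    rw [this]
    exact isClosed_iInter fun n => isClosed_le continuous_const (by fun_prop)
  exact h2

/-- The region is stable under s ↦ s + 1, so an estimate for this translation carries a bound from a
compact piece to the whole half-strip. It takes the place of Stirling's formula. -/
theorem exists_bound_of_add_one_le {f : ℂ → ℂ} (hf : ContinuousOn f (contourRegion c h δ)) (R : ℝ)
    (hR : ∀ s ∈ contourRegion c h δ, R ≤ s.re → ‖f (s + 1)‖ ≤ ‖f s‖) :
    ∃ C, ∀ s ∈ contourRegion c h δ, ‖f s‖ ≤ C := by
  set R' := max R c
  have hK : IsCompact (contourRegion c h δ ∩ {s | s.re ≤ R' + 1}) := by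
    refine ((isCompact_Icc (a := c) (b := R' + 1)).reProdIm
      (isCompact_Icc (a := -h) (b := h))).of_isClosed_subset
      (isClosed_contourRegion.inter (isClosed_le Complex.continuous_re continuous_const)) ?_
    intro s hs
    rw [Complex.mem_reProdIm]
    exact ⟨⟨hs.1.1, hs.2⟩, abs_le.1 hs.1.2.1⟩
  obtain ⟨C, hC⟩ := hK.exists_bound_of_continuousOn (hf.mono Set.inter_subset_left)
  have key : ∀ n : ℕ, ∀ s ∈ contourRegion c h δ, s.re ≤ R' + 1 + n → ‖f s‖ ≤ C := by
    intro n
    induction n with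
    | zero => exact fun s hs h => hC s ⟨hs, by simpa using h⟩
    | succ n ih =>
      intro s hs h
      rcases le_or_gt s.re (R' + 1) with h1 | h1
      · exact hC s ⟨hs, h1⟩
      · have h2 := sub_one_mem_contourRegion hs ((add_le_add_left (le_max_right R c) 1).trans h1.le)
        have h3 := hR (s - 1) h2 (by
          have := le_max_left R c
          simp only [Complex.sub_re, Complex.one_re]
          linarith)
        rw [sub_add_cancel] at h3
        refine h3.trans (ih _ h2 ?_)
        simp only [Complex.sub_re, Complex.one_re]
        push_cast at h
        linarith
  refine ⟨C, fun s hs => ?_⟩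
  obtain ⟨n, hn⟩ := exists_nat_ge (s.re - (R' + 1))
  exact key n s hs (by linarith)

theorem norm_le_re_add {s : ℂ} (hs : s ∈ contourRegion c h δ) : ‖s‖ ≤ s.re + (2 * |c| + h) := by
  have h1 := Complex.norm_le_abs_re_add_abs_im s
  have h2 : |s.re| ≤ s.re + 2 * |c| := by
    have := hs.1
    have h3 := neg_abs_le c
    rw [abs_le]
    constructor <;> linarith [abs_nonneg c]
  linarith [hs.2.1]

theorem moderateKernel_of_bound {f : ℂ → ℂ} (hf : ContinuousOn f (contourRegion c h δ)) {C : ℝ}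
    (hC : ∀ s ∈ contourRegion c h δ, ‖f s‖ ≤ C) :
    ModerateKernel (contourRegion c h δ) fun s (_ : E) => f s where
  cont := hf.comp continuousOn_fst fun _ hx => hx.1
  bound ρ := ⟨0, C, fun s hs p _ => by simpa using hC s hs⟩

theorem moderateKernel_id : ModerateKernel (contourRegion c h δ) fun s (_ : E) => s where
  cont := continuousOn_fst
  bound ρ := by
    -- Since Re s ≥ -|c|, the factor exp |c| · exp (Re s) is at least 1 and absorbs the additive
    -- constant.
    refine ⟨1, 1 + |2 * |c| + h| * Real.exp |c|, fun s hs p _ => ?_⟩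
    have h1 : s.re ≤ Real.exp s.re := (by linarith : s.re ≤ s.re + 1).trans (Real.add_one_le_exp _)
    have h2 : 1 ≤ Real.exp |c| * Real.exp s.re := by
      rw [← Real.exp_add]
      exact Real.one_le_exp (by linarith [hs.1, neg_abs_le c])
    have h3 := mul_le_mul_of_nonneg_left h2 (abs_nonneg (2 * |c| + h))
    have h4 := le_abs_self (2 * |c| + h)
    have h5 := norm_le_re_add hs
    rw [one_mul, add_mul, one_mul, mul_assoc]
    linarith

theorem moderateKernel_add_const (a : ℂ) :
    ModerateKernel (contourRegion c h δ) fun s (_ : E) => s + a where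
  cont := continuousOn_fst.add continuousOn_const
  bound ρ := by
    refine ⟨1, 1 + |2 * |c| + h + ‖a‖| * Real.exp |c|, fun s hs p _ => ?_⟩
    have h1 : s.re ≤ Real.exp s.re := (by linarith : s.re ≤ s.re + 1).trans (Real.add_one_le_exp _)
    have h2 : 1 ≤ Real.exp |c| * Real.exp s.re := by
      rw [← Real.exp_add]
      exact Real.one_le_exp (by linarith [hs.1, neg_abs_le c])
    have h3 := mul_le_mul_of_nonneg_left h2 (abs_nonneg (2 * |c| + h + ‖a‖))
    have h4 := le_abs_self (2 * |c| + h + ‖a‖)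
    have h5 := norm_le_re_add hs
    have h6 := norm_add_le s a
    rw [one_mul, add_mul, one_mul, mul_assoc]
    linarith

theorem moderateKernel_inv (hδ : 0 < δ) (n : ℤ) :
    ModerateKernel (contourRegion c h δ) fun s (_ : E) => (n - s)⁻¹ := by
  have h1 : ∀ s ∈ contourRegion c h δ, ((n : ℂ) - s) ≠ 0 := fun s hs =>
    sub_ne_zero.2 (ne_int_of_mem_contourRegion hδ hs n).symm
  refine moderateKernel_of_bound (f := fun s => (n - s)⁻¹) (C := δ⁻¹)
    (ContinuousOn.inv₀ (by fun_prop) h1) fun s hs => ?_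
  rw [norm_inv, norm_sub_rev]
  exact inv_anti₀ hδ (hs.2.2 n)

theorem moderateKernel_exp {g : E → ℂ} [ProperSpace E] (hg : Continuous g) :
    ModerateKernel (contourRegion c h δ) fun s p => Complex.exp (s * g p) where
  cont := by fun_prop
  bound ρ := by
    obtain ⟨C, hC⟩ := (isCompact_closedBall (0 : E) ρ).exists_bound_of_continuousOn hg.continuousOn
    refine ⟨max C 0, Real.exp ((2 * |c| + h) * max C 0), fun s hs p hp => ?_⟩
    rw [Complex.norm_exp, ← Real.exp_add, Real.exp_le_exp]
    calc (s * g p).re ≤ ‖s * g p‖ := Complex.re_le_norm _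
      _ ≤ (s.re + (2 * |c| + h)) * max C 0 := by
        rw [norm_mul]
        exact mul_le_mul (norm_le_re_add hs) ((hC p (by simpa using hp)).trans (le_max_left _ _))
          (norm_nonneg _) ((norm_nonneg _).trans (norm_le_re_add hs))
      _ = _ := by ring

theorem sin_ne_zero_of_mem (hδ : 0 < δ) {s : ℂ} (hs : s ∈ contourRegion c h δ) :
    Complex.sin (s * Real.pi) ≠ 0 := fun h0 => by
  obtain ⟨n, hn⟩ := (sin_int_mul_pi_eq_zero_iff s).1 h0
  exact ne_int_of_mem_contourRegion hδ hs n hn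

theorem moderateKernel_sin :
    ModerateKernel (contourRegion c h δ) fun s (_ : E) => Complex.sin (s * Real.pi) := by
  have hf : ContinuousOn (fun s : ℂ => Complex.sin (s * Real.pi)) (contourRegion c h δ) := by
    fun_prop
  obtain ⟨C, hC⟩ := exists_bound_of_add_one_le hf 0 fun s _ _ => by
    rw [sin_add_one_mul_pi, norm_neg]
  exact moderateKernel_of_bound hf hC

theorem moderateKernel_inv_sin (hδ : 0 < δ) :
    ModerateKernel (contourRegion c h δ) fun s (_ : E) => (Complex.sin (s * Real.pi))⁻¹ := by
  have hf : ContinuousOn (fun s : ℂ => (Complex.sin (s * Real.pi))⁻¹) (contourRegion c h δ) :=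
    ContinuousOn.inv₀ (by fun_prop) fun s hs => sin_ne_zero_of_mem hδ hs
  obtain ⟨C, hC⟩ := exists_bound_of_add_one_le hf 0 fun s _ _ => by
    rw [sin_add_one_mul_pi, norm_inv, norm_neg, norm_inv]
  exact moderateKernel_of_bound hf hC

theorem RapidKernel.moderate {S : Set ℂ} {k : ℂ → E → ℂ} (hk : RapidKernel S k) :
    ModerateKernel S k where
  cont := hk.cont
  bound ρ := by
    obtain ⟨C, hC⟩ := hk.bound ρ 0
    exact ⟨0, C, fun s hs p hp => by simpa using hC s hs p hp⟩

/-! ### Gamma functions -/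

theorem int_sub_ne_neg_nat (hδ : 0 < δ) {s : ℂ} (hs : s ∈ contourRegion c h δ) (k : ℤ) (m : ℕ) :
    (k : ℂ) - s ≠ -m := fun e => by
  refine ne_int_of_mem_contourRegion hδ hs (k + m) ?_
  push_cast
  linear_combination -e

theorem Gamma_int_sub_ne_zero (hδ : 0 < δ) {s : ℂ} (hs : s ∈ contourRegion c h δ) (k : ℤ) :
    Complex.Gamma (k - s) ≠ 0 :=
  Complex.Gamma_ne_zero (int_sub_ne_neg_nat hδ hs k)

theorem continuousOn_Gamma_int_sub (hδ : 0 < δ) (k : ℤ) :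
    ContinuousOn (fun s : ℂ => Complex.Gamma (k - s)) (contourRegion c h δ) := fun s hs =>
  (((Complex.differentiableAt_Gamma _ (int_sub_ne_neg_nat hδ hs k)).comp s
    (by fun_prop : DifferentiableAt ℂ (fun s : ℂ => (k : ℂ) - s) s)).continuousAt).continuousWithinAt

/-- As Γ(1-s) = -s Γ(-s), replacing s by s + 1 divides |Γ(1-s) e^{As}| by |s| e^{-A}. This does not
increase it once Re s ≥ e^A. -/
theorem rapidKernel_Gamma (hδ : 0 < δ) :
    RapidKernel (contourRegion c h δ) fun s (_ : E) => Complex.Gamma (1 - s) where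
  cont := by
    have := continuousOn_Gamma_int_sub (c := c) (h := h) hδ 1
    push_cast at this
    exact this.comp continuousOn_fst fun _ hx => hx.1
  bound ρ A := by
    have h1 := continuousOn_Gamma_int_sub (c := c) (h := h) hδ 1
    push_cast at h1
    obtain ⟨C, hC⟩ := exists_bound_of_add_one_le (c := c) (h := h) (δ := δ)
      (f := fun s => Complex.Gamma (1 - s) * Complex.exp (A * s))
      (h1.mul (by fun_prop)) (Real.exp A) fun s hs hsA => by
        have hs0 : s ≠ 0 := by simpa using ne_int_of_mem_contourRegion hδ hs 0
        have e1 : Complex.Gamma (1 - s) = -s * Complex.Gamma (1 - (s + 1)) := by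
          rw [show 1 - s = -s + 1 by ring, Complex.Gamma_add_one _ (neg_ne_zero.2 hs0)]
          congr 2
          ring
        rw [e1, norm_mul, norm_mul, norm_mul, norm_neg, Complex.norm_exp, Complex.norm_exp]
        have e2 : Real.exp ((A * (s + 1) : ℂ)).re = Real.exp A * Real.exp ((A * s : ℂ)).re := by
          rw [← Real.exp_add]
          congr 1
          simp
          ring
        rw [e2]
        have h2 : Real.exp A ≤ ‖s‖ := hsA.trans (Complex.re_le_norm s)
        calc _ = ‖Complex.Gamma (1 - (s + 1))‖ * (Real.exp ((A * s : ℂ)).re) * Real.exp A := by ring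
          _ ≤ ‖Complex.Gamma (1 - (s + 1))‖ * (Real.exp ((A * s : ℂ)).re) * ‖s‖ := by gcongr
          _ = _ := by ring
    refine ⟨C, fun s hs p _ => ?_⟩
    have h2 := hC s hs
    rw [norm_mul, Complex.norm_exp] at h2
    have e3 : ((A * s : ℂ)).re = A * s.re := by simp
    rw [e3] at h2
    calc ‖Complex.Gamma (1 - s)‖ = ‖Complex.Gamma (1 - s)‖ * Real.exp (A * s.re) *
          Real.exp (-A * s.re) := by rw [mul_assoc, ← Real.exp_add]; simp
      _ ≤ C * Real.exp (-A * s.re) := by gcongr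

theorem Gamma_int_add_one_sub (hδ : 0 < δ) {s : ℂ} (hs : s ∈ contourRegion c h δ) (k : ℤ) :
    Complex.Gamma ((k + 1 : ℤ) - s) = (k - s) * Complex.Gamma (k - s) := by
  have h0 : (k : ℂ) - s ≠ 0 := sub_ne_zero.2 (ne_int_of_mem_contourRegion hδ hs k).symm
  rw [← Complex.Gamma_add_one _ h0]
  congr 1
  push_cast
  ring

theorem moderateKernel_int_sub (k : ℤ) :
    ModerateKernel (contourRegion c h δ) fun s (_ : E) => (k : ℂ) - s :=
  ((moderateKernel_const (-1)).mul (moderateKernel_add_const (-k))).congr fun s _ _ => by ring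

/-- Induction in both directions from k = 1: each step introduces a factor k - s or its inverse, and
the inverse is bounded away from the integers. -/
theorem moderateKernel_Gamma_ratio (hδ : 0 < δ) (k : ℤ) :
    ModerateKernel (contourRegion c h δ)
      (fun s (_ : E) => Complex.Gamma (k - s) * (Complex.Gamma (1 - s))⁻¹) ∧
    ModerateKernel (contourRegion c h δ)
      (fun s (_ : E) => Complex.Gamma (1 - s) * (Complex.Gamma (k - s))⁻¹) := by
  induction k using Int.inductionOn' (b := 1) with
  | zero =>
    have h1 : ∀ s ∈ contourRegion c h δ, Complex.Gamma (1 - s) ≠ 0 := fun s hs => by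
      simpa using Gamma_int_sub_ne_zero hδ hs 1
    exact ⟨(moderateKernel_const 1).congr fun s hs _ => by simp [h1 s hs],
      (moderateKernel_const 1).congr fun s hs _ => by simp [h1 s hs]⟩
  | succ k _ ih =>
    refine ⟨((moderateKernel_int_sub k).mul ih.1).congr fun s hs _ => ?_,
      ((moderateKernel_inv hδ k).mul ih.2).congr fun s hs _ => ?_⟩
    · rw [Gamma_int_add_one_sub hδ hs]; ring
    · rw [Gamma_int_add_one_sub hδ hs, mul_inv]; ring
  | pred k _ ih =>
    have h1 : ∀ s ∈ contourRegion c h δ, Complex.Gamma (k - s) =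
        ((k - 1 : ℤ) - s) * Complex.Gamma ((k - 1 : ℤ) - s) := fun s hs => by
      rw [← Gamma_int_add_one_sub hδ hs, sub_add_cancel]
    have h2 : ∀ s ∈ contourRegion c h δ, ((k - 1 : ℤ) : ℂ) - s ≠ 0 := fun s hs =>
      sub_ne_zero.2 (ne_int_of_mem_contourRegion hδ hs (k - 1)).symm
    refine ⟨((moderateKernel_inv hδ (k - 1)).mul ih.1).congr fun s hs _ => ?_,
      ((moderateKernel_int_sub (k - 1)).mul ih.2).congr fun s hs _ => ?_⟩
    · rw [h1 s hs, ← mul_assoc, inv_mul_cancel_left₀ (h2 s hs)]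
    · rw [h1 s hs, mul_inv, mul_left_comm, mul_inv_cancel_left₀ (h2 s hs)]

/-- By reflection 1/Γ(1+s) = -Γ(-s) sin(πs)/π. Both Gamma factors decay, and the sine is bounded on
a horizontal strip. -/
theorem moderateKernel_inv_Gamma_one_add (hδ : 0 < δ) :
    ModerateKernel (contourRegion c h δ)
      (fun s (_ : E) => Complex.Gamma (1 - s) * (Complex.Gamma (1 + s))⁻¹) := by
  have h1 := (((rapidKernel_Gamma (E := E) (c := c) (h := h) hδ).moderate.mul
    ((moderateKernel_Gamma_ratio hδ 0).1.mul (rapidKernel_Gamma hδ).moderate)).mul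
    moderateKernel_sin).mul (moderateKernel_const (-(Real.pi : ℂ)⁻¹))
  refine h1.congr fun s hs _ => ?_
  have h2 := Complex.Gamma_mul_Gamma_one_sub (-s)
  have h3 : Complex.Gamma (1 - s) ≠ 0 := by simpa using Gamma_int_sub_ne_zero hδ hs 1
  have h4 : Complex.sin (Real.pi * -s) = -Complex.sin (s * Real.pi) := by
    rw [mul_neg, Complex.sin_neg, mul_comm]
  have h5 := sin_ne_zero_of_mem hδ hs
  have hpi : (Real.pi : ℂ) ≠ 0 := by exact_mod_cast Real.pi_ne_zero
  rw [h4, sub_neg_eq_add] at h2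
  have h6 : Complex.Gamma (1 + s) ≠ 0 := fun h0 => by
    rw [h0, mul_zero] at h2
    exact div_ne_zero hpi (neg_ne_zero.2 h5) h2.symm
  rw [eq_div_iff (neg_ne_zero.2 h5)] at h2
  have h7 : (Complex.Gamma (1 + s))⁻¹ =
      Complex.Gamma (-s) * -Complex.sin (s * Real.pi) * (Real.pi : ℂ)⁻¹ := by
    refine inv_eq_of_mul_eq_one_right ?_
    linear_combination (Real.pi : ℂ)⁻¹ * h2 + mul_inv_cancel₀ hpi
  rw [h7, Int.cast_zero, zero_sub, inv_mul_cancel_right₀ h3]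
  ring

/-! ### Bessel functions -/

theorem norm_inv_Gamma_le (hδ : 0 < δ) {ν : ℂ} (hν : ∀ n : ℤ, δ ≤ ‖ν - n‖) (k : ℕ) :
    ‖(Complex.Gamma (ν + k + 1))⁻¹‖ ≤ ‖(Complex.Gamma (1 + ν))⁻¹‖ * δ⁻¹ ^ k := by
  induction k with
  | zero => simp [add_comm]
  | succ k ih =>
    have h1 : δ ≤ ‖ν + k + 1‖ := by
      have := hν (-(k : ℤ) - 1)
      convert! this using 2
      push_cast
      ring
    have h0 : ν + k + 1 ≠ 0 := norm_pos_iff.1 (hδ.trans_le h1)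
    rw [show ν + ((k + 1 : ℕ) : ℂ) + 1 = (ν + k + 1) + 1 by push_cast; ring,
      Complex.Gamma_add_one _ h0, mul_inv, norm_mul, norm_inv, mul_comm, pow_succ, ← mul_assoc]
    exact mul_le_mul ih (inv_anti₀ hδ h1) (by positivity) (by positivity)

/-- Passing from Γ(ν+1) to Γ(ν+k+1) introduces k factors of modulus at least δ. The series is
dominated by 1/|Γ(1+ν)| times an exponential series, uniformly in ν away from the integers. -/
theorem norm_hypLimit_le (hδ : 0 < δ) {ν : ℂ} (hν : ∀ n : ℤ, δ ≤ ‖ν - n‖) (y : ℂ) :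
    ‖hypLimit ν y‖ ≤ ‖(Complex.Gamma (1 + ν))⁻¹‖ * Real.exp (‖y‖ * δ⁻¹) := by
  have hs : HasSum (fun k : ℕ => ‖(Complex.Gamma (1 + ν))⁻¹‖ *
      ((‖y‖ * δ⁻¹) ^ k / k.factorial)) (‖(Complex.Gamma (1 + ν))⁻¹‖ * Real.exp (‖y‖ * δ⁻¹)) := by
    refine HasSum.mul_left _ ?_
    rw [Real.exp_eq_exp_ℝ]
    exact NormedSpace.expSeries_div_hasSum_exp _
  rw [hypLimit]
  refine tsum_of_norm_bounded hs fun k => ?_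
  have h1 := norm_inv_Gamma_le hδ hν k
  rw [div_eq_mul_inv, mul_inv, norm_mul, norm_mul, norm_pow, norm_inv, Complex.norm_natCast,
    mul_pow]
  calc ‖y‖ ^ k * ((k.factorial : ℝ)⁻¹ * ‖(Complex.Gamma (ν + k + 1))⁻¹‖)
      ≤ ‖y‖ ^ k * ((k.factorial : ℝ)⁻¹ * (‖(Complex.Gamma (1 + ν))⁻¹‖ * δ⁻¹ ^ k)) := by gcongr
    _ = _ := by ring

theorem norm_besselI_mul_Gamma_le (hδ : 0 < δ) {ν : ℂ} (hν : ∀ n : ℤ, δ ≤ ‖ν - n‖) (ℓ : ℂ) :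
    ‖besselI ν ℓ * Complex.Gamma (1 + ν)‖ ≤ ‖Complex.exp (ν * (ℓ - Real.log 2))‖ *
      Real.exp (‖(Complex.exp ℓ / 2) ^ 2‖ * δ⁻¹) := by
  have h0 : Complex.Gamma (1 + ν) ≠ 0 := Complex.Gamma_ne_zero fun m e => by
    have := hν (-m - 1)
    rw [show ν - ((-m - 1 : ℤ) : ℂ) = 0 by push_cast; linear_combination e, norm_zero] at this
    linarith
  rw [besselI_eq, norm_mul, norm_mul, mul_assoc]
  refine mul_le_mul_of_nonneg_left ?_ (norm_nonneg _)
  have h1 := mul_le_mul_of_nonneg_right (norm_hypLimit_le hδ hν ((Complex.exp ℓ / 2) ^ 2))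
    (norm_nonneg (Complex.Gamma (1 + ν)))
  refine h1.trans (le_of_eq ?_)
  rw [norm_inv]
  field_simp [norm_ne_zero_iff.2 h0]

theorem moderateKernel_of_norm_le {S : Set ℂ} {k k' : ℂ → E → ℂ} (hk : ModerateKernel S k)
    (hc : ContinuousOn (fun x : ℂ × E => k' x.1 x.2) (S ×ˢ Set.univ))
    (hle : ∀ s ∈ S, ∀ p, ‖k' s p‖ ≤ ‖k s p‖) : ModerateKernel S k' where
  cont := hc
  bound ρ := by
    obtain ⟨A, C, hC⟩ := hk.bound ρ
    exact ⟨A, C, fun s hs p hp => (hle s hs p).trans (hC s hs p hp)⟩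

theorem moderateKernel_besselI_aux (hδ : 0 < δ) (σ : ℂ) (hσ : σ = 1 ∨ σ = -1) :
    ModerateKernel (contourRegion c h δ) fun s (p : ℂ × ℂ) =>
      besselI (σ * s) p.1 * Complex.Gamma (1 + σ * s) := by
  have hdist : ∀ s ∈ contourRegion c h δ, ∀ n : ℤ, δ ≤ ‖σ * s - n‖ := by
    intro s hs n
    rcases hσ with rfl | rfl
    · simpa using hs.2.2 n
    · have := hs.2.2 (-n)
      rw [← norm_neg] at this
      convert! this using 2
      push_cast
      ring
  refine moderateKernel_of_norm_le
    ((moderateKernel_exp (g := fun p : ℂ × ℂ => σ * (p.1 - Real.log 2)) (by fun_prop)).mul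
    (moderateKernel_of_continuous (g := fun p : ℂ × ℂ =>
      ((Real.exp (‖(Complex.exp p.1 / 2) ^ 2‖ * δ⁻¹) : ℝ) : ℂ)) (by fun_prop))) ?_ fun s hs p => ?_
  · have h1 : Continuous fun x : ℂ × ℂ × ℂ => besselI (σ * x.1) x.2.1 :=
      continuous_besselI.comp (f := fun x : ℂ × ℂ × ℂ => (σ * x.1, x.2.1)) (by fun_prop)
    refine h1.continuousOn.mul fun x hx => ContinuousAt.continuousWithinAt ?_
    have h2 : DifferentiableAt ℂ Complex.Gamma (1 + σ * x.1) :=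
      Complex.differentiableAt_Gamma _ fun m e => by
        have := hdist x.1 hx.1 (-m - 1)
        rw [show σ * x.1 - ((-m - 1 : ℤ) : ℂ) = 0 by push_cast; linear_combination e,
          norm_zero] at this
        linarith
    exact ContinuousAt.comp (g := Complex.Gamma) (f := fun x : ℂ × ℂ × ℂ => 1 + σ * x.1)
      h2.continuousAt (by fun_prop)
  · have h1 := norm_besselI_mul_Gamma_le hδ (hdist s hs) p.1
    rw [norm_mul (Complex.exp _), Complex.norm_real, Real.norm_of_nonneg (Real.exp_pos _).le]
    convert! h1 using 3
    congr 1
    ring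

theorem ModerateKernel.add {E : Type*} [NormedAddCommGroup E] {k k' : ℂ → E → ℂ}
    (h1 : ModerateKernel (contourRegion c h δ) k) (h2 : ModerateKernel (contourRegion c h δ) k') :
    ModerateKernel (contourRegion c h δ) fun s p => k s p + k' s p := by
  refine ⟨h1.cont.add h2.cont, fun ρ => ?_⟩
  obtain ⟨A, C, hC⟩ := h1.bound ρ
  obtain ⟨A', C', hC'⟩ := h2.bound ρ
  -- Because Re s ≥ -|c|, passing from the exponent A to the larger one costs at most exp (|c| ·
  -- (max A A' - A)).
  refine ⟨max A A', |C| * Real.exp (|c| * (max A A' - A)) +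
    |C'| * Real.exp (|c| * (max A A' - A')), fun s hs p hp => ?_⟩
  have hre : -|c| ≤ s.re := (neg_abs_le c).trans hs.1
  have key : ∀ B D : ℝ, B ≤ max A A' → D * Real.exp (B * s.re) ≤
      |D| * Real.exp (|c| * (max A A' - B)) * Real.exp (max A A' * s.re) := by
    intro B D hB
    rw [mul_assoc, ← Real.exp_add]
    refine mul_le_mul (le_abs_self D) (Real.exp_le_exp.2 ?_) (Real.exp_pos _).le (abs_nonneg D)
    nlinarith [mul_nonneg (sub_nonneg.2 hB) (by linarith : 0 ≤ s.re + |c|)]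
  rw [add_mul]
  exact (norm_add_le _ _).trans (add_le_add ((hC s hs p hp).trans (key A C (le_max_left _ _)))
    ((hC' s hs p hp).trans (key A' C' (le_max_right _ _))))

/-- The function I_{-s} has the size of 1/Γ(1-s) up to exponentials. In K_{-s} the second function
I_s has the size of 1/Γ(1+s), which is also controlled after multiplication by Γ(1-s); the factor
1/sin πs is bounded. -/
theorem moderateKernel_bessel (hδ : 0 < δ) (L : Kind) :
    ModerateKernel (contourRegion c h δ) fun s (p : ℂ × ℂ) =>
      bessel L (-s) p.1 * Complex.Gamma (1 - s) := by
  have h1 : ModerateKernel (contourRegion c h δ) fun s (p : ℂ × ℂ) =>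
      besselI (-s) p.1 * Complex.Gamma (1 - s) :=
    (moderateKernel_besselI_aux hδ (-1) (Or.inr rfl)).congr fun s _ p => by
      rw [neg_one_mul, sub_eq_add_neg]
  cases L with
  | I => exact h1
  | K =>
    have h2 : ModerateKernel (contourRegion c h δ) fun s (p : ℂ × ℂ) =>
        besselI s p.1 * Complex.Gamma (1 - s) :=
      ((moderateKernel_besselI_aux hδ 1 (Or.inl rfl)).mul
        (moderateKernel_inv_Gamma_one_add hδ)).congr fun s hs p => by
          have h6 : Complex.Gamma (1 + s) ≠ 0 := Complex.Gamma_ne_zero fun m e => by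
            refine ne_int_of_mem_contourRegion hδ hs (-m - 1) ?_
            push_cast
            linear_combination e
          simp only [one_mul]
          field_simp
    have h3 : ModerateKernel (contourRegion c h δ) fun s (p : ℂ × ℂ) =>
        (besselI (-s) p.1 - besselI s p.1) * Complex.Gamma (1 - s) := by
      refine (h1.add (h2.mul (moderateKernel_const (-1)))).congr fun s _ p => ?_
      ring
    refine ((h3.mul (moderateKernel_inv_sin hδ)).mul
      (moderateKernel_const (Real.pi / 2 : ℂ))).congr fun s hs p => ?_
    change besselK (-s) p.1 * _ = _
    rw [besselK_neg (sin_ne_zero_of_mem hδ hs)]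
    ring

end Growth

end SpinWhittaker

namespace SpinWhittaker

open MeasureTheory

/-! ### The quotients of Gamma functions -/

theorem prod_Icc_left {a b : ℕ} (h : a ≤ b) (f : ℕ → ℂ) :
    ∏ p ∈ Finset.Icc a b, f p = f a * ∏ p ∈ Finset.Icc (a + 1) b, f p := by
  rw [← Finset.insert_Icc_add_one_left_eq_Icc h, Finset.prod_insert (by simp)]

theorem sin_add_int_mul_pi_eq (n : ℤ) :
    ∃ κ : ℂ, (κ = 1 ∨ κ = -1) ∧
      ∀ s : ℂ, Complex.sin ((s + n) * Real.pi) = κ * Complex.sin (s * Real.pi) := by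
  induction n using Int.induction_on with
  | zero => exact ⟨1, Or.inl rfl, fun s => by simp⟩
  | succ n ih =>
    obtain ⟨κ, hκ, h⟩ := ih
    refine ⟨-κ, by rcases hκ with rfl | rfl <;> simp, fun s => ?_⟩
    have := sin_add_one_mul_pi (s + (n : ℤ))
    rw [h] at this
    push_cast at this ⊢
    rw [← add_assoc, this]
    ring
  | pred n ih =>
    obtain ⟨κ, hκ, h⟩ := ih
    refine ⟨-κ, by rcases hκ with rfl | rfl <;> simp, fun s => ?_⟩
    have := sin_add_one_mul_pi (s + (-(n : ℤ) - 1 : ℤ))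
    rw [show s + ((-(n : ℤ) - 1 : ℤ) : ℂ) + 1 = s + (-(n : ℤ) : ℤ) by push_cast; ring, h] at this
    rw [neg_mul, this, neg_neg]

/-- For integral a the shift changes sin πs only by a sign, so all reflections below involve the
same sine and their sines can cancel. -/
theorem Gamma_reflection_int (a : ℤ) :
    ∃ κ : ℂ, (κ = 1 ∨ κ = -1) ∧ ∀ s : ℂ, Complex.sin (s * Real.pi) ≠ 0 →
      Complex.Gamma (-(a : ℂ) - s) * Complex.Gamma (1 + a + s) * Complex.sin (s * Real.pi) =
        κ * Real.pi := by
  obtain ⟨κ, hκ, h⟩ := sin_add_int_mul_pi_eq a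
  refine ⟨-κ, by rcases hκ with rfl | rfl <;> simp, fun s hs => ?_⟩
  have h1 := Complex.Gamma_mul_Gamma_one_sub (-(a : ℂ) - s)
  have h2 : Complex.sin (Real.pi * (-(a : ℂ) - s)) = -(κ * Complex.sin (s * Real.pi)) := by
    rw [← h s, ← Complex.sin_neg]
    congr 1
    ring
  have hκ0 : κ ≠ 0 := by rcases hκ with rfl | rfl <;> simp
  have hκ2 : κ * κ = 1 := by rcases hκ with rfl | rfl <;> simp
  rw [h2, show 1 - (-(a : ℂ) - s) = 1 + a + s by ring,
    eq_div_iff (neg_ne_zero.2 (mul_ne_zero hκ0 hs))] at h1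
  linear_combination -κ * h1 - Complex.Gamma (-(a : ℂ) - s) * Complex.Gamma (1 + a + s) *
    Complex.sin (s * Real.pi) * hκ2

section Quotient

variable {N : ℕ} {α β : ℕ → ℝ}

theorem gammaQuotient_one (s : ℂ) : gammaQuotient N α β 1 s =
    (∏ p ∈ Finset.Icc 1 N, Complex.Gamma (-(α p : ℂ) - s)) /
      ∏ p ∈ Finset.Icc 3 N, Complex.Gamma (1 - (β p : ℂ) - s) := by
  simp [gammaQuotient]

theorem ne_int_of_sin_ne_zero {s : ℂ} (hs : Complex.sin (s * Real.pi) ≠ 0) (n : ℤ) : s ≠ n :=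
  fun e => hs ((sin_int_mul_pi_eq_zero_iff s).2 ⟨n, e⟩)

/-- For `j ≥ 2` the quotients are, up to sign, multiples of the first one. -/
theorem gammaQuotient_eq_sin_mul (H : Interlacing N α β) {j : ℕ} (hj : 2 ≤ j) (hjN : j ≤ N) :
    ∃ κ : ℂ, (κ = 1 ∨ κ = -1) ∧ ∀ s : ℂ, Complex.sin (s * Real.pi) ≠ 0 →
      gammaQuotient N α β j s =
        κ * (Complex.sin (s * Real.pi) / Real.pi) * gammaQuotient N α β 1 s := by
  have hpi : (Real.pi : ℂ) ≠ 0 := by exact_mod_cast Real.pi_ne_zero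
  have h2N := H.two_le
  induction j, hj using Nat.le_induction with
  | base =>
    obtain ⟨a, ha⟩ := H.int_alpha 1 le_rfl (by omega)
    obtain ⟨κ, hκ, h⟩ := Gamma_reflection_int a
    refine ⟨κ, hκ, fun s hs => ?_⟩
    have h1 := h s hs
    have hκ2 : κ * κ = 1 := by rcases hκ with rfl | rfl <;> simp
    have hne : Complex.Gamma (-(a : ℂ) - s) * Complex.Gamma (1 + a + s) ≠ 0 := fun h0 => by
      rw [h0, zero_mul] at h1
      rcases hκ with rfl | rfl <;> simp [hpi, eq_comm] at h1
    have hg1 := right_ne_zero_of_mul hne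
    have e : (α 1 : ℂ) = a := by rw [ha]; simp
    rw [gammaQuotient_one, gammaQuotient, prod_Icc_left (show 1 ≤ N by omega)]
    simp only [show Finset.Icc 3 2 = ∅ by rfl, Finset.prod_empty, mul_one,
      show Finset.Icc 1 (2 - 1) = {1} by rfl, Finset.prod_singleton,
      show max 3 (2 + 1) = 3 by rfl, show 1 + 1 = 2 by rfl, e]
    have h3 : (Complex.Gamma (1 + a + s))⁻¹ =
        κ * (Complex.sin (s * Real.pi) / Real.pi) * Complex.Gamma (-(a : ℂ) - s) := by
      refine inv_eq_of_mul_eq_one_right ?_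
      linear_combination κ / Real.pi * h1 + κ * κ * mul_inv_cancel₀ hpi + hκ2
    rw [div_eq_mul_inv, mul_inv, h3]
    ring
  | succ j hj ih =>
    obtain ⟨κ, hκ, ih⟩ := ih (by omega)
    obtain ⟨a, ha⟩ := H.int_alpha j (by omega) (by omega)
    obtain ⟨b, hb⟩ := H.int_beta (j + 1) (by omega) hjN
    obtain ⟨κ₁, hκ₁, h₁⟩ := Gamma_reflection_int a
    obtain ⟨κ₂, hκ₂, h₂⟩ := Gamma_reflection_int (b - 1)
    refine ⟨κ₁ * κ₂ * κ, by
      rcases hκ with rfl | rfl <;> rcases hκ₁ with rfl | rfl <;> rcases hκ₂ with rfl | rfl <;> simp,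
      fun s hs => ?_⟩
    have e1 : (α j : ℂ) = a := by rw [ha]; simp
    have e2 : (β (j + 1) : ℂ) = b := by rw [hb]; simp
    have h1 := h₁ s hs
    have h2 := h₂ s hs
    rw [show -((b - 1 : ℤ) : ℂ) - s = 1 - b - s by push_cast; ring,
      show 1 + ((b - 1 : ℤ) : ℂ) + s = b + s by push_cast; ring] at h2
    have hg : ∀ {x y z w : ℂ}, x * y * z = w → w ≠ 0 → x ≠ 0 ∧ y ≠ 0 := fun h0 hw => by
      constructor <;> rintro rfl <;> simp at h0 <;> exact hw h0.symm
    have hk : ∀ {κ : ℂ}, κ = 1 ∨ κ = -1 → κ * Real.pi ≠ 0 := fun h0 => by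
      rcases h0 with rfl | rfl <;> simp [hpi]
    obtain ⟨g1, g2⟩ := hg h1 (hk hκ₁)
    obtain ⟨g3, g4⟩ := hg h2 (hk hκ₂)
    have hκ₁2 : κ₁ * κ₁ = 1 := by rcases hκ₁ with rfl | rfl <;> simp
    -- Passing from j to j + 1 reflects one factor with α_j and one with β_{j+1}. The two sines
    -- cancel up to sign.
    have key : Complex.Gamma (1 - b - s) * Complex.Gamma (b + s) =
        κ₁ * κ₂ * (Complex.Gamma (-(a : ℂ) - s) * Complex.Gamma (1 + a + s)) := by
      refine mul_right_cancel₀ hs ?_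
      linear_combination h2 - κ₁ * κ₂ * h1 - κ₂ * Real.pi * hκ₁2
    rw [mul_assoc (κ₁ * κ₂), mul_assoc (κ₁ * κ₂), ← ih s hs]
    simp only [gammaQuotient]
    obtain ⟨i, rfl⟩ : ∃ i, j = i + 1 := ⟨j - 1, by omega⟩
    rw [prod_Icc_left (show i + 1 ≤ N by omega), Finset.prod_Icc_succ_top (show 3 ≤ i + 1 + 1 by omega),
      show max 3 (i + 1 + 1 + 1) = i + 1 + 1 + 1 by omega, show max 3 (i + 1 + 1) = i + 1 + 1 by omega,
      show i + 1 + 1 - 1 = i + 1 by omega, show i + 1 - 1 = i by omega,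
      Finset.prod_Icc_succ_top (show 1 ≤ i + 1 by omega),
      prod_Icc_left (show i + 1 + 1 ≤ N by omega) (fun p => Complex.Gamma (1 - (β p : ℂ) - s)),
      e1, e2]
    simp only [div_eq_mul_inv, mul_inv]
    set X := ∏ p ∈ Finset.Icc (i + 1 + 1) N, Complex.Gamma (-(α p : ℂ) - s)
    set Y := ∏ p ∈ Finset.Icc 3 (i + 1), Complex.Gamma ((β p : ℂ) + s)
    set Z := (∏ p ∈ Finset.Icc 1 i, Complex.Gamma (1 + (α p : ℂ) + s))⁻¹
    set W := (∏ p ∈ Finset.Icc (i + 1 + 1 + 1) N, Complex.Gamma (1 - (β p : ℂ) - s))⁻¹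
    field_simp
    linear_combination X * Y * Z * W * key

/-- The functional equation of Γ is applied to each factor. The N factors in the numerator and the N
- 2 in the denominator each give a sign -1, and 2N - 2 is even. The second alternative covers the
poles. -/
theorem gammaQuotient_one_recurrence (h2N : 2 ≤ N) (s : ℂ) :
    gammaQuotient N α β 1 s * ∏ p ∈ Finset.Icc 1 N, (s + α p) =
      gammaQuotient N α β 1 (s - 1) * ∏ p ∈ Finset.Icc 3 N, (s - 1 + β p) ∨
      ∃ n : ℤ, ∃ p, 1 ≤ p ∧ p ≤ N ∧ s = n - α p := by
  by_cases hex : ∃ n : ℤ, ∃ p, 1 ≤ p ∧ p ≤ N ∧ s = n - α p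
  · exact Or.inr hex
  refine Or.inl ?_
  rw [gammaQuotient_one, gammaQuotient_one, div_eq_mul_inv, div_eq_mul_inv,
    ← Finset.prod_inv_distrib, ← Finset.prod_inv_distrib, mul_right_comm,
    ← Finset.prod_mul_distrib, mul_assoc, ← Finset.prod_mul_distrib]
  have e1 : ∀ p ∈ Finset.Icc 1 N, Complex.Gamma (-(α p : ℂ) - s) * (s + α p) =
      -1 * Complex.Gamma (-(α p : ℂ) - (s - 1)) := fun p hp => by
    have hp' := Finset.mem_Icc.1 hp
    have h0 : -(α p : ℂ) - s ≠ 0 := fun h0 =>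
      hex ⟨0, p, hp'.1, hp'.2, by push_cast; linear_combination -h0⟩
    rw [show -(α p : ℂ) - (s - 1) = -(α p : ℂ) - s + 1 by ring, Complex.Gamma_add_one _ h0]
    ring
  have e2 : ∀ p ∈ Finset.Icc 3 N, (Complex.Gamma (1 - (β p : ℂ) - s))⁻¹ =
      -1 * ((Complex.Gamma (1 - (β p : ℂ) - (s - 1)))⁻¹ * (s - 1 + β p)) := fun p hp => by
    rw [inv_Gamma_eq, show 1 - (β p : ℂ) - (s - 1) = 1 - (β p : ℂ) - s + 1 by ring]
    ring
  rw [Finset.prod_congr rfl e1, Finset.prod_congr rfl e2, Finset.prod_mul_distrib,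
    Finset.prod_mul_distrib, Finset.prod_const, Finset.prod_const, Nat.card_Icc, Nat.card_Icc]
  have hsign : (-1 : ℂ) ^ (N + 1 - 1) * (-1) ^ (N + 1 - 3) = 1 := by
    rw [← pow_add, show N + 1 - 1 + (N + 1 - 3) = 2 * (N - 1) by omega, pow_mul]
    simp
  linear_combination (∏ p ∈ Finset.Icc 1 N, Complex.Gamma (-(α p : ℂ) - (s - 1))) *
    (∏ p ∈ Finset.Icc 3 N, (Complex.Gamma (1 - (β p : ℂ) - (s - 1)))⁻¹ * (s - 1 + β p)) * hsign

/-- The sign in the recurrence for the quotients. -/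
def recSign (j : ℕ) : ℂ := if j = 1 then 1 else -1

/-- For j ≥ 2 the quotient carries an additional factor sin πs, which changes sign when s is
replaced by s - 1; this is the origin of `recSign`. -/
theorem gammaQuotient_recurrence (H : Interlacing N α β) {j : ℕ} (hj : 1 ≤ j) (hjN : j ≤ N) {s : ℂ}
    (hs : Complex.sin (s * Real.pi) ≠ 0) :
    gammaQuotient N α β j s * ∏ p ∈ Finset.Icc 1 N, (s + α p) =
      recSign j * gammaQuotient N α β j (s - 1) * ∏ p ∈ Finset.Icc 3 N, (s - 1 + β p) := by
  have h1 : gammaQuotient N α β 1 s * ∏ p ∈ Finset.Icc 1 N, (s + α p) =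
      gammaQuotient N α β 1 (s - 1) * ∏ p ∈ Finset.Icc 3 N, (s - 1 + β p) := by
    rcases gammaQuotient_one_recurrence (α := α) (β := β) H.two_le s with h | ⟨n, p, hp, hpN, h⟩
    · exact h
    · obtain ⟨a, ha⟩ := H.int_alpha p hp hpN
      rw [ha] at h
      exact absurd (by rw [h]; push_cast; ring) (ne_int_of_sin_ne_zero hs (n - a))
  rcases hj.eq_or_lt with rfl | hj
  · rw [h1, recSign, if_pos rfl, one_mul]
  · obtain ⟨κ, -, hκ⟩ := gammaQuotient_eq_sin_mul H hj hjN
    have h2 := sin_add_one_mul_pi (s - 1)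
    rw [sub_add_cancel] at h2
    rw [hκ s hs, hκ (s - 1) (fun h0 => hs (by rw [h2, h0, neg_zero])), recSign, if_neg (by omega)]
    linear_combination κ * (Complex.sin (s * Real.pi) / Real.pi) * h1 +
      κ * gammaQuotient N α β 1 (s - 1) * (∏ p ∈ Finset.Icc 3 N, (s - 1 + (β p : ℂ))) / Real.pi * h2

/-- The weights of the Mellin-Barnes kernels: growth at most `Γ(1 - s)²` up to exponentials. -/
def AdmissibleWeight (S : Set ℂ) (w : ℂ → ℂ) : Prop :=
  ModerateKernel S fun s (_ : ℂ × ℂ) => w s * (Complex.Gamma (1 - s))⁻¹ ^ 2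

/-- Each Gamma factor is Γ(1-s) up to a moderate ratio, because the exponents are integers. There
are two more factors in the numerator than in the denominator. For j ≥ 2 only a bounded sine is
added. -/
theorem admissible_gammaQuotient (H : Interlacing N α β) {c h δ : ℝ} (hδ : 0 < δ) {j : ℕ}
    (hj : 1 ≤ j) (hjN : j ≤ N) :
    AdmissibleWeight (contourRegion c h δ) (gammaQuotient N α β j) := by
  have h1 : AdmissibleWeight (contourRegion c h δ) (gammaQuotient N α β 1) := by
    have hA : ModerateKernel (contourRegion c h δ) fun s (_ : ℂ × ℂ) =>
        ∏ p ∈ Finset.Icc 1 N, (Complex.Gamma (-(α p : ℂ) - s) * (Complex.Gamma (1 - s))⁻¹) :=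
      ModerateKernel.prod _ fun p hp => by
        obtain ⟨hp, hp'⟩ := Finset.mem_Icc.1 hp
        obtain ⟨a, ha⟩ := H.int_alpha p hp hp'
        refine (moderateKernel_Gamma_ratio hδ (-a)).1.congr fun s _ _ => ?_
        rw [ha]
        push_cast
        rfl
    have hB : ModerateKernel (contourRegion c h δ) fun s (_ : ℂ × ℂ) =>
        ∏ p ∈ Finset.Icc 3 N, (Complex.Gamma (1 - s) * (Complex.Gamma (1 - (β p : ℂ) - s))⁻¹) :=
      ModerateKernel.prod _ fun p hp => by
        obtain ⟨hp, hp'⟩ := Finset.mem_Icc.1 hp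
        obtain ⟨b, hb⟩ := H.int_beta p hp hp'
        refine (moderateKernel_Gamma_ratio hδ (1 - b)).2.congr fun s _ _ => ?_
        rw [hb]
        push_cast
        rfl
    refine (hA.mul hB).congr fun s hs _ => ?_
    have h0 : Complex.Gamma (1 - s) ≠ 0 := by simpa using Gamma_int_sub_ne_zero hδ hs 1
    have h2N := H.two_le
    rw [gammaQuotient_one, Finset.prod_mul_distrib, Finset.prod_mul_distrib, Finset.prod_const,
      Finset.prod_const, Finset.prod_inv_distrib, Nat.card_Icc, Nat.card_Icc,
      show N + 1 - 1 = (N + 1 - 3) + 2 by omega, pow_add]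
    have h3 : (Complex.Gamma (1 - s))⁻¹ ^ (N + 1 - 3) * Complex.Gamma (1 - s) ^ (N + 1 - 3) = 1 := by
      rw [← mul_pow, inv_mul_cancel₀ h0, one_pow]
    rw [div_eq_mul_inv]
    linear_combination -(∏ p ∈ Finset.Icc 1 N, Complex.Gamma (-(α p : ℂ) - s)) *
      (∏ p ∈ Finset.Icc 3 N, Complex.Gamma (1 - (β p : ℂ) - s))⁻¹ *
      (Complex.Gamma (1 - s))⁻¹ ^ 2 * h3
  rcases hj.eq_or_lt with rfl | hj
  · exact h1
  · obtain ⟨κ, -, hκ⟩ := gammaQuotient_eq_sin_mul H hj hjN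
    refine ((ModerateKernel.mul h1 moderateKernel_sin).mul
      (moderateKernel_const (κ / Real.pi))).congr fun s hs _ => ?_
    rw [hκ s (sin_ne_zero_of_mem hδ hs)]
    ring

theorem differentiableAt_Gamma_of_re_pos {z : ℂ} (hz : 0 < z.re) :
    DifferentiableAt ℂ Complex.Gamma z :=
  Complex.differentiableAt_Gamma z fun m e => by
    have := congrArg Complex.re e
    simp at this
    have h0 : (0 : ℝ) ≤ m := m.cast_nonneg
    linarith

theorem differentiableOn_Gamma_real_sub (a : ℝ) {S : Set ℂ} (hS : ∀ s ∈ S, s.re < a) :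
    DifferentiableOn ℂ (fun s : ℂ => Complex.Gamma (a - s)) S := fun s hs =>
  ((differentiableAt_Gamma_of_re_pos (by simpa using hS s hs)).comp s
    (by fun_prop : DifferentiableAt ℂ (fun s : ℂ => (a : ℂ) - s) s)).differentiableWithinAt

theorem differentiableOn_Gamma_real_add (a : ℝ) {S : Set ℂ} (hS : ∀ s ∈ S, -a < s.re) :
    DifferentiableOn ℂ (fun s : ℂ => Complex.Gamma (a + s)) S := fun s hs =>
  ((differentiableAt_Gamma_of_re_pos (by
    have := hS s hs
    simp only [Complex.add_re, Complex.ofReal_re]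
    linarith)).comp s
    (by fun_prop : DifferentiableAt ℂ (fun s : ℂ => (a : ℂ) + s) s)).differentiableWithinAt

theorem differentiable_inv_denominator (j : ℕ) : Differentiable ℂ fun s : ℂ =>
    ((∏ p ∈ Finset.Icc 1 (j - 1), Complex.Gamma (1 + (α p : ℂ) + s)) *
      ∏ p ∈ Finset.Icc (max 3 (j + 1)) N, Complex.Gamma (1 - (β p : ℂ) - s))⁻¹ := by
  simp only [mul_inv, ← Finset.prod_inv_distrib]
  refine Differentiable.mul (Differentiable.fun_finsetProd fun p _ => ?_)
    (Differentiable.fun_finsetProd fun p _ => ?_)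
  · exact Complex.differentiable_one_div_Gamma.comp (by fun_prop)
  · exact Complex.differentiable_one_div_Gamma.comp (by fun_prop)

theorem differentiableOn_beta_prod (H : Interlacing N α β) {j : ℕ} (hjN : j ≤ N) {S : Set ℂ}
    (hS : ∀ s ∈ S, -α j - 1 < s.re) :
    DifferentiableOn ℂ (fun s : ℂ => ∏ p ∈ Finset.Icc 3 j, Complex.Gamma ((β p : ℂ) + s)) S := by
  refine DifferentiableOn.fun_finsetProd fun p hp => ?_
  obtain ⟨hp, hp'⟩ := Finset.mem_Icc.1 hp
  refine differentiableOn_Gamma_real_add (β p) fun s hs => ?_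
  have := H.alpha_add_one_le_beta hp hp' hjN
  linarith [hS s hs]

/-- The product of the quotient with `∏ (s + α_p)` extends analytically across `-α_j`. -/
theorem exists_extension_mul_prod (H : Interlacing N α β) {j : ℕ} (hj : 1 ≤ j) (hjN : j ≤ N) :
    ∃ r : ℂ → ℂ, DifferentiableOn ℂ r {s : ℂ | -α j - 1 < s.re ∧ s.re < -α j + 1} ∧
      ∀ s, Complex.sin (s * Real.pi) ≠ 0 →
        gammaQuotient N α β j s * ∏ p ∈ Finset.Icc 1 N, (s + α p) = r s := by
  -- For p ≥ j one has (s + α_p) Γ(-α_p - s) = -Γ(1 - α_p - s), which is regular for Re s < 1 - α_j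
  -- because α_p ≤ α_j. The factors Γ(β_p + s), p ≤ j, are regular for Re s > -α_j - 1 because β_p ≥
  -- α_j + 1.
  refine ⟨fun s => (∏ p ∈ Finset.Icc j N, -Complex.Gamma ((1 - α p : ℝ) - s)) *
    (∏ p ∈ Finset.Icc 1 (j - 1), (s + α p)) *
    (∏ p ∈ Finset.Icc 3 j, Complex.Gamma ((β p : ℂ) + s)) *
    ((∏ p ∈ Finset.Icc 1 (j - 1), Complex.Gamma (1 + (α p : ℂ) + s)) *
      ∏ p ∈ Finset.Icc (max 3 (j + 1)) N, Complex.Gamma (1 - (β p : ℂ) - s))⁻¹, ?_, fun s hs => ?_⟩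
  · refine (((DifferentiableOn.fun_finsetProd fun p hp => ?_).mul
      (DifferentiableOn.fun_finsetProd fun p hp => by fun_prop)).mul
      (differentiableOn_beta_prod H hjN fun s hs => hs.1)).mul
      (differentiable_inv_denominator j).differentiableOn
    obtain ⟨hp, hp'⟩ := Finset.mem_Icc.1 hp
    refine (differentiableOn_Gamma_real_sub (1 - α p) fun s hs => ?_).neg
    have := H.alpha_le_of_le hj hp hp'
    linarith [hs.2]
  · have e0 : ∏ p ∈ Finset.Icc 1 N, (s + (α p : ℂ)) =
        (∏ p ∈ Finset.Icc 1 (j - 1), (s + (α p : ℂ))) * ∏ p ∈ Finset.Icc j N, (s + (α p : ℂ)) := by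
      rw [← Finset.prod_union]
      · congr 1
        ext p
        simp only [Finset.mem_Icc, Finset.mem_union]
        omega
      · rw [Finset.disjoint_left]
        intro p hp hp'
        simp only [Finset.mem_Icc] at hp hp'
        omega
    have e1 : ∏ p ∈ Finset.Icc j N, -Complex.Gamma ((1 - α p : ℝ) - s) =
        (∏ p ∈ Finset.Icc j N, Complex.Gamma (-(α p : ℂ) - s)) *
          ∏ p ∈ Finset.Icc j N, (s + (α p : ℂ)) := by
      rw [← Finset.prod_mul_distrib]
      refine Finset.prod_congr rfl fun p hp => ?_
      obtain ⟨hp, hp'⟩ := Finset.mem_Icc.1 hp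
      obtain ⟨a, ha⟩ := H.int_alpha p (by omega) hp'
      have h0 : -(α p : ℂ) - s ≠ 0 := fun h0 => ne_int_of_sin_ne_zero hs (-a) (by
        rw [ha] at h0
        push_cast at h0 ⊢
        linear_combination -h0)
      rw [show ((1 - α p : ℝ) : ℂ) - s = -(α p : ℂ) - s + 1 by push_cast; ring,
        Complex.Gamma_add_one _ h0]
      ring
    simp only [e1]
    rw [gammaQuotient, e0, div_eq_mul_inv]
    ring

/-- The first pole of the quotient to the right of the loop is simple, with the expected residue. -/
theorem exists_extension_mul_inv (H : Interlacing N α β) {j : ℕ} (hj : 1 ≤ j) (hjN : j ≤ N)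
    (hne : α 1 ≠ α 2 ∨ 2 ≤ j) :
    ∃ r : ℂ → ℂ, DifferentiableOn ℂ r {s : ℂ | -α j - 1 < s.re ∧ s.re < -α j + 1} ∧
      (∀ s, Complex.sin (s * Real.pi) ≠ 0 →
        gammaQuotient N α β j s = r s * (s - (-α j : ℝ))⁻¹) ∧
      r (-α j : ℝ) = -(leadingCoeff N α β j : ℂ) := by
  -- Only Γ(-α_j - s) = -Γ(1 - α_j - s)/(s + α_j) has a pole in the strip: for p > j one has α_p ≤
  -- α_j - 1, and this is where α₁ ≠ α₂ matters if j = 1.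
  refine ⟨fun s => -Complex.Gamma ((1 - α j : ℝ) - s) *
    (∏ p ∈ Finset.Icc (j + 1) N, Complex.Gamma ((-α p : ℝ) - s)) *
    (∏ p ∈ Finset.Icc 3 j, Complex.Gamma ((β p : ℂ) + s)) *
    ((∏ p ∈ Finset.Icc 1 (j - 1), Complex.Gamma (1 + (α p : ℂ) + s)) *
      ∏ p ∈ Finset.Icc (max 3 (j + 1)) N, Complex.Gamma (1 - (β p : ℂ) - s))⁻¹, ?_, fun s hs => ?_,
    ?_⟩
  · refine (((differentiableOn_Gamma_real_sub (1 - α j) fun s hs => by linarith [hs.2]).neg.mul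
      (DifferentiableOn.fun_finsetProd fun p hp => ?_)).mul
      (differentiableOn_beta_prod H hjN fun s hs => hs.1)).mul
      (differentiable_inv_denominator j).differentiableOn
    obtain ⟨hp, hp'⟩ := Finset.mem_Icc.1 hp
    refine differentiableOn_Gamma_real_sub (-α p) fun s hs => ?_
    have := H.alpha_add_one_le hj hp hp' hne
    linarith [hs.2]
  · obtain ⟨a, ha⟩ := H.int_alpha j hj hjN
    have h0 : -(α j : ℂ) - s ≠ 0 := fun h0 => ne_int_of_sin_ne_zero hs (-a) (by
      rw [ha] at h0
      push_cast at h0 ⊢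
      linear_combination -h0)
    have h1 : s - (-α j : ℝ) ≠ 0 := fun h1 => h0 (by push_cast at h1; linear_combination -h1)
    rw [eq_mul_inv_iff_mul_eq₀ h1, gammaQuotient]
    dsimp only
    rw [prod_Icc_left hjN,
      show ((1 - α j : ℝ) : ℂ) - s = -(α j : ℂ) - s + 1 by push_cast; ring,
      Complex.Gamma_add_one _ h0, div_eq_mul_inv]
    push_cast
    ring
  · have e1 : ∀ x : ℝ, (Real.Gamma x : ℂ) = Complex.Gamma x := fun x =>
      (Complex.Gamma_ofReal x).symm
    simp only [leadingCoeff]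
    push_cast [e1]
    have e2 : (1 - (α j : ℂ) - -(α j : ℂ)) = 1 := by ring
    rw [e2, Complex.Gamma_one, div_eq_mul_inv]
    have e3 : ∀ p, (1 - (β p : ℂ) - -(α j : ℂ)) = α j - β p + 1 := fun p => by ring
    have e4 : ∀ p, (-(α p : ℂ) - -(α j : ℂ)) = α j - α p := fun p => by ring
    have e5 : ∀ p, ((β p : ℂ) + -(α j : ℂ)) = β p - α j := fun p => by ring
    have e6 : ∀ p, (1 + (α p : ℂ) + -(α j : ℂ)) = 1 + α p - α j := fun p => by ring
    simp only [e3, e4, e5, e6]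
    ring

/-- The interlacing makes the arguments of all Gamma factors positive. -/
theorem leadingCoeff_ne_zero (H : Interlacing N α β) {j : ℕ} (hj : 1 ≤ j) (hjN : j ≤ N)
    (hne : α 1 ≠ α 2 ∨ 2 ≤ j) : leadingCoeff N α β j ≠ 0 := by
  refine div_ne_zero (mul_ne_zero (Finset.prod_ne_zero_iff.2 fun p hp => ?_)
    (Finset.prod_ne_zero_iff.2 fun p hp => ?_)) (mul_ne_zero
    (Finset.prod_ne_zero_iff.2 fun p hp => ?_) (Finset.prod_ne_zero_iff.2 fun p hp => ?_)) <;>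
  obtain ⟨hp, hp'⟩ := Finset.mem_Icc.1 hp <;> refine (Real.Gamma_pos_of_pos ?_).ne'
  · have := H.alpha_add_one_le hj hp hp' hne
    linarith
  · have := H.alpha_add_one_le_beta hp hp' hjN
    linarith
  · have := H.alpha_le_of_le hp (show p ≤ j by omega) hjN
    linarith
  · have := H.beta_le_alpha hj (show j < p by omega) (by omega) hp'
    linarith

end Quotient

end SpinWhittaker

namespace SpinWhittaker

open MeasureTheory

/-! ### Mellin-Barnes kernels -/

/-- The kernel with weight `w` and profile `b`. -/
noncomputable def mbKernel (w : ℂ → ℂ) (b : ℂ → ℂ → ℂ) (s : ℂ) (p : ℂ × ℂ) : ℂ :=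
  w s * (Complex.exp (s * p.2) * b s p.1)

/-- Profiles decay like `1 / Γ(1 - s)` up to exponentials. -/
def AdmissibleProfile (S : Set ℂ) (b : ℂ → ℂ → ℂ) : Prop :=
  ModerateKernel S fun s (p : ℂ × ℂ) => b s p.1 * Complex.Gamma (1 - s)

/-- The profile `∂_{t₁} K_{-s}(t₁)`, respectively `∂_{t₁} I_{-s}(t₁)`. -/
noncomputable def besselDeriv (L : Kind) (s ℓ : ℂ) : ℂ :=
  s * bessel L (-s) ℓ + L.sign * Complex.exp ℓ * bessel L (-(s + 1)) ℓ

/-- The profile `∂_{t₁}² K_{-s}(t₁)`, respectively `∂_{t₁}² I_{-s}(t₁)`. -/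
noncomputable def besselDeriv₂ (L : Kind) (s ℓ : ℂ) : ℂ := (s ^ 2 + Complex.exp ℓ ^ 2) * bessel L (-s) ℓ

section Kernel

variable {c h δ : ℝ} {w : ℂ → ℂ} {b b' : ℂ → ℂ → ℂ}

/-- The kernel is written as Γ(1-s) · [w Γ(1-s)⁻²] · [b Γ(1-s)] · e^{s p₂}. The first factor decays
rapidly and the others are moderate. -/
theorem rapidKernel_mbKernel (hδ : 0 < δ) (hw : AdmissibleWeight (contourRegion c h δ) w)
    (hb : AdmissibleProfile (contourRegion c h δ) b) :
    RapidKernel (contourRegion c h δ) (mbKernel w b) := by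
  have h1 := (((rapidKernel_Gamma (E := ℂ × ℂ) (c := c) (h := h) hδ).mul_moderate hw).mul_moderate
    hb).mul_moderate (moderateKernel_exp (g := Prod.snd) continuous_snd)
  refine h1.congr fun s hs p => ?_
  have h0 : Complex.Gamma (1 - s) ≠ 0 := by simpa using Gamma_int_sub_ne_zero hδ hs 1
  rw [mbKernel]
  field_simp

theorem ModerateKernel.comp_add_one {E : Type*} [NormedAddCommGroup E] {k : ℂ → E → ℂ}
    (hk : ModerateKernel (contourRegion c h δ) k) :
    ModerateKernel (contourRegion c h δ) fun s p => k (s + 1) p where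
  cont := hk.cont.comp (f := fun x : ℂ × E => (x.1 + 1, x.2)) (by fun_prop)
    fun x hx => ⟨add_one_mem_contourRegion hx.1, trivial⟩
  bound ρ := by
    obtain ⟨A, C, hC⟩ := hk.bound ρ
    refine ⟨A, C * Real.exp A, fun s hs p hp => (hC _ (add_one_mem_contourRegion hs) p hp).trans ?_⟩
    rw [mul_assoc, ← Real.exp_add, Complex.add_re, Complex.one_re, mul_add, mul_one, add_comm A]

theorem AdmissibleWeight.mul_add_const (hw : AdmissibleWeight (contourRegion c h δ) w) (a : ℂ) :
    AdmissibleWeight (contourRegion c h δ) fun s => (s + a) * w s :=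
  (ModerateKernel.mul (moderateKernel_add_const a) hw).congr fun s _ _ => by ring

theorem AdmissibleWeight.mul_id (hw : AdmissibleWeight (contourRegion c h δ) w) :
    AdmissibleWeight (contourRegion c h δ) fun s => s * w s := by
  simpa using hw.mul_add_const 0

theorem AdmissibleWeight.mul_list (hw : AdmissibleWeight (contourRegion c h δ) w) (as : List ℝ) :
    AdmissibleWeight (contourRegion c h δ) fun s => (as.map fun a : ℝ => s + (a : ℂ)).prod * w s := by
  induction as with
  | nil => simpa using hw
  | cons a as ih => simpa [mul_assoc] using ih.mul_add_const a

theorem admissibleProfile_bessel (hδ : 0 < δ) (L : Kind) :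
    AdmissibleProfile (contourRegion c h δ) fun s ℓ => bessel L (-s) ℓ :=
  moderateKernel_bessel hδ L

theorem admissibleProfile_bessel_add_one (hδ : 0 < δ) (L : Kind) :
    AdmissibleProfile (contourRegion c h δ) fun s ℓ => bessel L (-(s + 1)) ℓ := by
  refine ((moderateKernel_bessel hδ L).comp_add_one.mul
    (moderateKernel_Gamma_ratio hδ 0).2).congr fun s hs p => ?_
  have h0 := Gamma_int_sub_ne_zero hδ hs 0
  rw [show 1 - (s + 1) = ((0 : ℤ) : ℂ) - s by push_cast; ring]
  field_simp

theorem admissibleProfile_besselDeriv (hδ : 0 < δ) (L : Kind) :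
    AdmissibleProfile (contourRegion c h δ) (besselDeriv L) :=
  ((moderateKernel_id.mul (admissibleProfile_bessel hδ L)).add
    ((moderateKernel_of_continuous (g := fun p : ℂ × ℂ => L.sign * Complex.exp p.1)
      (by fun_prop)).mul (admissibleProfile_bessel_add_one hδ L))).congr fun s _ p => by
    rw [besselDeriv]; ring

theorem admissibleProfile_besselDeriv₂ (hδ : 0 < δ) (L : Kind) :
    AdmissibleProfile (contourRegion c h δ) (besselDeriv₂ L) :=
  (((moderateKernel_id.mul moderateKernel_id).add
    (moderateKernel_of_continuous (g := fun p : ℂ × ℂ => Complex.exp p.1 ^ 2)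
      (by fun_prop))).mul (admissibleProfile_bessel hδ L)).congr fun s _ p => by
    rw [besselDeriv₂]; ring

/-- This is the modified Bessel equation in the logarithmic variable; it results from the derivative
formula at s and at s + 1 together with the three-term recurrence. -/
theorem hasDerivAt_besselDeriv (L : Kind) {s : ℂ} (hs : Complex.sin (s * Real.pi) ≠ 0) (ℓ : ℂ) :
    HasDerivAt (besselDeriv L s) (besselDeriv₂ L s ℓ) ℓ := by
  have hs1 : Complex.sin ((s + 1) * Real.pi) ≠ 0 := by
    rw [sin_add_one_mul_pi]; exact neg_ne_zero.2 hs
  have h1 := hasDerivAt_bessel L hs ℓ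
  have h2 := hasDerivAt_bessel L hs1 ℓ
  have h3 := bessel_recurrence L hs1 ℓ
  rw [add_sub_cancel_right] at h3
  have h4 := (h1.const_mul s).add (((Complex.hasDerivAt_exp ℓ).const_mul L.sign).mul h2)
  convert! h4 using 1
  rw [besselDeriv₂]
  have h5 := L.sign_sq
  linear_combination (L.sign * Complex.exp ℓ) * h3 - Complex.exp ℓ ^ 2 * bessel L (-s) ℓ * h5

theorem hasDerivAt_mbKernel_fst {s : ℂ} (hb : ∀ ℓ, HasDerivAt (b s) (b' s ℓ) ℓ) (z v : ℂ) :
    HasDerivAt (fun z => mbKernel w b s (z, v)) (mbKernel w b' s (z, v)) z :=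
  ((hb z).const_mul (Complex.exp (s * v))).const_mul (w s)

theorem hasDerivAt_mbKernel_snd (s z v : ℂ) :
    HasDerivAt (fun v => mbKernel w b s (z, v)) (mbKernel (fun s => s * w s) b s (z, v)) v := by
  have h1 : HasDerivAt (fun v => Complex.exp (s * v)) (Complex.exp (s * v) * s) v := by
    simpa using ((hasDerivAt_id v).const_mul s).cexp
  convert! (h1.mul_const (b s z)).const_mul (w s) using 1
  simp only [mbKernel]
  ring

/-- The integral of a Mellin-Barnes kernel over a loop. -/
noncomputable def mbInt (w : ℂ → ℂ) (b : ℂ → ℂ → ℂ) (c h : ℝ) (p : ℂ × ℂ) : ℂ :=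
  loopIntegral c h fun s => mbKernel w b s p

theorem mellinBarnes_eq (N : ℕ) (α β : ℕ → ℝ) (c h : ℝ) (j : ℕ) (L : Kind) (ℓ₁ ℓ₂ : ℂ) :
    mellinBarnes N α β c h j L ℓ₁ ℓ₂ = 1 / (2 * Real.pi * Complex.I) *
      mbInt (gammaQuotient N α β j) (fun s ℓ => bessel L (-s) ℓ) c h (ℓ₁, ℓ₂) := rfl

theorem analyticOnNhd_mbInt (hδ : 0 < δ) (hl : LoopIn c h (contourRegion c h δ))
    (hw : AdmissibleWeight (contourRegion c h δ) w)
    (hb : AdmissibleProfile (contourRegion c h δ) b)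
    (hb' : AdmissibleProfile (contourRegion c h δ) b')
    (hd : ∀ s ∈ contourRegion c h δ, ∀ ℓ, HasDerivAt (b s) (b' s ℓ) ℓ) :
    AnalyticOnNhd ℂ (mbInt w b c h) Set.univ :=
  (rapidKernel_mbKernel hδ hw hb).analyticOnNhd (rapidKernel_mbKernel hδ hw hb')
    (rapidKernel_mbKernel hδ hw.mul_id hb) (fun s hs => hasDerivAt_mbKernel_fst (hd s hs))
    (fun s _ => hasDerivAt_mbKernel_snd s) hl

theorem hasDerivAt_mbInt_fst (hδ : 0 < δ) (hl : LoopIn c h (contourRegion c h δ))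
    (hw : AdmissibleWeight (contourRegion c h δ) w)
    (hb : AdmissibleProfile (contourRegion c h δ) b)
    (hb' : AdmissibleProfile (contourRegion c h δ) b')
    (hd : ∀ s ∈ contourRegion c h δ, ∀ ℓ, HasDerivAt (b s) (b' s ℓ) ℓ) (z v : ℂ) :
    HasDerivAt (fun z => mbInt w b c h (z, v)) (mbInt w b' c h (z, v)) z :=
  (rapidKernel_mbKernel hδ hw hb).hasDerivAt_fst (rapidKernel_mbKernel hδ hw hb')
    (fun s hs => hasDerivAt_mbKernel_fst (hd s hs)) hl z v

theorem hasDerivAt_mbInt_snd (hδ : 0 < δ) (hl : LoopIn c h (contourRegion c h δ))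
    (hw : AdmissibleWeight (contourRegion c h δ) w)
    (hb : AdmissibleProfile (contourRegion c h δ) b) (z v : ℂ) :
    HasDerivAt (fun v => mbInt w b c h (z, v)) (mbInt (fun s => s * w s) b c h (z, v)) v :=
  (rapidKernel_mbKernel hδ hw hb).hasDerivAt_snd (rapidKernel_mbKernel hδ hw.mul_id hb)
    (fun s _ => hasDerivAt_mbKernel_snd s) hl z v

end Kernel

/-! ### Convergence and leading terms -/

section Asymptotics

variable {N : ℕ} {α β : ℕ → ℝ} {c h : ℝ}

theorem Interlacing.loop_ne_int (H : Interlacing N α β) {j : ℕ} (hj : 1 ≤ j) (hjN : j ≤ N)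
    (hc : c ∈ Set.Ioo (-α j - 1) (-α j)) (n : ℤ) : c ≠ n := by
  obtain ⟨a, ha⟩ := H.int_alpha j hj hjN
  rintro rfl
  rw [ha] at hc
  have h1 : -a - 1 < n := by exact_mod_cast hc.1
  have h2 : n < -a := by exact_mod_cast hc.2
  omega

theorem loopIntegrable_mbKernel (H : Interlacing N α β) {j : ℕ} (hj : 1 ≤ j) (hjN : j ≤ N)
    (hc : ∀ n : ℤ, c ≠ n) (hh : 0 < h) (L : Kind) (p : ℂ × ℂ) (as : List ℝ) :
    LoopIntegrable c h fun s =>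
      mbKernel (fun s => (as.map fun a : ℝ => s + (a : ℂ)).prod * gammaQuotient N α β j s)
        (fun s ℓ => bessel L (-s) ℓ) s p := by
  obtain ⟨δ, hδ, hl⟩ := exists_loopIn hc hh
  exact (rapidKernel_mbKernel hδ ((admissible_gammaQuotient H hδ hj hjN).mul_list as)
    (admissibleProfile_bessel hδ L)).loopIntegrable hl p

theorem loopIntegrable_integrand (H : Interlacing N α β) {j : ℕ} (hj : 1 ≤ j) (hjN : j ≤ N)
    (hc : ∀ n : ℤ, c ≠ n) (hh : 0 < h) (L : Kind) (ℓ₁ ℓ₂ : ℂ) :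
    LoopIntegrable c h (integrand N α β j L ℓ₁ ℓ₂) := by
  simpa using! loopIntegrable_mbKernel H hj hjN hc hh L (ℓ₁, ℓ₂) []

theorem sin_ne_zero_of_edge {c c' : ℝ} (hc : ∀ n : ℤ, c ≠ n) (hc' : ∀ n : ℤ, c' ≠ n) {s : ℂ}
    (hs : s.re = c ∨ s.re = c' ∨ s.im ≠ 0) : Complex.sin (s * Real.pi) ≠ 0 := fun h0 => by
  obtain ⟨n, rfl⟩ := (sin_int_mul_pi_eq_zero_iff s).1 h0
  rcases hs with h | h | h
  · exact hc n (by simpa using h.symm)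
  · exact hc' n (by simpa using h.symm)
  · exact h (by simp)

theorem norm_loopIntegral_le {S : Set ℂ} (hl : LoopIn c h S) {F : ℂ → ℂ} {D : ℝ}
    (hF : ∀ s ∈ S, ‖F s‖ ≤ D * Real.exp (-s.re)) :
    ‖loopIntegral c h F‖ ≤ D * (2 * Real.exp (-c) + 2 * h * Real.exp (-c)) := by
  have hle : -h ≤ h := by linarith [hl.pos]
  have hint : ∫ x in Set.Ioi c, D * Real.exp (-x) = D * Real.exp (-c) := by
    rw [integral_const_mul, integral_exp_neg_Ioi]
  have h1 : ‖∫ x in Set.Ioi c, F (x - h * Complex.I)‖ ≤ D * Real.exp (-c) := by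
    rw [← hint]
    refine norm_integral_le_of_norm_le ((integrableOn_exp_neg_Ioi c).const_mul D) ?_
    filter_upwards [ae_restrict_mem measurableSet_Ioi] with x hx
    simpa using hF _ (hl.bottom hx)
  have h2 : ‖∫ x in Set.Ioi c, F (x + h * Complex.I)‖ ≤ D * Real.exp (-c) := by
    rw [← hint]
    refine norm_integral_le_of_norm_le ((integrableOn_exp_neg_Ioi c).const_mul D) ?_
    filter_upwards [ae_restrict_mem measurableSet_Ioi] with x hx
    simpa using hF _ (hl.top hx)
  have h3 : ‖∫ y in (-h)..h, F (c + y * Complex.I)‖ ≤ D * Real.exp (-c) * |h - -h| := by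
    refine intervalIntegral.norm_integral_le_of_norm_le_const fun y hy => ?_
    rw [Set.uIoc_of_le hle] at hy
    simpa using hF _ (hl.left (Set.Ioc_subset_Icc_self hy))
  rw [abs_of_nonneg (by linarith)] at h3
  rw [loopIntegral]
  refine (norm_add_le _ _).trans ((add_le_add_left (norm_add_le _ _) _).trans ?_)
  rw [norm_neg, norm_mul, Complex.norm_I, one_mul]
  linarith

/-- On the loop Re s ≥ c and |Im s| ≤ h. Hence |e^{sℓ₂}| ≤ e^{hM} e^{c Re ℓ₂} as soon as Re ℓ₂ ≤ 0,
and the rest of the kernel is integrable independently of ℓ₂. -/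
theorem exists_remainder_bound (H : Interlacing N α β) {j : ℕ} (hj : 1 ≤ j) (hjN : j ≤ N)
    (hc : ∀ n : ℤ, c ≠ n) (hh : 0 < h) (L : Kind) (a M ρ : ℝ) :
    ∃ C, ∀ ℓ₁ ℓ₂ : ℂ, ‖ℓ₁‖ ≤ ρ → ℓ₂.re ≤ 0 → |ℓ₂.im| ≤ M →
      ‖loopIntegral c h (integrand N α β j L ℓ₁ ℓ₂) * Complex.exp (a * ℓ₂)‖ ≤
        C * Real.exp ((c + a) * ℓ₂.re) := by
  obtain ⟨δ, hδ, hl⟩ := exists_loopIn hc hh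
  obtain ⟨C, hC⟩ := (rapidKernel_mbKernel hδ (admissible_gammaQuotient H hδ hj hjN)
    (admissibleProfile_bessel hδ L)).bound ρ 1
  refine ⟨C * Real.exp (h * M) * (2 * Real.exp (-c) + 2 * h * Real.exp (-c)),
    fun ℓ₁ ℓ₂ h1 h2 h3 => ?_⟩
  rw [mul_comm (loopIntegral c h _), ← loopIntegral_const_mul]
  refine (norm_loopIntegral_le hl (D := C * Real.exp (h * M) * Real.exp ((c + a) * ℓ₂.re))
    fun s hs => ?_).trans (le_of_eq (by ring))
  have h4 := hC s hs (ℓ₁, 0) (by simpa [Prod.norm_def] using h1)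
  rw [neg_one_mul] at h4
  have h5 : Complex.exp (a * ℓ₂) * integrand N α β j L ℓ₁ ℓ₂ s =
      mbKernel (gammaQuotient N α β j) (fun s ℓ => bessel L (-s) ℓ) s (ℓ₁, 0) *
        Complex.exp ((s + a) * ℓ₂) := by
    simp only [mbKernel, integrand, add_mul, Complex.exp_add, mul_zero, Complex.exp_zero]
    ring
  have h6 : ‖Complex.exp ((s + a) * ℓ₂)‖ ≤ Real.exp (h * M) * Real.exp ((c + a) * ℓ₂.re) := by
    rw [Complex.norm_exp, ← Real.exp_add, Real.exp_le_exp]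
    simp only [Complex.mul_re, Complex.add_re, Complex.ofReal_re, Complex.add_im,
      Complex.ofReal_im, add_zero]
    have h7 : -(s.im * ℓ₂.im) ≤ h * M := by
      refine (neg_le_abs _).trans ?_
      rw [abs_mul]
      exact mul_le_mul hs.2.1 h3 (abs_nonneg _) hh.le
    have h8 : (s.re + a) * ℓ₂.re ≤ (c + a) * ℓ₂.re :=
      mul_le_mul_of_nonpos_right (by linarith [hs.1]) h2
    linarith
  rw [h5, norm_mul]
  calc _ ≤ C * Real.exp (-s.re) * (Real.exp (h * M) * Real.exp ((c + a) * ℓ₂.re)) :=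
        mul_le_mul h4 h6 (norm_nonneg _) ((norm_nonneg _).trans h4)
    _ = _ := by ring

/-- The leading term of `f_j^L` at `t₂ = 0`, with a remainder estimate. -/
theorem exists_mellinBarnes_asymptotic (H : Interlacing N α β) {j : ℕ} (hj : 1 ≤ j) (hjN : j ≤ N)
    (hne : α 1 ≠ α 2 ∨ 2 ≤ j) (hc : c ∈ Set.Ioo (-α j - 1) (-α j)) (hh : 0 < h) (L : Kind)
    (M ρ : ℝ) :
    ∃ C, ∀ ℓ₁ ℓ₂ : ℂ, ‖ℓ₁‖ ≤ ρ → ℓ₂.re ≤ 0 → |ℓ₂.im| ≤ M →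
      ‖mellinBarnes N α β c h j L ℓ₁ ℓ₂ / Complex.exp (-(α j : ℂ) * ℓ₂) -
        (leadingCoeff N α β j : ℂ) * bessel L (α j) ℓ₁‖ ≤ C * Real.exp (1 / 2 * ℓ₂.re) := by
  have hcn := H.loop_ne_int hj hjN hc
  -- The new loop starts half-way between the pole at -α_j and the next integer; this gives the
  -- factor |t₂|^{1/2} in the remainder.
  have hcn' : ∀ n : ℤ, -α j + 1 / 2 ≠ n := fun n hn => by
    obtain ⟨a, ha⟩ := H.int_alpha j hj hjN
    rw [ha] at hn
    have h1 : (2 * (-a - n) : ℝ) = -1 := by linarith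
    have h2 : (2 * (-a - n) : ℤ) = -1 := by exact_mod_cast h1
    omega
  obtain ⟨C, hC⟩ := exists_remainder_bound H hj hjN hcn' hh L (α j) M ρ
  obtain ⟨r, hr, hgr, hrα⟩ := exists_extension_mul_inv H hj hjN hne
  refine ⟨‖(1 / (2 * Real.pi * Complex.I) : ℂ)‖ * C, fun ℓ₁ ℓ₂ h1 h2 h3 => ?_⟩
  have h4 := loopIntegral_sub_loopIntegral
    (loopIntegrable_integrand H hj hjN hcn hh L ℓ₁ ℓ₂)
    (loopIntegrable_integrand H hj hjN hcn' hh L ℓ₁ ℓ₂)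
  have hB : Differentiable ℂ fun s : ℂ => Complex.exp (s * ℓ₂) * bessel L (-s) ℓ₁ := by
    have := (differentiable_bessel_left L ℓ₁).comp differentiable_neg
    exact Differentiable.mul (by fun_prop) this
  have h5 : rectIntegral c (-α j + 1 / 2) h (integrand N α β j L ℓ₁ ℓ₂) =
      2 * Real.pi * Complex.I * (r (-α j : ℝ) *
        (Complex.exp ((-α j : ℝ) * ℓ₂) * bessel L (-((-α j : ℝ) : ℂ)) ℓ₁)) := by
    rw [← rectIntegral_residue (r := fun s => r s * (Complex.exp (s * ℓ₂) * bessel L (-s) ℓ₁))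
      hc.2 (by linarith) hh hc.1 (by linarith : -α j + 1 / 2 < -α j + 1)
      (hr.mul hB.differentiableOn)]
    refine rectIntegral_congr (by linarith [hc.2]) hh fun s _ hs => ?_
    rw [integrand, hgr s (sin_ne_zero_of_edge hcn hcn' hs)]
    ring
  have hpi : (2 * Real.pi * Complex.I : ℂ) ≠ 0 := Complex.two_pi_I_ne_zero
  have e0 := Complex.exp_ne_zero (-(α j : ℂ) * ℓ₂)
  have e1 : Complex.exp (α j * ℓ₂) = (Complex.exp (-(α j : ℂ) * ℓ₂))⁻¹ := by
    rw [← Complex.exp_neg]; congr 1; ring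
  have h6 : mellinBarnes N α β c h j L ℓ₁ ℓ₂ / Complex.exp (-(α j : ℂ) * ℓ₂) -
        (leadingCoeff N α β j : ℂ) * bessel L (α j) ℓ₁ = 1 / (2 * Real.pi * Complex.I) *
      (loopIntegral (-α j + 1 / 2) h (integrand N α β j L ℓ₁ ℓ₂) *
        Complex.exp (α j * ℓ₂)) := by
    -- The loop runs clockwise and the residue of the quotient is minus the leading coefficient, so
    -- the two signs cancel.
    rw [h5, hrα] at h4
    push_cast at h4
    rw [neg_neg] at h4
    rw [mellinBarnes, sub_eq_iff_eq_add.1 h4, e1]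
    field_simp
    ring
  rw [h6, norm_mul, mul_assoc ‖_‖ C]
  have h7 := hC ℓ₁ ℓ₂ h1 h2 h3
  rw [show -α j + 1 / 2 + α j = 1 / 2 by ring] at h7
  exact mul_le_mul_of_nonneg_left h7 (norm_nonneg _)

theorem tendsto_mellinBarnes_leading (H : Interlacing N α β) {j : ℕ} (hj : 1 ≤ j) (hjN : j ≤ N)
    (hne : α 1 ≠ α 2 ∨ 2 ≤ j) (hc : c ∈ Set.Ioo (-α j - 1) (-α j)) (hh : 0 < h) (L : Kind)
    (M : ℝ) :
    TendstoLocallyUniformly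
      (fun ℓ₂ ℓ₁ : ℂ => mellinBarnes N α β c h j L ℓ₁ ℓ₂ / Complex.exp (-(α j : ℂ) * ℓ₂))
      (fun ℓ₁ : ℂ => (leadingCoeff N α β j : ℂ) * bessel L (α j) ℓ₁)
      (Filter.comap Complex.re Filter.atBot ⊓ Filter.principal {ℓ₂ : ℂ | |ℓ₂.im| ≤ M}) := by
  rw [Metric.tendstoLocallyUniformly_iff]
  intro ε hε x
  obtain ⟨C, hC⟩ := exists_mellinBarnes_asymptotic H hj hjN hne hc hh L M (‖x‖ + 1)
  have hlim : Filter.Tendsto (fun y : ℝ => C * Real.exp (1 / 2 * y)) Filter.atBot (𝓝 0) := by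
    have h1 : Filter.Tendsto (fun y : ℝ => 1 / 2 * y) Filter.atBot Filter.atBot :=
      Filter.tendsto_id.const_mul_atBot (by norm_num)
    simpa using (Real.tendsto_exp_atBot.comp h1).const_mul C
  have h2 : ∀ᶠ ℓ₂ : ℂ in Filter.comap Complex.re Filter.atBot,
      C * Real.exp (1 / 2 * ℓ₂.re) < ε ∧ ℓ₂.re ≤ 0 :=
    Filter.tendsto_comap.eventually
      ((hlim.eventually (gt_mem_nhds hε)).and (Filter.eventually_le_atBot 0))
  refine ⟨Metric.ball x 1, Metric.ball_mem_nhds x one_pos, ?_⟩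
  filter_upwards [Filter.mem_inf_of_left h2, Filter.mem_inf_of_right (Filter.mem_principal_self _)]
    with ℓ₂ h3 h4 ℓ₁ h5
  rw [dist_comm, dist_eq_norm]
  refine (hC ℓ₁ ℓ₂ ?_ h3.2 h4).trans_lt h3.1
  have h6 := norm_sub_norm_le ℓ₁ x
  rw [Metric.mem_ball, dist_eq_norm] at h5
  linarith

end Asymptotics

end SpinWhittaker

namespace SpinWhittaker

open MeasureTheory

/-! ### Branches of logarithms and Euler operators -/

/-- Two continuous logarithms of the same function which agree at a point agree near it. -/
theorem eventuallyEq_of_exp_eq {X : Type*} [TopologicalSpace X] {L L' : X → ℂ} {x : X}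
    (hL : ContinuousAt L x) (hL' : ContinuousAt L' x) (hx : L x = L' x)
    (he : ∀ᶠ y in 𝓝 x, Complex.exp (L y) = Complex.exp (L' y)) : L =ᶠ[𝓝 x] L' := by
  have h1 : ContinuousAt (fun y => (L y - L' y).im) x :=
    Complex.continuous_im.continuousAt.comp (hL.sub hL')
  have h2 : ∀ᶠ y in 𝓝 x, (L y - L' y).im ∈ Set.Ioo (-Real.pi) Real.pi :=
    h1.eventually_mem (Ioo_mem_nhds (by simp [hx, Real.pi_pos]) (by simp [hx, Real.pi_pos]))
  filter_upwards [h2, he] with y hy hey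
  have h3 := Complex.log_exp hy.1 hy.2.le
  rw [Complex.exp_sub, hey, div_self (Complex.exp_ne_zero _), Complex.log_one] at h3
  exact sub_eq_zero.1 h3.symm

/-- The function log(g/g(t)) + L(t) is an analytic logarithm of g with the same value at t, and
continuity forces L to agree with it near t. -/
theorem analyticAt_of_exp_eq {L g : ℂ × ℂ → ℂ} {t : ℂ × ℂ} (hL : ContinuousAt L t)
    (hg : AnalyticAt ℂ g t) (he : ∀ᶠ y in 𝓝 t, Complex.exp (L y) = g y) : AnalyticAt ℂ L t := by
  have h0 : g t ≠ 0 := he.self_of_nhds ▸ Complex.exp_ne_zero _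
  have h1 : AnalyticAt ℂ (fun y => Complex.log (g y / g t) + L t) t :=
    ((hg.div analyticAt_const h0).clog (by simp [h0])).add analyticAt_const
  refine h1.congr (eventuallyEq_of_exp_eq h1.continuousAt hL (by simp [h0]) ?_)
  have h2 : ∀ᶠ y in 𝓝 t, g y ≠ 0 := hg.continuousAt.eventually_ne h0
  filter_upwards [he, h2] with y hy hy0
  rw [Complex.exp_add, Complex.exp_log (div_ne_zero hy0 h0), he.self_of_nhds, hy,
    div_mul_cancel₀ _ h0]

theorem hasFDerivAt_of_exp_eq {L g : ℂ × ℂ → ℂ} {t : ℂ × ℂ} {g' : ℂ × ℂ →L[ℂ] ℂ}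
    (hL : AnalyticAt ℂ L t) (hg : HasFDerivAt g g' t)
    (he : ∀ᶠ y in 𝓝 t, Complex.exp (L y) = g y) : HasFDerivAt L ((g t)⁻¹ • g') t := by
  have h0 : g t ≠ 0 := he.self_of_nhds ▸ Complex.exp_ne_zero _
  have h1 := hL.differentiableAt.hasFDerivAt
  have h2 := (h1.cexp.congr_of_eventuallyEq (he.mono fun y hy => hy.symm)).unique hg
  rw [he.self_of_nhds] at h2
  rwa [← h2, smul_smul, inv_mul_cancel₀ h0, one_smul]

/-- `L₁` and `L₂` are branches of `log t₁` and `log (σ t₂)` on the open set `V`. -/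
structure LogChart (V : Set (ℂ × ℂ)) (L₁ L₂ : ℂ × ℂ → ℂ) (σ : ℂ) : Prop where
  isOpen : IsOpen V
  cont₁ : ContinuousOn L₁ V
  cont₂ : ContinuousOn L₂ V
  exp₁ : ∀ t ∈ V, Complex.exp (L₁ t) = t.1
  exp₂ : ∀ t ∈ V, Complex.exp (L₂ t) = σ * t.2

theorem euler₁_congr {V : Set (ℂ × ℂ)} (hV : IsOpen V) {F G : ℂ × ℂ → ℂ} (h : ∀ t ∈ V, F t = G t) :
    ∀ t ∈ V, euler₁ F t = euler₁ G t := fun t ht => by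
  have h1 : F =ᶠ[𝓝 t] G := Filter.mem_of_superset (hV.mem_nhds ht) h
  rw [euler₁, euler₁, h1.fderiv_eq]

theorem euler₂_congr {V : Set (ℂ × ℂ)} (hV : IsOpen V) {F G : ℂ × ℂ → ℂ} (h : ∀ t ∈ V, F t = G t) :
    ∀ t ∈ V, euler₂ F t = euler₂ G t := fun t ht => by
  have h1 : F =ᶠ[𝓝 t] G := Filter.mem_of_superset (hV.mem_nhds ht) h
  rw [euler₂, euler₂, h1.fderiv_eq]

namespace LogChart

variable {V : Set (ℂ × ℂ)} {L₁ L₂ : ℂ × ℂ → ℂ} {σ : ℂ} {Φ Φ' : ℂ × ℂ → ℂ} {t : ℂ × ℂ}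

theorem analyticAt_fst (C : LogChart V L₁ L₂ σ) (ht : t ∈ V) : AnalyticAt ℂ L₁ t :=
  analyticAt_of_exp_eq (C.cont₁.continuousAt (C.isOpen.mem_nhds ht)) _root_.analyticAt_fst
    (Filter.mem_of_superset (C.isOpen.mem_nhds ht) C.exp₁)

theorem analyticAt_snd (C : LogChart V L₁ L₂ σ) (ht : t ∈ V) : AnalyticAt ℂ L₂ t :=
  analyticAt_of_exp_eq (C.cont₂.continuousAt (C.isOpen.mem_nhds ht))
    (analyticAt_const.mul _root_.analyticAt_snd)
    (Filter.mem_of_superset (C.isOpen.mem_nhds ht) C.exp₂)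

theorem fst_ne_zero (C : LogChart V L₁ L₂ σ) (ht : t ∈ V) : t.1 ≠ 0 :=
  C.exp₁ t ht ▸ Complex.exp_ne_zero _

theorem snd_ne_zero (C : LogChart V L₁ L₂ σ) (ht : t ∈ V) : σ * t.2 ≠ 0 :=
  C.exp₂ t ht ▸ Complex.exp_ne_zero _

theorem analyticOnNhd_comp (C : LogChart V L₁ L₂ σ) (hΦ : AnalyticOnNhd ℂ Φ Set.univ) :
    AnalyticOnNhd ℂ (fun t => Φ (L₁ t, L₂ t)) V := fun t ht =>
  AnalyticAt.comp (f := fun t => (L₁ t, L₂ t)) (hΦ (L₁ t, L₂ t) trivial)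
    ((C.analyticAt_fst ht).prod (C.analyticAt_snd ht))

/-- The constant σ drops out of the logarithmic derivative of σt₂. In the coordinates ℓ₁, ℓ₂ the
Euler operators therefore become the partial derivatives, whichever sign the base has. -/
theorem fderiv_comp (C : LogChart V L₁ L₂ σ) (hΦ : AnalyticOnNhd ℂ Φ Set.univ) (ht : t ∈ V)
    (v : ℂ × ℂ) :
    fderiv ℂ (fun t => Φ (L₁ t, L₂ t)) t v =
      fderiv ℂ Φ (L₁ t, L₂ t) (t.1⁻¹ * v.1, t.2⁻¹ * v.2) := by
  have h1 := hasFDerivAt_of_exp_eq (C.analyticAt_fst ht) hasFDerivAt_fst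
    (Filter.mem_of_superset (C.isOpen.mem_nhds ht) C.exp₁)
  have h2 := hasFDerivAt_of_exp_eq (C.analyticAt_snd ht) (hasFDerivAt_snd.const_mul σ)
    (Filter.mem_of_superset (C.isOpen.mem_nhds ht) C.exp₂)
  have h3 := ((hΦ (L₁ t, L₂ t) trivial).differentiableAt.hasFDerivAt).comp t (h1.prodMk h2)
  have h4 := C.snd_ne_zero ht
  rw [show (fun t => Φ (L₁ t, L₂ t)) = Φ ∘ fun t => (L₁ t, L₂ t) from rfl, h3.fderiv]
  simp only [ContinuousLinearMap.comp_apply, ContinuousLinearMap.prod_apply,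
    _root_.smul_apply, ContinuousLinearMap.coe_fst', ContinuousLinearMap.coe_snd',
    smul_eq_mul]
  congr 2
  have := left_ne_zero_of_mul h4
  field_simp

theorem euler₁_comp (C : LogChart V L₁ L₂ σ) (hΦ : AnalyticOnNhd ℂ Φ Set.univ)
    (hd : ∀ z v, HasDerivAt (fun z => Φ (z, v)) (Φ' (z, v)) z) {F : ℂ × ℂ → ℂ}
    (hF : ∀ t ∈ V, F t = Φ (L₁ t, L₂ t)) : ∀ t ∈ V, euler₁ F t = Φ' (L₁ t, L₂ t) := fun t ht => by
  rw [euler₁_congr C.isOpen hF t ht, euler₁, C.fderiv_comp hΦ ht]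
  have h1 := ((hΦ (L₁ t, L₂ t) trivial).differentiableAt.hasFDerivAt).comp_hasDerivAt (L₁ t)
    ((hasDerivAt_id (L₁ t)).prodMk (hasDerivAt_const (L₁ t) (L₂ t)))
  rw [← h1.unique (hd (L₁ t) (L₂ t)), ← smul_eq_mul, ← map_smul]
  simp [C.fst_ne_zero ht]

theorem euler₂_comp (C : LogChart V L₁ L₂ σ) (hΦ : AnalyticOnNhd ℂ Φ Set.univ)
    (hd : ∀ z v, HasDerivAt (fun v => Φ (z, v)) (Φ' (z, v)) v) {F : ℂ × ℂ → ℂ}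
    (hF : ∀ t ∈ V, F t = Φ (L₁ t, L₂ t)) : ∀ t ∈ V, euler₂ F t = Φ' (L₁ t, L₂ t) := fun t ht => by
  rw [euler₂_congr C.isOpen hF t ht, euler₂, C.fderiv_comp hΦ ht]
  have h1 := ((hΦ (L₁ t, L₂ t) trivial).differentiableAt.hasFDerivAt).comp_hasDerivAt (L₂ t)
    ((hasDerivAt_const (L₂ t) (L₁ t)).prodMk (hasDerivAt_id (L₂ t)))
  rw [← h1.unique (hd (L₁ t) (L₂ t)), ← smul_eq_mul, ← map_smul]
  simp [right_ne_zero_of_mul (C.snd_ne_zero ht)]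

end LogChart

/-! ### The system for the Mellin-Barnes integrals -/

section System

variable {N : ℕ} {α β : ℕ → ℝ} {c h δ : ℝ} {w : ℂ → ℂ} {b : ℂ → ℂ → ℂ}

theorem prod_map_range' {R : Type*} [CommMonoid R] (a N : ℕ) (f : ℕ → R) :
    ((List.range' a (N + 1 - a)).map f).prod = ∏ p ∈ Finset.Icc a N, f p := by
  change _ = (Multiset.map f ((List.range' a (N + 1 - a) : List ℕ) : Multiset ℕ)).prod
  simp

theorem loopIntegrable_of_admissible (hδ : 0 < δ) (hl : LoopIn c h (contourRegion c h δ))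
    (hw : AdmissibleWeight (contourRegion c h δ) w)
    (hb : AdmissibleProfile (contourRegion c h δ) b) (p : ℂ × ℂ) :
    LoopIntegrable c h fun s => mbKernel w b s p :=
  (rapidKernel_mbKernel hδ hw hb).loopIntegrable hl p

theorem mbInt_add_const_mul (hδ : 0 < δ) (hl : LoopIn c h (contourRegion c h δ))
    (hw : AdmissibleWeight (contourRegion c h δ) w)
    (hb : AdmissibleProfile (contourRegion c h δ) b) (a : ℂ) (p : ℂ × ℂ) :
    mbInt (fun s => (s + a) * w s) b c h p =
      mbInt (fun s => s * w s) b c h p + a * mbInt w b c h p := by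
  simp only [mbInt]
  rw [← loopIntegral_const_mul, ← loopIntegral_add
    (loopIntegrable_of_admissible hδ hl hw.mul_id hb p)]
  · congr 1
    funext s
    simp only [mbKernel]
    ring
  · exact (((rapidKernel_mbKernel hδ hw hb).mul_moderate (moderateKernel_const a)).congr
      fun s _ p => mul_comm _ _).loopIntegrable hl p

variable {V : Set (ℂ × ℂ)} {L₁ L₂ : ℂ × ℂ → ℂ} {σ : ℂ}

/-- Differentiation under the integral: ∂_{t₂} + a multiplies e^{sℓ₂} by s + a, so each factor goes
into the weight. -/
theorem LogChart.eulerProd_mbInt (C : LogChart V L₁ L₂ σ) (hδ : 0 < δ)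
    (hl : LoopIn c h (contourRegion c h δ)) (hw : AdmissibleWeight (contourRegion c h δ) w)
    (L : Kind) (as : List ℝ) : ∀ t ∈ V,
    eulerProd as (fun t => mbInt w (fun s ℓ => bessel L (-s) ℓ) c h (L₁ t, L₂ t)) t =
      mbInt (fun s => (as.map fun a : ℝ => s + (a : ℂ)).prod * w s)
        (fun s ℓ => bessel L (-s) ℓ) c h (L₁ t, L₂ t) := by
  have hb := admissibleProfile_bessel (c := c) (h := h) hδ L
  have hd : ∀ s ∈ contourRegion c h δ, ∀ ℓ,
      HasDerivAt (fun ℓ => bessel L (-s) ℓ) (besselDeriv L s ℓ) ℓ := fun s hs =>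
    hasDerivAt_bessel L (sin_ne_zero_of_mem hδ hs)
  induction as with
  | nil => simp [eulerProd]
  | cons a as ih =>
    intro t ht
    change euler₂ (eulerProd as _) t + (a : ℂ) * eulerProd as _ t = _
    rw [C.euler₂_comp (analyticOnNhd_mbInt hδ hl (hw.mul_list as) hb
        (admissibleProfile_besselDeriv hδ L) hd)
      (hasDerivAt_mbInt_snd hδ hl (hw.mul_list as) hb) ih t ht, ih t ht,
      ← mbInt_add_const_mul hδ hl (hw.mul_list as) hb]
    simp only [List.map_cons, List.prod_cons, mul_assoc]

/-- Under the integral ∂_{t₁}² gives s² + t₁² by the Bessel equation and ∂_{t₂}² gives s². The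
weight plays no role. -/
theorem LogChart.firstOp_mbInt (C : LogChart V L₁ L₂ σ) (hδ : 0 < δ)
    (hl : LoopIn c h (contourRegion c h δ)) (hw : AdmissibleWeight (contourRegion c h δ) w)
    (L : Kind) : ∀ t ∈ V,
    firstOp (fun t => mbInt w (fun s ℓ => bessel L (-s) ℓ) c h (L₁ t, L₂ t)) t = 0 := by
  intro t ht
  have hb := admissibleProfile_bessel (c := c) (h := h) hδ L
  have hb' := admissibleProfile_besselDeriv (c := c) (h := h) hδ L
  have hb'' := admissibleProfile_besselDeriv₂ (c := c) (h := h) hδ L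
  have hd : ∀ s ∈ contourRegion c h δ, ∀ ℓ,
      HasDerivAt (fun ℓ => bessel L (-s) ℓ) (besselDeriv L s ℓ) ℓ := fun s hs =>
    hasDerivAt_bessel L (sin_ne_zero_of_mem hδ hs)
  have hd' : ∀ s ∈ contourRegion c h δ, ∀ ℓ,
      HasDerivAt (besselDeriv L s) (besselDeriv₂ L s ℓ) ℓ := fun s hs =>
    hasDerivAt_besselDeriv L (sin_ne_zero_of_mem hδ hs)
  have e1 := C.euler₁_comp (analyticOnNhd_mbInt hδ hl hw hb' hb'' hd')
    (hasDerivAt_mbInt_fst hδ hl hw hb' hb'' hd')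
    (C.euler₁_comp (analyticOnNhd_mbInt hδ hl hw hb hb' hd)
      (hasDerivAt_mbInt_fst hδ hl hw hb hb' hd) fun _ _ => rfl) t ht
  have e2 := C.euler₂_comp (analyticOnNhd_mbInt hδ hl hw.mul_id hb hb' hd)
    (hasDerivAt_mbInt_snd hδ hl hw.mul_id hb)
    (C.euler₂_comp (analyticOnNhd_mbInt hδ hl hw hb hb' hd)
      (hasDerivAt_mbInt_snd hδ hl hw hb) fun _ _ => rfl) t ht
  rw [firstOp, e1, e2, ← C.exp₁ t ht, mbInt, mbInt, mbInt, ← loopIntegral_const_mul,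
    sub_sub, ← loopIntegral_add (loopIntegrable_of_admissible hδ hl hw.mul_id.mul_id hb _),
    sub_eq_zero]
  · congr 1
    funext s
    simp only [mbKernel, besselDeriv₂]
    ring
  · exact (((rapidKernel_mbKernel hδ hw hb).mul_moderate
      (moderateKernel_const (Complex.exp (L₁ t) ^ 2))).congr
      fun s _ p => mul_comm _ _).loopIntegrable hl _

/-- The effect of the difference equation for the Gamma quotients on the integrals. -/
theorem exp_mul_loopIntegral_shift (H : Interlacing N α β) {j : ℕ} (hj : 1 ≤ j) (hjN : j ≤ N)
    (hc : c ∈ Set.Ioo (-α j - 1) (-α j)) (hh : 0 < h) (L : Kind) (ℓ₁ ℓ₂ : ℂ) :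
    Complex.exp ℓ₂ * loopIntegral c h (fun s =>
        (∏ p ∈ Finset.Icc 3 N, (s + β p)) * gammaQuotient N α β j s *
          (Complex.exp (s * ℓ₂) * bessel L (-(s + 1)) ℓ₁)) =
      recSign j * loopIntegral c h fun s =>
        (∏ p ∈ Finset.Icc 1 N, (s + α p)) * gammaQuotient N α β j s *
          (Complex.exp (s * ℓ₂) * bessel L (-s) ℓ₁) := by
  have hcn := H.loop_ne_int hj hjN hc
  have hcn' : ∀ n : ℤ, c + 1 ≠ n := fun n hn => hcn (n - 1) (by push_cast; linarith)
  obtain ⟨δ, hδ, hl⟩ := exists_loopIn hcn' hh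
  obtain ⟨r, hr, hgr⟩ := exists_extension_mul_prod H hj hjN
  set G : ℂ → ℂ := fun s => (∏ p ∈ Finset.Icc 1 N, (s + α p)) * gammaQuotient N α β j s *
          (Complex.exp (s * ℓ₂) * bessel L (-s) ℓ₁) with hG
  have hGi : ∀ c' : ℝ, (∀ n : ℤ, c' ≠ n) → LoopIntegrable c' h G := fun c' hc' => by
    have := loopIntegrable_mbKernel H hj hjN hc' hh L (ℓ₁, ℓ₂) ((List.range' 1 N).map α)
    simp only [List.map_map] at this
    convert! this using 1
  -- The only integer between c and c + 1 is -α_j, and the factor ∏ (s + α_p) removes the pole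
  -- there, so the loop moves without a residue.
  have h1 : loopIntegral c h G = loopIntegral (c + 1) h G := by
    have h2 := loopIntegral_sub_loopIntegral (hGi c hcn) (hGi (c + 1) hcn')
    have h3 : rectIntegral c (c + 1) h G =
        rectIntegral c (c + 1) h fun s => r s * (Complex.exp (s * ℓ₂) * bessel L (-s) ℓ₁) :=
      rectIntegral_congr (by linarith) hh fun s _ hs => by
        rw [hG, ← hgr s (sin_ne_zero_of_edge hcn hcn' hs)]
        ring
    have hB : Differentiable ℂ fun s : ℂ => Complex.exp (s * ℓ₂) * bessel L (-s) ℓ₁ := by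
      have := (differentiable_bessel_left L ℓ₁).comp differentiable_neg
      exact Differentiable.mul (by fun_prop) this
    have h4 : rectIntegral c (c + 1) h
        (fun s => r s * (Complex.exp (s * ℓ₂) * bessel L (-s) ℓ₁)) = 0 :=
      rectIntegral_eq_zero (by linarith) hh ((hr.mul hB.differentiableOn).mono
        fun s hs => ⟨hc.1.trans_le hs.1.1, hs.1.2.trans_lt (by linarith [hc.2])⟩)
    rw [h3, h4, neg_zero] at h2
    exact sub_eq_zero.1 h2
  have h4 : recSign j * recSign j = 1 := by unfold recSign; split_ifs <;> norm_num
  rw [h1, ← loopIntegral_const_mul, ← loopIntegral_const_mul]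
  -- On the loop at c + 1 the recurrence expresses the weight at s by the weight at s - 1. The
  -- substitution s ↦ s + 1 then leads back to the loop at c.
  rw [loopIntegral_congr hl (G := fun s => (∏ p ∈ Finset.Icc 3 N, (s - 1 + β p)) *
      gammaQuotient N α β j (s - 1) * (Complex.exp (s * ℓ₂) * bessel L (-s) ℓ₁)),
    ← loopIntegral_add_one]
  · congr 1
    funext s
    simp only [add_sub_cancel_right, add_mul, Complex.exp_add, one_mul]
    ring
  · intro s hs
    have h5 := gammaQuotient_recurrence H hj hjN (sin_ne_zero_of_mem hδ hs)
    simp only [hG]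
    linear_combination (recSign j * (Complex.exp (s * ℓ₂) * bessel L (-s) ℓ₁)) * h5 +
      (gammaQuotient N α β j (s - 1) * (∏ p ∈ Finset.Icc 3 N, (s - 1 + (β p : ℂ))) *
        (Complex.exp (s * ℓ₂) * bessel L (-s) ℓ₁)) * h4

/-- In ∂_{t₁} - ∂_{t₂} the terms with s cancel, leaving ±t₁ B_{-(s+1)}, whose t₁ cancels against
t₂/t₁. The shifted integral carries e^{ℓ₂} = σt₂, and the condition on σ is the one that makes the
two terms of the equation opposite; hence the alternation between t₂ and -t₂. -/
theorem LogChart.secondOp_mbInt (C : LogChart V L₁ L₂ σ) (H : Interlacing N α β) {j : ℕ}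
    (hj : 1 ≤ j) (hjN : j ≤ N) (hc : c ∈ Set.Ioo (-α j - 1) (-α j)) (hh : 0 < h) (L : Kind)
    (hσ : σ = -(L.sign * recSign j)) : ∀ t ∈ V, secondOp N α β
      (fun t => mbInt (gammaQuotient N α β j) (fun s ℓ => bessel L (-s) ℓ) c h (L₁ t, L₂ t)) t =
        0 := by
  intro t ht
  obtain ⟨δ, hδ, hl⟩ := exists_loopIn (H.loop_ne_int hj hjN hc) hh
  have hw := admissible_gammaQuotient H (c := c) (h := h) hδ hj hjN
  have hb := admissibleProfile_bessel (c := c) (h := h) hδ L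
  have hb' := admissibleProfile_besselDeriv (c := c) (h := h) hδ L
  have hd : ∀ s ∈ contourRegion c h δ, ∀ ℓ,
      HasDerivAt (fun ℓ => bessel L (-s) ℓ) (besselDeriv L s ℓ) ℓ := fun s hs =>
    hasDerivAt_bessel L (sin_ne_zero_of_mem hδ hs)
  set bs := (List.range' 3 (N - 2)).map β with hbs
  have hw' := hw.mul_list bs
  have e3 : ∀ s : ℂ, (bs.map fun a : ℝ => s + (a : ℂ)).prod = ∏ p ∈ Finset.Icc 3 N, (s + β p) :=
    fun s => by rw [← prod_map_range', hbs, List.map_map]; rfl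
  have e4 : ∀ s : ℂ, (((List.range' 1 N).map α).map fun a : ℝ => s + (a : ℂ)).prod =
      ∏ p ∈ Finset.Icc 1 N, (s + α p) :=
    fun s => by rw [← prod_map_range', List.map_map]; rfl
  have e5 := C.eulerProd_mbInt hδ hl hw L bs
  rw [secondOp, C.eulerProd_mbInt hδ hl hw L _ t ht,
    C.euler₁_comp (analyticOnNhd_mbInt hδ hl hw' hb hb' hd)
      (hasDerivAt_mbInt_fst hδ hl hw' hb hb' hd) e5 t ht,
    C.euler₂_comp (analyticOnNhd_mbInt hδ hl hw' hb hb' hd)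
      (hasDerivAt_mbInt_snd hδ hl hw' hb) e5 t ht]
  have h1 := exp_mul_loopIntegral_shift H hj hjN hc hh L (L₁ t) (L₂ t)
  have h2 : mbInt (fun s => (bs.map fun a : ℝ => s + (a : ℂ)).prod * gammaQuotient N α β j s)
        (besselDeriv L) c h (L₁ t, L₂ t) =
      mbInt (fun s => s * ((bs.map fun a : ℝ => s + (a : ℂ)).prod * gammaQuotient N α β j s))
        (fun s ℓ => bessel L (-s) ℓ) c h (L₁ t, L₂ t) +
      L.sign * t.1 * loopIntegral c h (fun s =>
        (∏ p ∈ Finset.Icc 3 N, (s + β p)) * gammaQuotient N α β j s *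
          (Complex.exp (s * L₂ t) * bessel L (-(s + 1)) (L₁ t))) := by
    rw [mbInt, mbInt, ← loopIntegral_const_mul,
      ← loopIntegral_add (loopIntegrable_of_admissible hδ hl hw'.mul_id hb _)]
    · congr 1
      funext s
      simp only [mbKernel, besselDeriv, e3, ← C.exp₁ t ht]
      ring
    · convert! ((rapidKernel_mbKernel hδ hw' (admissibleProfile_bessel_add_one hδ L)).mul_moderate
        (moderateKernel_const (L.sign * t.1))).loopIntegrable hl (L₁ t, L₂ t) using 1
      funext s
      simp only [mbKernel, e3]
      ring
  have h3 : σ * σ = 1 := by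
    have h4 : recSign j * recSign j = 1 := by unfold recSign; split_ifs <;> norm_num
    rw [hσ]
    linear_combination recSign j * recSign j * L.sign_sq + h4
  have h5 : mbInt (fun s => (((List.range' 1 N).map α).map fun a : ℝ => s + (a : ℂ)).prod *
      gammaQuotient N α β j s) (fun s ℓ => bessel L (-s) ℓ) c h (L₁ t, L₂ t) =
      loopIntegral c h fun s => (∏ p ∈ Finset.Icc 1 N, (s + α p)) * gammaQuotient N α β j s *
          (Complex.exp (s * L₂ t) * bessel L (-s) (L₁ t)) := by
    rw [mbInt]
    simp only [mbKernel, e4]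
  rw [h2, h5, add_sub_cancel_left, C.exp₂ t ht] at *
  set X := loopIntegral c h fun s => (∏ p ∈ Finset.Icc 3 N, (s + β p)) *
    gammaQuotient N α β j s * (Complex.exp (s * L₂ t) * bessel L (-(s + 1)) (L₁ t))
  set Y := loopIntegral c h fun s => (∏ p ∈ Finset.Icc 1 N, (s + α p)) *
    gammaQuotient N α β j s * (Complex.exp (s * L₂ t) * bessel L (-s) (L₁ t))
  have h6 := C.fst_ne_zero ht
  have h7 : t.2 / t.1 * (L.sign * t.1 * X) = t.2 * L.sign * X := by field_simp
  rw [h7]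
  have h8 : recSign j * L.sign = -σ := by rw [hσ]; ring
  linear_combination (σ * L.sign) * h1 - (t.2 * L.sign * X) * h3 + σ * Y * h8 - Y * h3

theorem LogChart.isSolutionOn_mellinBarnes (C : LogChart V L₁ L₂ σ) (H : Interlacing N α β) {j : ℕ}
    (hj : 1 ≤ j) (hjN : j ≤ N) (hc : c ∈ Set.Ioo (-α j - 1) (-α j)) (hh : 0 < h) (L : Kind)
    (hσ : σ = -(L.sign * recSign j)) :
    IsSolutionOn N α β V fun t => mellinBarnes N α β c h j L (L₁ t) (L₂ t) := by
  obtain ⟨δ, hδ, hl⟩ := exists_loopIn (H.loop_ne_int hj hjN hc) hh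
  have hw := admissible_gammaQuotient H (c := c) (h := h) hδ hj hjN
  have h1 : IsSolutionOn N α β V fun t =>
      mbInt (gammaQuotient N α β j) (fun s ℓ => bessel L (-s) ℓ) c h (L₁ t, L₂ t) :=
    { analytic := C.analyticOnNhd_comp (analyticOnNhd_mbInt hδ hl hw
        (admissibleProfile_bessel hδ L) (admissibleProfile_besselDeriv hδ L)
        fun s hs => hasDerivAt_bessel L (sin_ne_zero_of_mem hδ hs))
      first := C.firstOp_mbInt hδ hl hw L
      second := C.secondOp_mbInt H hj hjN hc hh L hσ }
  have h2 := (isSolutionOn_zero N α β V).comb C.isOpen (1 / (2 * Real.pi * Complex.I)) h1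
  simpa only [zero_add, mellinBarnes_eq] using h2

/-- The sign of the base of the power in `f_j^L`. -/
def baseSign (j : ℕ) (L : Kind) : ℂ := -(L.sign * recSign j)

/-- In each of the four cases the sign demanded by the second equation agrees with the logarithm
chosen in the definition of f_j^L. -/
theorem logChart_logBase {L₂ L₂' : ℂ × ℂ → ℂ} (hV : IsOpen V) (h1 : ContinuousOn L₁ V)
    (h2 : ContinuousOn L₂ V) (h2' : ContinuousOn L₂' V) (e1 : ∀ t ∈ V, Complex.exp (L₁ t) = t.1)
    (e2 : ∀ t ∈ V, Complex.exp (L₂ t) = t.2) (e2' : ∀ t ∈ V, Complex.exp (L₂' t) = -t.2)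
    (j : ℕ) (L : Kind) :
    LogChart V L₁ (fun t => logBase j L (L₂ t) (L₂' t)) (baseSign j L) := by
  rcases L with _ | _ <;> by_cases hj : j = 1
  all_goals simp only [logBase, baseSign, recSign, Kind.sign, hj, if_true, if_false]
  all_goals norm_num
  · exact ⟨hV, h1, h2, e1, by simpa using e2⟩
  · exact ⟨hV, h1, h2', e1, by simpa using e2'⟩
  · exact ⟨hV, h1, h2', e1, by simpa using e2'⟩
  · exact ⟨hV, h1, h2, e1, by simpa using e2⟩

end System

end SpinWhittaker

namespace SpinWhittaker

/-! ### The system as a holonomic system of rank at most `2 N` -/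

section Commutation

variable {V : Set (ℂ × ℂ)} {F G : ℂ × ℂ → ℂ}

theorem euler₁_mul {t : ℂ × ℂ} (hF : DifferentiableAt ℂ F t) (hG : DifferentiableAt ℂ G t) :
    euler₁ (fun t => F t * G t) t = F t * euler₁ G t + G t * euler₁ F t := by
  rw [euler₁, fderiv_fun_mul hF hG]
  simp [euler₁]
  ring

theorem euler₂_mul {t : ℂ × ℂ} (hF : DifferentiableAt ℂ F t) (hG : DifferentiableAt ℂ G t) :
    euler₂ (fun t => F t * G t) t = F t * euler₂ G t + G t * euler₂ F t := by
  rw [euler₂, fderiv_fun_mul hF hG]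
  simp [euler₂]
  ring

theorem euler₁_fst (t : ℂ × ℂ) : euler₁ Prod.fst t = t.1 := by simp [euler₁, fderiv_fst]

theorem euler₁_snd (t : ℂ × ℂ) : euler₁ Prod.snd t = 0 := by simp [euler₁, fderiv_snd]

theorem euler₂_fst (t : ℂ × ℂ) : euler₂ Prod.fst t = 0 := by simp [euler₂, fderiv_fst]

theorem euler₂_snd (t : ℂ × ℂ) : euler₂ Prod.snd t = t.2 := by simp [euler₂, fderiv_snd]

theorem euler₁_euler₂ (hF : AnalyticOnNhd ℂ F V) : ∀ t ∈ V,
    euler₁ (euler₂ F) t = euler₂ (euler₁ F) t := by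
  intro t ht
  have h1 : ∀ v : ℂ × ℂ, HasFDerivAt (fun t => fderiv ℂ F t v)
      ((ContinuousLinearMap.apply ℂ ℂ v).comp (fderiv ℂ (fderiv ℂ F) t)) t := fun v =>
    (ContinuousLinearMap.apply ℂ ℂ v).hasFDerivAt.comp t
      (hF t ht).fderiv.differentiableAt.hasFDerivAt
  have h2 : IsSymmSndFDerivAt ℂ F t := (hF t ht).contDiffAt.isSymmSndFDerivAt (n := 2) (by simp)
  have e1 : euler₁ (fun t => fderiv ℂ F t (0, 1)) t = t.1 * fderiv ℂ (fderiv ℂ F) t (1, 0) (0, 1) := by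
    rw [euler₁, (h1 _).fderiv]; rfl
  have e2 : euler₂ (fun t => fderiv ℂ F t (1, 0)) t = t.2 * fderiv ℂ (fderiv ℂ F) t (0, 1) (1, 0) := by
    rw [euler₂, (h1 _).fderiv]; rfl
  change euler₁ (fun t => t.2 * fderiv ℂ F t (0, 1)) t =
    euler₂ (fun t => t.1 * fderiv ℂ F t (1, 0)) t
  rw [euler₁_mul differentiableAt_snd (h1 _).differentiableAt,
    euler₂_mul differentiableAt_fst (h1 _).differentiableAt, e1, e2, h2.eq]
  have e3 := euler₁_snd t
  have e4 := euler₂_fst t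
  simp only [euler₁, euler₂] at e3 e4 ⊢
  change _ + fderiv ℂ F t (0, 1) * (t.1 * fderiv ℂ Prod.snd t (1, 0)) =
    _ + fderiv ℂ F t (1, 0) * (t.2 * fderiv ℂ Prod.fst t (0, 1))
  rw [e3, e4]
  ring

theorem euler₁_eulerProd (hV : IsOpen V) (as : List ℝ) (hF : AnalyticOnNhd ℂ F V) : ∀ t ∈ V,
    euler₁ (eulerProd as F) t = eulerProd as (euler₁ F) t := by
  induction as with
  | nil => exact fun _ _ => rfl
  | cons a as ih =>
    intro t ht
    have h1 := analytic_eulerProd as hF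
    change euler₁ (fun t => euler₂ (eulerProd as F) t + a * eulerProd as F t) t =
      euler₂ (eulerProd as (euler₁ F)) t + a * eulerProd as (euler₁ F) t
    rw [euler₁_comb hV a (analytic_euler₂ h1) h1 (fun _ _ => rfl) t ht, euler₁_euler₂ h1 t ht,
      euler₂_congr hV ih t ht, ih t ht]

theorem euler₂_eulerProd (hV : IsOpen V) (as : List ℝ) (hF : AnalyticOnNhd ℂ F V) : ∀ t ∈ V,
    euler₂ (eulerProd as F) t = eulerProd as (euler₂ F) t := by
  induction as with
  | nil => exact fun _ _ => rfl
  | cons a as ih =>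
    intro t ht
    have h1 := analytic_eulerProd as hF
    change euler₂ (fun t => euler₂ (eulerProd as F) t + a * eulerProd as F t) t =
      euler₂ (eulerProd as (euler₂ F)) t + a * eulerProd as (euler₂ F) t
    rw [euler₂_comb hV a (analytic_euler₂ h1) h1 (fun _ _ => rfl) t ht,
      euler₂_congr hV ih t ht, ih t ht]

theorem analytic_euler₂_iterate (hF : AnalyticOnNhd ℂ F V) (b : ℕ) :
    AnalyticOnNhd ℂ (euler₂^[b] F) V := by
  induction b with
  | zero => exact hF
  | succ b ih => rw [Function.iterate_succ_apply']; exact analytic_euler₂ ih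

theorem euler₂_iterate_comb (hV : IsOpen V) (c : ℂ) (hF : AnalyticOnNhd ℂ F V)
    (hG : AnalyticOnNhd ℂ G V) {H : ℂ × ℂ → ℂ} (hH : ∀ t ∈ V, H t = F t + c * G t) (b : ℕ) :
    ∀ t ∈ V, euler₂^[b] H t = euler₂^[b] F t + c * euler₂^[b] G t := by
  induction b with
  | zero => exact hH
  | succ b ih =>
    simp only [Function.iterate_succ_apply']
    exact euler₂_comb hV c (analytic_euler₂_iterate hF b) (analytic_euler₂_iterate hG b) ih

theorem euler₁_euler₂_iterate (hV : IsOpen V) (hF : AnalyticOnNhd ℂ F V) (b : ℕ) : ∀ t ∈ V,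
    euler₁ (euler₂^[b] F) t = euler₂^[b] (euler₁ F) t := by
  induction b with
  | zero => exact fun _ _ => rfl
  | succ b ih =>
    intro t ht
    simp only [Function.iterate_succ_apply']
    rw [euler₁_euler₂ (analytic_euler₂_iterate hF b) t ht, euler₂_congr hV ih t ht]

/-- The first equation eliminates ∂₁², at the price of two more derivatives ∂₂. Multiplication by
t₁² commutes with ∂₂. -/
theorem euler₂_iterate_euler₁_euler₁ (hV : IsOpen V) (hF : AnalyticOnNhd ℂ F V)
    (h : ∀ t ∈ V, firstOp F t = 0) (b : ℕ) : ∀ t ∈ V,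
    euler₂^[b] (euler₁ (euler₁ F)) t = euler₂^[b + 2] F t + t.1 ^ 2 * euler₂^[b] F t := by
  induction b with
  | zero =>
    intro t ht
    have h1 := h t ht
    rw [firstOp] at h1
    simp only [Function.iterate_succ_apply', Function.iterate_zero, id]
    linear_combination h1
  | succ b ih =>
    intro t ht
    have h1 := analytic_euler₂_iterate hF b
    rw [Function.iterate_succ_apply', euler₂_congr hV ih t ht]
    have h2 : AnalyticOnNhd ℂ (fun t : ℂ × ℂ => t.1 ^ 2) V := fun t _ => analyticAt_fst.pow 2
    have h3 : euler₂ (fun t : ℂ × ℂ => t.1 ^ 2) t = 0 := by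
      simp only [sq]
      rw [euler₂_mul differentiableAt_fst differentiableAt_fst]
      simp [euler₂_fst]
    rw [euler₂_comb hV 1 (analytic_euler₂_iterate hF (b + 2)) (h2.mul h1)
      (fun _ _ => by rw [one_mul]) t ht]
    change _ + 1 * euler₂ (fun t : ℂ × ℂ => t.1 ^ 2 * euler₂^[b] F t) t = _
    rw [euler₂_mul (h2 t ht).differentiableAt (h1 t ht).differentiableAt, h3,
      Function.iterate_succ_apply' _ (b + 2), Function.iterate_succ_apply' _ b]
    ring

end Commutation

/-! ### The derivatives of the jet are bounded by the jet. -/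

section Jets

open Asymptotics

variable {V : Set (ℂ × ℂ)} {F G : ℂ × ℂ → ℂ} {E : Type*} [NormedAddCommGroup E]
  {U : ℂ × ℂ → E} {t₀ : ℂ × ℂ}

/-- The product has leading term ∂₂^{length}, and the difference involves only lower powers.
Estimates replace an explicit connection matrix: uniqueness requires no more than a bound by U near
t₀. -/
theorem isBigO_eulerProd_sub (hV : IsOpen V) (ht : t₀ ∈ V) (as : List ℝ)
    (hG : AnalyticOnNhd ℂ G V) (h : ∀ b < as.length, euler₂^[b] G =O[𝓝 t₀] U) :
    (fun t => eulerProd as G t - euler₂^[as.length] G t) =O[𝓝 t₀] U := by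
  induction as generalizing G with
  | nil => simpa [eulerProd] using isBigO_zero U (𝓝 t₀)
  | cons a as ih =>
    have h1 := ih (analytic_euler₂ hG) fun b hb => by
      rw [← Function.iterate_succ_apply]
      exact h (b + 1) (by simpa using hb)
    have h2 := ih hG fun b hb => h b (hb.trans (by simp))
    have h3 := h2.add (h as.length (by simp))
    refine (h1.add (h3.const_mul_left (a : ℂ))).congr' ?_ Filter.EventuallyEq.rfl
    filter_upwards [hV.mem_nhds ht] with t ht
    change _ = euler₂ (eulerProd as G) t + a * eulerProd as G t - _
    rw [euler₂_eulerProd hV as hG t ht, List.length_cons, Function.iterate_succ_apply]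
    ring

theorem isBigO_eulerProd (hV : IsOpen V) (ht : t₀ ∈ V) (as : List ℝ) (hG : AnalyticOnNhd ℂ G V)
    (h : ∀ b ≤ as.length, euler₂^[b] G =O[𝓝 t₀] U) : eulerProd as G =O[𝓝 t₀] U := by
  simpa using (isBigO_eulerProd_sub hV ht as hG fun b hb => h b hb.le).add (h _ le_rfl)

theorem isBigO_iterate_of_eulerProd (hV : IsOpen V) (ht : t₀ ∈ V) (as : List ℝ)
    (hG : AnalyticOnNhd ℂ G V) (h : ∀ b < as.length, euler₂^[b] G =O[𝓝 t₀] U)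
    (h' : eulerProd as G =O[𝓝 t₀] U) : euler₂^[as.length] G =O[𝓝 t₀] U := by
  simpa using h'.sub (isBigO_eulerProd_sub hV ht as hG h)

theorem isBigO_of_fst_mul_add {P Q : ℂ × ℂ → ℂ} (h0 : t₀.1 ≠ 0) (hQ : Q =O[𝓝 t₀] U)
    (h : ∀ᶠ t in 𝓝 t₀, t.1 * P t + Q t = 0) : P =O[𝓝 t₀] U := by
  have h1 : ContinuousAt (fun t : ℂ × ℂ => -t.1⁻¹) t₀ := (continuousAt_fst.inv₀ h0).neg
  have h2 := (h1.isBigO_one ℝ).mul hQ.norm_right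
  simp only [one_mul, isBigO_norm_right] at h2
  refine h2.congr' ?_ Filter.EventuallyEq.rfl
  · filter_upwards [h, continuousAt_fst.eventually_ne h0] with t ht ht0
    field_simp
    linear_combination -ht

theorem isBigO_continuous_mul {g P : ℂ × ℂ → ℂ} (hg : Continuous g) (hP : P =O[𝓝 t₀] U) :
    (fun t => g t * P t) =O[𝓝 t₀] U := by
  simpa using ((hg.tendsto t₀).isBigO_one ℝ).mul hP.norm_right

/-- The jet of `F` with respect to which the system is an integrable connection. -/
noncomputable def jet (N : ℕ) (F : ℂ × ℂ → ℂ) (t : ℂ × ℂ) (i : Fin 2 × Fin N) : ℂ :=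
  euler₂^[i.2] (euler₁^[i.1] F) t

/-- Differentiation leads out of the jet only to ∂₂^N F, ∂₂^N ∂₁F and ∂₂^b ∂₁²F. The second equation
gives the first of these, its ∂₁-derivative the second, and the first equation the third. The last
requires ∂₂^{N+1} F, which comes from the ∂₂-derivative of the second equation. -/
theorem isBigO_euler_jet {N : ℕ} {α β : ℕ → ℝ} (hN : 2 ≤ N) (hV : IsOpen V)
    (hV0 : ∀ t ∈ V, t.1 ≠ 0) (ht : t₀ ∈ V) (hF : IsSolutionOn N α β V F) (i : Fin 2 × Fin N) :
    euler₁ (fun t => jet N F t i) =O[𝓝 t₀] jet N F ∧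
      euler₂ (fun t => jet N F t i) =O[𝓝 t₀] jet N F := by
  have hVn := hV.mem_nhds ht
  have hFa := hF.analytic
  have hF1 := analytic_euler₁ hFa
  have hF2 := analytic_euler₂ hFa
  have hA0 : ∀ b < N, euler₂^[b] F =O[𝓝 t₀] jet N F := fun b hb =>
    isBigO_pi.1 (isBigO_refl (jet N F) (𝓝 t₀)) (0, ⟨b, hb⟩)
  have hA1 : ∀ b < N, euler₂^[b] (euler₁ F) =O[𝓝 t₀] jet N F := fun b hb =>
    isBigO_pi.1 (isBigO_refl (jet N F) (𝓝 t₀)) (1, ⟨b, hb⟩)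
  set as := (List.range' 1 N).map α with has
  set bs := (List.range' 3 (N - 2)).map β with hbs
  have hal : as.length = N := by simp [has]
  have hbl : bs.length = N - 2 := by simp [hbs]
  set G : ℂ × ℂ → ℂ := fun t => euler₁ F t + (-1) * euler₂ F t with hG
  have hGa : AnalyticOnNhd ℂ G V := hF1.add (analyticOnNhd_const.mul hF2)
  have hGb : ∀ b, ∀ t ∈ V, euler₂^[b] G t = euler₂^[b] (euler₁ F) t + (-1) * euler₂^[b + 1] F t :=
    fun b => euler₂_iterate_comb hV (-1) hF1 hF2 (fun _ _ => rfl) b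
  have hPa := analytic_eulerProd as hFa
  have hQa := analytic_eulerProd bs hGa
  -- The second equation multiplied by t₁. The relations `e1` and `e2` are its images under ∂₁ and
  -- ∂₂, where ∂₁t₁ = t₁ and ∂₂t₂ = t₂ contribute lower-order terms.
  have e0 : ∀ t ∈ V, t.1 * eulerProd as F t + t.2 * eulerProd bs G t = 0 := fun t ht => by
    have h1 := hF.second t ht
    rw [secondOp, euler₁_eulerProd hV _ hFa t ht, euler₂_eulerProd hV _ hFa t ht] at h1
    have h2 := eulerProd_comb hV (-1) bs hF1 hF2 t ht
    have h3 := hV0 t ht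
    rw [h2]
    field_simp at h1
    linear_combination h1
  have e0' : ∀ t ∈ V, t.1 * eulerProd as F t = 0 + (-1) * (t.2 * eulerProd bs G t) := fun t ht => by
    linear_combination e0 t ht
  have hz : AnalyticOnNhd ℂ (fun _ : ℂ × ℂ => (0 : ℂ)) V := analyticOnNhd_const
  have hsQ : AnalyticOnNhd ℂ (fun t : ℂ × ℂ => t.2 * eulerProd bs G t) V :=
    analyticOnNhd_snd.mul hQa
  have e1 : ∀ t ∈ V, t.1 * eulerProd as (euler₁ F) t +
      (t.1 * eulerProd as F t + t.2 * eulerProd bs (euler₁ G) t) = 0 := fun t ht => by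
    have h1 := euler₁_comb hV (-1) hz hsQ e0' t ht
    have h2 := euler₁_mul differentiableAt_fst (hPa t ht).differentiableAt
    have h3 := euler₁_mul differentiableAt_snd (hQa t ht).differentiableAt
    rw [euler₁_fst, euler₁_eulerProd hV as hFa t ht] at h2
    rw [euler₁_snd, euler₁_eulerProd hV bs hGa t ht] at h3
    rw [h2, h3, euler₁_zero] at h1
    linear_combination h1
  have e2 : ∀ t ∈ V, t.1 * eulerProd as (euler₂ F) t +
      (t.2 * eulerProd bs G t + t.2 * eulerProd bs (euler₂ G) t) = 0 := fun t ht => by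
    have h1 := euler₂_comb hV (-1) hz hsQ e0' t ht
    have h2 := euler₂_mul differentiableAt_fst (hPa t ht).differentiableAt
    have h3 := euler₂_mul differentiableAt_snd (hQa t ht).differentiableAt
    rw [euler₂_fst, euler₂_eulerProd hV as hFa t ht] at h2
    rw [euler₂_snd, euler₂_eulerProd hV bs hGa t ht] at h3
    rw [h2, h3, euler₂_zero] at h1
    linear_combination h1
  have hGO : ∀ b, euler₂^[b] (euler₁ F) =O[𝓝 t₀] jet N F → euler₂^[b + 1] F =O[𝓝 t₀] jet N F →
      euler₂^[b] G =O[𝓝 t₀] jet N F := fun b h1 h2 =>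
    (h1.add (h2.const_mul_left (-1))).congr'
      (Filter.mem_of_superset hVn fun t ht => (hGb b t ht).symm) Filter.EventuallyEq.rfl
  have hQO : eulerProd bs G =O[𝓝 t₀] jet N F := isBigO_eulerProd hV ht bs hGa fun b hb =>
    hGO b (hA1 b (by omega)) (hA0 (b + 1) (by omega))
  -- The product over β has only N - 2 factors, so it reaches at most ∂₂^{N-1} F and ∂₂^{N-2} ∂₁F.
  -- The equation is then solved for ∂₂^N F, as t₁ ≠ 0.
  have hAN : euler₂^[N] F =O[𝓝 t₀] jet N F := by
    have := isBigO_iterate_of_eulerProd hV ht as hFa (fun b hb => hA0 b (by omega))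
      (isBigO_of_fst_mul_add (hV0 _ ht) (isBigO_continuous_mul continuous_snd hQO)
        (Filter.mem_of_superset hVn e0))
    rwa [hal] at this
  have hA0' : ∀ b ≤ N, euler₂^[b] F =O[𝓝 t₀] jet N F := fun b hb =>
    hb.lt_or_eq.elim (hA0 b) fun e => e ▸ hAN
  have hPO : eulerProd as F =O[𝓝 t₀] jet N F := isBigO_eulerProd hV ht as hFa fun b hb =>
    hA0' b (by omega)
  have hQ2 : eulerProd bs (euler₂ G) =O[𝓝 t₀] jet N F :=
    isBigO_eulerProd hV ht bs (analytic_euler₂ hGa) fun b hb => by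
      rw [← Function.iterate_succ_apply]
      exact hGO (b + 1) (hA1 (b + 1) (by omega)) (hA0' (b + 2) (by omega))
  have hAN1 : euler₂^[N + 1] F =O[𝓝 t₀] jet N F := by
    have := isBigO_iterate_of_eulerProd hV ht as hF2 (fun b hb => by
        rw [← Function.iterate_succ_apply]; exact hA0' (b + 1) (by omega))
      (isBigO_of_fst_mul_add (hV0 _ ht) ((isBigO_continuous_mul continuous_snd hQO).add
        (isBigO_continuous_mul continuous_snd hQ2)) (Filter.mem_of_superset hVn e2))
    rwa [hal, ← Function.iterate_succ_apply] at this
  have hA0'' : ∀ b ≤ N + 1, euler₂^[b] F =O[𝓝 t₀] jet N F := fun b hb =>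
    hb.lt_or_eq.elim (fun h => hA0' b (by omega)) fun e => e ▸ hAN1
  -- The case b = N - 1 is the one that needs ∂₂^{N+1} F.
  have hA2 : ∀ b < N, euler₂^[b] (euler₁ (euler₁ F)) =O[𝓝 t₀] jet N F := fun b hb =>
    ((hA0'' (b + 2) (by omega)).add (isBigO_continuous_mul (continuous_fst.pow 2)
      (hA0 b hb))).congr' (Filter.mem_of_superset hVn fun t ht =>
        (euler₂_iterate_euler₁_euler₁ hV hFa hF.first b t ht).symm) Filter.EventuallyEq.rfl
  have hQ1 : eulerProd bs (euler₁ G) =O[𝓝 t₀] jet N F :=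
    isBigO_eulerProd hV ht bs (analytic_euler₁ hGa) fun b hb => by
      refine ((hA2 b (by omega)).add ((hA1 (b + 1) (by omega)).const_mul_left (-1))).congr'
        (Filter.mem_of_superset hVn fun t ht => ?_) Filter.EventuallyEq.rfl
      have h1 := euler₁_comb hV (-1) (analytic_euler₂_iterate hF1 b)
        (analytic_euler₂_iterate hFa (b + 1)) (hGb b) t ht
      rw [euler₁_euler₂_iterate hV hGa b t ht, euler₁_euler₂_iterate hV hF1 b t ht,
        euler₁_euler₂_iterate hV hFa (b + 1) t ht] at h1
      exact h1.symm
  have hA1' : euler₂^[N] (euler₁ F) =O[𝓝 t₀] jet N F := by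
    have := isBigO_iterate_of_eulerProd hV ht as hF1 (fun b hb => hA1 b (by omega))
      (isBigO_of_fst_mul_add (hV0 _ ht) ((isBigO_continuous_mul continuous_fst hPO).add
        (isBigO_continuous_mul continuous_snd hQ1)) (Filter.mem_of_superset hVn e1))
    rwa [hal] at this
  obtain ⟨a, b⟩ := i
  have hb := b.2
  fin_cases a
  · constructor
    · exact (hA1 b hb).congr' (Filter.mem_of_superset hVn fun t ht =>
        (euler₁_euler₂_iterate hV hFa b t ht).symm) Filter.EventuallyEq.rfl
    · change euler₂ (euler₂^[b] F) =O[𝓝 t₀] jet N F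
      rw [← Function.iterate_succ_apply' euler₂]
      exact hA0' (b + 1) hb
  · constructor
    · exact (hA2 b hb).congr' (Filter.mem_of_superset hVn fun t ht =>
        (euler₁_euler₂_iterate hV hF1 b t ht).symm) Filter.EventuallyEq.rfl
    · change euler₂ (euler₂^[b] (euler₁ F)) =O[𝓝 t₀] jet N F
      rw [← Function.iterate_succ_apply' euler₂]
      rcases (show (b : ℕ) + 1 ≤ N from hb).lt_or_eq with h | h
      · exact hA1 _ h
      · rw [Nat.succ_eq_add_one, h]; exact hA1'

end Jets

end SpinWhittaker

namespace SpinWhittaker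

/-! ### Uniqueness and the bound 2N for the dimension. -/

section Dimension

open Asymptotics

variable {V : Set (ℂ × ℂ)} {F G : ℂ × ℂ → ℂ} {N : ℕ} {α β : ℕ → ℝ} {t₀ : ℂ × ℂ}

theorem analytic_jet (hF : AnalyticOnNhd ℂ F V) (i : Fin 2 × Fin N) :
    AnalyticOnNhd ℂ (fun t => jet N F t i) V := by
  obtain ⟨a, b⟩ := i
  fin_cases a
  · exact analytic_euler₂_iterate hF b
  · exact analytic_euler₂_iterate (analytic_euler₁ hF) b

theorem fderiv_eq_euler (F : ℂ × ℂ → ℂ) {t : ℂ × ℂ} (h1 : t.1 ≠ 0) (h2 : t.2 ≠ 0) :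
    fderiv ℂ F t = (t.1⁻¹ * euler₁ F t) • ContinuousLinearMap.fst ℂ ℂ ℂ +
      (t.2⁻¹ * euler₂ F t) • ContinuousLinearMap.snd ℂ ℂ ℂ := by
  ext <;> simp [euler₁, euler₂, h1, h2]

/-- Gronwall's inequality on the segment from t₀ to t: the restriction of U vanishes at the start,
and its derivative is at most K‖t - t₀‖ times its norm. -/
theorem eventually_eq_zero_of_fderiv_isBigO {ι : Type*} [Fintype ι] {U : ℂ × ℂ → ι → ℂ}
    (hU : ∀ i, ∀ᶠ t in 𝓝 t₀, DifferentiableAt ℂ (fun t => U t i) t)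
    (hd : ∀ i, (fun t => fderiv ℂ (fun t => U t i) t) =O[𝓝 t₀] U) (h0 : U t₀ = 0) :
    ∀ᶠ t in 𝓝 t₀, U t = 0 := by
  obtain ⟨K, hK⟩ := (isBigO_pi.2 hd).bound
  obtain ⟨r, hr, hball⟩ := Metric.mem_nhds_iff.1 (Filter.inter_mem hK (Filter.eventually_all.2 hU))
  filter_upwards [Metric.ball_mem_nhds t₀ hr] with t ht
  set v := t - t₀ with hv
  have hmem : ∀ x ∈ Set.Icc (0 : ℝ) 1, t₀ + (x : ℂ) • v ∈ Metric.ball t₀ r := fun x hx => by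
    rw [Metric.mem_ball, dist_eq_norm, add_sub_cancel_left, norm_smul, Complex.norm_real,
      Real.norm_of_nonneg hx.1]
    rw [Metric.mem_ball, dist_eq_norm] at ht
    exact (mul_le_of_le_one_left (norm_nonneg _) hx.2).trans_lt ht
  have hder : ∀ x ∈ Set.Icc (0 : ℝ) 1, HasDerivAt (fun x : ℝ => U (t₀ + (x : ℂ) • v))
      (fun i => fderiv ℂ (fun t => U t i) (t₀ + (x : ℂ) • v) v) x := fun x hx => by
    refine hasDerivAt_pi.2 fun i => ?_
    have h1 : HasDerivAt (fun x : ℝ => t₀ + (x : ℂ) • v) v x := by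
      simpa using ((Complex.ofRealCLM.hasDerivAt (x := x)).smul_const v).const_add t₀
    exact (((hball (hmem x hx)).2 i).hasFDerivAt.restrictScalars ℝ).comp_hasDerivAt x h1
  have h1 := eq_zero_of_abs_deriv_le_mul_abs_self_of_eq_zero_right
    (f := fun x : ℝ => U (t₀ + (x : ℂ) • v)) (K := K * ‖v‖)
    (fun x hx => (hder x hx).continuousAt.continuousWithinAt)
    (fun x hx => (hder x (Set.Ico_subset_Icc_self hx)).hasDerivWithinAt) (by simpa using h0)
    (fun x hx => ?_) 1 (by simp)
  · simpa [hv] using h1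
  · have h2 := (hball (hmem x (Set.Ico_subset_Icc_self hx))).1
    have h3 : 0 ≤ K * ‖U (t₀ + (x : ℂ) • v)‖ := (norm_nonneg _).trans h2
    rw [mul_right_comm]
    refine (pi_norm_le_iff_of_nonneg (mul_nonneg h3 (norm_nonneg _))).2 fun i => ?_
    refine (ContinuousLinearMap.le_opNorm _ _).trans
      (mul_le_mul_of_nonneg_right ((norm_le_pi_norm (fun i => fderiv ℂ (fun t => U t i)
        (t₀ + (x : ℂ) • v)) i).trans h2) (norm_nonneg _))

/-- A solution is determined by its jet at a point. -/
theorem IsSolutionOn.eq_zero_of_jet_eq_zero (hN : 2 ≤ N) (hV : IsOpen V) (hVc : IsPreconnected V)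
    (hV0 : ∀ t ∈ V, t.1 ≠ 0 ∧ t.2 ≠ 0) (ht : t₀ ∈ V) (hF : IsSolutionOn N α β V F)
    (h0 : jet N F t₀ = 0) : ∀ t ∈ V, F t = 0 := by
  have h1 : ∀ᶠ t in 𝓝 t₀, jet N F t = 0 := by
    refine eventually_eq_zero_of_fderiv_isBigO (fun i => Filter.mem_of_superset (hV.mem_nhds ht)
      fun t ht => (analytic_jet hF.analytic i t ht).differentiableAt) (fun i => ?_) h0
    obtain ⟨e1, e2⟩ := isBigO_euler_jet hN hV (fun t ht => (hV0 t ht).1) ht hF i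
    have c1 : ContinuousAt (fun t : ℂ × ℂ => t.1⁻¹) t₀ := continuousAt_fst.inv₀ (hV0 t₀ ht).1
    have c2 : ContinuousAt (fun t : ℂ × ℂ => t.2⁻¹) t₀ := continuousAt_snd.inv₀ (hV0 t₀ ht).2
    have f1 := ((c1.isBigO_one ℝ).mul e1.norm_right).smul
      (isBigO_const_const (ContinuousLinearMap.fst ℂ ℂ ℂ) (one_ne_zero (α := ℝ)) (𝓝 t₀))
    have f2 := ((c2.isBigO_one ℝ).mul e2.norm_right).smul
      (isBigO_const_const (ContinuousLinearMap.snd ℂ ℂ ℂ) (one_ne_zero (α := ℝ)) (𝓝 t₀))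
    have f3 := f1.add f2
    simp only [one_mul, smul_eq_mul, mul_one, isBigO_norm_right] at f3
    exact f3.congr' (Filter.mem_of_superset (hV.mem_nhds ht) fun t ht =>
      (fderiv_eq_euler _ (hV0 t ht).1 (hV0 t ht).2).symm) Filter.EventuallyEq.rfl
  refine hF.analytic.eqOn_zero_of_preconnected_of_eventuallyEq_zero hVc ht ?_
  filter_upwards [h1] with t ht
  exact congrFun ht (0, ⟨0, by omega⟩)

theorem jet_comb (hV : IsOpen V) (c : ℂ) (hF : AnalyticOnNhd ℂ F V) (hG : AnalyticOnNhd ℂ G V)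
    {H : ℂ × ℂ → ℂ} (hH : ∀ t ∈ V, H t = F t + c * G t) : ∀ t ∈ V,
    jet N H t = jet N F t + c • jet N G t := by
  intro t ht
  ext ⟨a, b⟩
  fin_cases a
  · exact euler₂_iterate_comb hV c hF hG hH b t ht
  · exact euler₂_iterate_comb hV c (analytic_euler₁ hF) (analytic_euler₁ hG)
      (euler₁_comb hV c hF hG hH) b t ht

theorem jet_zero (t : ℂ × ℂ) : jet N (fun _ => 0) t = 0 := by
  have h := jet_comb (N := N) isOpen_univ (-1) (analyticOnNhd_const (v := (0 : ℂ)))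
    (analyticOnNhd_const (v := (0 : ℂ))) (H := fun _ => 0) (by simp) t trivial
  simpa using h

theorem exists_injective_jet (hN : 2 ≤ N) (V : TopologicalSpace.Opens (ℂ × ℂ))
    (hVc : IsConnected (V : Set (ℂ × ℂ))) (hV0 : ∀ t ∈ V, t.1 ≠ 0 ∧ t.2 ≠ 0) :
    ∃ T : solutionSpace N α β V →ₗ[ℂ] (Fin 2 × Fin N → ℂ), Function.Injective T := by
  obtain ⟨t₀, ht⟩ := hVc.nonempty
  -- An element of the solution space is a function on V, represented by a chosen F on ℂ². As V is
  -- open, the jet at t₀ depends only on the values on V, so the choice does not spoil linearity.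
  choose F hF hFg using fun g : solutionSpace N α β V => g.2
  refine ⟨{ toFun := fun g => jet N (F g) t₀, map_add' := fun g g' => ?_,
            map_smul' := fun c g => ?_ }, fun g g' h => ?_⟩
  · have h1 := jet_comb (N := N) V.isOpen 1 (hF g).analytic (hF g').analytic (H := F (g + g'))
      (fun t ht => by
        rw [← hFg _ ⟨t, ht⟩, ← hFg _ ⟨t, ht⟩, ← hFg _ ⟨t, ht⟩]; simp) t₀ ht
    simpa using h1
  · have h1 := jet_comb (N := N) V.isOpen c analyticOnNhd_const (hF g).analytic (H := F (c • g))
      (F := fun _ => 0) (fun t ht => by rw [← hFg _ ⟨t, ht⟩, ← hFg _ ⟨t, ht⟩]; simp) t₀ ht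
    simpa [jet_zero] using h1
  · have h1 := (hF g).comb V.isOpen (-1) (hF g')
    have h2 := jet_comb (N := N) V.isOpen (-1) (hF g).analytic (hF g').analytic
      (fun _ _ => rfl) t₀ ht
    have h3 := h1.eq_zero_of_jet_eq_zero hN V.isOpen hVc.isPreconnected hV0 ht (by
      rw [h2, show jet N (F g) t₀ = jet N (F g') t₀ from h]
      simp)
    ext t
    have h4 := h3 t t.2
    rw [← hFg, ← hFg] at h4
    linear_combination h4

theorem finite_solutionSpace (hN : 2 ≤ N) (V : TopologicalSpace.Opens (ℂ × ℂ))
    (hVc : IsConnected (V : Set (ℂ × ℂ))) (hV0 : ∀ t ∈ V, t.1 ≠ 0 ∧ t.2 ≠ 0) :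
    Module.Finite ℂ (solutionSpace N α β V) ∧
      Module.finrank ℂ (solutionSpace N α β V) ≤ 2 * N := by
  obtain ⟨T, hT⟩ := exists_injective_jet (α := α) (β := β) hN V hVc hV0
  exact ⟨Module.Finite.of_injective T hT,
    (LinearMap.finrank_le_finrank_of_injective hT).trans (by simp)⟩

end Dimension

end SpinWhittaker

namespace SpinWhittaker

/-! ### Linear independence -/

instance : Fintype Kind where
  elems := ⟨{Kind.K, Kind.I}, by simp⟩
  complete L := by rcases L <;> simp

theorem sum_kind {M : Type*} [AddCommMonoid M] (f : Kind → M) :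
    ∑ L, f L = f Kind.K + f Kind.I := by
  change (Multiset.map f ({Kind.K, Kind.I} : Multiset Kind)).sum = _
  simp

/-! ### Limits and monodromy in t₂. -/

section Monodromy

variable {N : ℕ} {α β : ℕ → ℝ} {c h : ℝ}

theorem LoopIntegrable.const_mul {F : ℂ → ℂ} (hF : LoopIntegrable c h F) (a : ℂ) :
    LoopIntegrable c h fun s => a * F s :=
  ⟨hF.1.const_mul a, hF.2.1.const_mul a, hF.2.2.const_mul a⟩

/-- The leading term along the ray ℓ₂ = x + μ, x → -∞. The offset μ accommodates both the passage
from log t₂ to log(-t₂) and circuits around t₂ = 0. -/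
theorem tendsto_mellinBarnes_mul_exp (H : Interlacing N α β) {j : ℕ} (hj : 1 ≤ j) (hjN : j ≤ N)
    (hne : α 1 ≠ α 2 ∨ 2 ≤ j) (hc : c ∈ Set.Ioo (-α j - 1) (-α j)) (hh : 0 < h) (L : Kind)
    (ℓ₁ μ : ℂ) :
    Filter.Tendsto (fun x : ℝ => mellinBarnes N α β c h j L ℓ₁ (x + μ) * Complex.exp (α j * x))
      Filter.atBot
      (𝓝 (Complex.exp (-α j * μ) * ((leadingCoeff N α β j : ℂ) * bessel L (α j) ℓ₁))) := by
  obtain ⟨C, hC⟩ := exists_mellinBarnes_asymptotic H hj hjN hne hc hh L |μ.im| ‖ℓ₁‖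
  have h1 : Filter.Tendsto (fun x : ℝ => mellinBarnes N α β c h j L ℓ₁ (x + μ) /
      Complex.exp (-α j * (x + μ))) Filter.atBot
      (𝓝 ((leadingCoeff N α β j : ℂ) * bessel L (α j) ℓ₁)) := by
    rw [tendsto_iff_norm_sub_tendsto_zero]
    have h2 : Filter.Tendsto (fun x : ℝ => C * Real.exp (1 / 2 * (x + μ.re))) Filter.atBot
        (𝓝 0) := by
      have h3 : Filter.Tendsto (fun x : ℝ => 1 / 2 * (x + μ.re)) Filter.atBot Filter.atBot :=
        (Filter.tendsto_atBot_add_const_right _ _ Filter.tendsto_id).const_mul_atBot (by norm_num)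
      simpa using (Real.tendsto_exp_atBot.comp h3).const_mul C
    refine squeeze_zero' (Filter.Eventually.of_forall fun _ => norm_nonneg _) ?_ h2
    filter_upwards [Filter.eventually_le_atBot (-μ.re)] with x hx
    have := hC ℓ₁ (x + μ) le_rfl (by simp; linarith) (by simp)
    simpa using this
  refine (h1.const_mul (Complex.exp (-α j * μ))).congr fun x => ?_
  have e0 := Complex.exp_ne_zero (-(α j : ℂ) * μ)
  have e1 := Complex.exp_ne_zero (α j * (x : ℂ))
  rw [show -(α j : ℂ) * (x + μ) = -(α j : ℂ) * μ + -(α j * (x : ℂ)) by ring, Complex.exp_add,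
    Complex.exp_neg (α j * (x : ℂ))]
  field_simp

theorem tendsto_mul_exp_atBot_zero {f : ℝ → ℂ} {y : ℂ} (hf : Filter.Tendsto f Filter.atBot (𝓝 y))
    {d : ℝ} (hd : 0 < d) :
    Filter.Tendsto (fun x : ℝ => f x * Complex.exp (d * x)) Filter.atBot (𝓝 0) := by
  have h1 : Filter.Tendsto (fun x : ℝ => Real.exp (d * x)) Filter.atBot (𝓝 0) :=
    Real.tendsto_exp_atBot.comp (Filter.tendsto_id.const_mul_atBot hd)
  have h2 := hf.mul ((Complex.continuous_ofReal.tendsto 0).comp h1)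
  simpa using h2

/-- Continuation multiplies the integrand by e^{2πis}, and e^{2πis} - 1 = 2i e^{πis} sin πs. The
sine turns the first Gamma quotient into the second up to a constant, and e^{πis} moves ℓ₂ by πi. -/
theorem exists_monodromy (H : Interlacing N α β) (hc : ∀ n : ℤ, c ≠ n) (hh : 0 < h) :
    ∃ k : ℂ, k ≠ 0 ∧ ∀ (L : Kind) (ℓ₁ ℓ₂ : ℂ),
      mellinBarnes N α β c h 1 L ℓ₁ (ℓ₂ + 2 * Real.pi * Complex.I) -
        mellinBarnes N α β c h 1 L ℓ₁ ℓ₂ =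
      k * mellinBarnes N α β c h 2 L ℓ₁ (ℓ₂ + Real.pi * Complex.I) := by
  have h2N := H.two_le
  obtain ⟨κ, hκ, hg⟩ := gammaQuotient_eq_sin_mul H le_rfl h2N
  have hκ2 : κ * κ = 1 := by rcases hκ with rfl | rfl <;> norm_num
  have hpi : (Real.pi : ℂ) ≠ 0 := by exact_mod_cast Real.pi_ne_zero
  obtain ⟨δ, hδ, hl⟩ := exists_loopIn hc hh
  refine ⟨2 * Real.pi * Complex.I * κ, mul_ne_zero Complex.two_pi_I_ne_zero fun h => by
    rw [h] at hκ2; simp at hκ2, fun L ℓ₁ ℓ₂ => ?_⟩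
  have h1 := loopIntegrable_integrand H le_rfl (by omega) hc hh L ℓ₁ ℓ₂
  have h2 := (loopIntegrable_integrand H (show 1 ≤ 2 by omega) h2N hc hh L ℓ₁
    (ℓ₂ + Real.pi * Complex.I)).const_mul (2 * Real.pi * Complex.I * κ)
  have h3 := loopIntegral_add h1 h2
  rw [loopIntegral_const_mul] at h3
  have h4 : loopIntegral c h (integrand N α β 1 L ℓ₁ (ℓ₂ + 2 * Real.pi * Complex.I)) =
      loopIntegral c h fun s => integrand N α β 1 L ℓ₁ ℓ₂ s + 2 * Real.pi * Complex.I * κ *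
        integrand N α β 2 L ℓ₁ (ℓ₂ + Real.pi * Complex.I) s := by
    refine loopIntegral_congr hl fun s hs => ?_
    rw [integrand, integrand, integrand, hg s (sin_ne_zero_of_mem hδ hs), Complex.sin]
    have e1 : Complex.exp (-(s * Real.pi) * Complex.I) * Complex.exp (s * Real.pi * Complex.I) =
        1 := by
      rw [← Complex.exp_add]; simp
    have e2 : Complex.exp (s * (ℓ₂ + Real.pi * Complex.I)) =
        Complex.exp (s * ℓ₂) * Complex.exp (s * Real.pi * Complex.I) := by
      rw [← Complex.exp_add]; ring_nf
    have e3 : Complex.exp (s * (ℓ₂ + 2 * Real.pi * Complex.I)) = Complex.exp (s * ℓ₂) *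
        (Complex.exp (s * Real.pi * Complex.I) * Complex.exp (s * Real.pi * Complex.I)) := by
      rw [← Complex.exp_add, ← Complex.exp_add]; ring_nf
    rw [e2, e3]
    set E := Complex.exp (s * Real.pi * Complex.I)
    set E' := Complex.exp (-(s * Real.pi) * Complex.I)
    set Z := gammaQuotient N α β 1 s * Complex.exp (s * ℓ₂) * bessel L (-s) ℓ₁ with hZ
    have e4 : ∀ q : ℂ, gammaQuotient N α β 1 s * (Complex.exp (s * ℓ₂) * q * bessel L (-s) ℓ₁) =
      Z * q := fun q => by rw [hZ]; ring
    have e5 : gammaQuotient N α β 1 s * (Complex.exp (s * ℓ₂) * bessel L (-s) ℓ₁) = Z := by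
      rw [hZ]; ring
    rw [e4, e5, mul_assoc (κ * _), e4]
    field_simp
    linear_combination κ ^ 2 * Z * e1 + (Z * (1 - E ^ 2)) * hκ2 -
      κ ^ 2 * Z * E * (E' - E) * Complex.I_sq
  simp only [mellinBarnes]
  rw [h4, h3]
  ring

end Monodromy

/-! ### Vanishing of the coefficients and the basis property. -/

section Independence

variable {N : ℕ} {α β c h : ℕ → ℝ}

/-- The relation is multiplied by e^{α_{k+1}x} and x → -∞. Only the pair with index k survives, and
K_n, I_n are independent. The index k is zero-based, so it belongs to f_{k+1}. -/
theorem coeff_eq_zero_of_lead (H : Interlacing N α β)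
    (hc : ∀ j ∈ Finset.Icc 1 N, c j ∈ Set.Ioo (-α j - 1) (-α j))
    (hh : ∀ j ∈ Finset.Icc 1 N, 0 < h j) {a μ : Fin N × Kind → ℂ}
    (hrel : ∀ ℓ₁ ℓ₂, ∑ i, a i * mellinBarnes N α β (c (i.1 + 1)) (h (i.1 + 1)) (i.1 + 1) i.2 ℓ₁
      (ℓ₂ + μ i) = 0) (k : Fin N) (hne : α 1 ≠ α 2 ∨ 1 ≤ (k : ℕ))
    (hk : ∀ i < k, ∀ L, a (i, L) = 0) (L : Kind) : a (k, L) = 0 := by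
  obtain ⟨n, hn⟩ := H.int_alpha (k + 1) (by omega) (by omega)
  have hmem : ∀ i : Fin N, (i : ℕ) + 1 ∈ Finset.Icc 1 N := fun i => by simp
  have key : ∀ ℓ₁, (a (k, Kind.K) * Complex.exp (-n * μ (k, Kind.K))) * besselK n ℓ₁ +
      (a (k, Kind.I) * Complex.exp (-n * μ (k, Kind.I))) * besselI n ℓ₁ = 0 := by
    intro ℓ₁
    have h1 : Filter.Tendsto (fun x : ℝ => ∑ i, a i * (mellinBarnes N α β (c (i.1 + 1))
        (h (i.1 + 1)) (i.1 + 1) i.2 ℓ₁ (x + μ i) * Complex.exp (α (k + 1) * x))) Filter.atBot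
        (𝓝 (∑ i : Fin N × Kind, if i.1 = k then a i * (Complex.exp (-α (k + 1) * μ i) *
          ((leadingCoeff N α β (k + 1) : ℂ) * bessel i.2 (α (k + 1)) ℓ₁)) else 0)) := by
      refine tendsto_finsetSum _ fun i _ => ?_
      obtain ⟨i, L⟩ := i
      have hci := hc _ (hmem i)
      have hhi := hh _ (hmem i)
      rcases lt_trichotomy i k with hik | hik | hik
      · simp [hk i hik, hik.ne]
      · subst hik
        simp only [if_true]
        exact (tendsto_mellinBarnes_mul_exp H (by omega) (by omega)
          (hne.imp_right fun h => by omega) hci hhi L ℓ₁ _).const_mul _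
      -- For i > k one has α_{i+1} < α_{k+1}, so the normalisation leaves a decaying factor
      -- e^{(α_{k+1} - α_{i+1})x}.
      · simp only [hik.ne', if_false]
        have h2 := tendsto_mul_exp_atBot_zero (tendsto_mellinBarnes_mul_exp H (by omega) (by omega)
          (Or.inr (by simp only [Fin.lt_def] at hik; omega)) hci hhi L ℓ₁ (μ (i, L)))
          (d := α (k + 1) - α (i + 1)) (sub_pos.2 (H.alpha_lt_of_lt' (by omega)
            (by simp only [Fin.lt_def] at hik; omega) (by omega)
            (hne.imp_right fun h => by omega)))
        have h3 := h2.const_mul (a (i, L))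
        rw [mul_zero] at h3
        refine h3.congr fun x => ?_
        rw [mul_assoc (mellinBarnes _ _ _ _ _ _ _ _ _), ← Complex.exp_add]
        push_cast
        ring_nf
    have h2 := tendsto_nhds_unique h1 ((tendsto_const_nhds (x := (0 : ℂ))).congr fun x : ℝ => by
      have h3 := hrel ℓ₁ x
      rw [← zero_mul (Complex.exp (α (k + 1) * x)), ← h3, Finset.sum_mul]
      exact Finset.sum_congr rfl fun i _ => by ring)
    rw [Fintype.sum_prod_type, Finset.sum_eq_single k (fun i _ hik => by simp [hik])
      (fun h => absurd (Finset.mem_univ k) h), sum_kind] at h2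
    simp only [if_true, hn, bessel, Complex.ofReal_intCast] at h2
    have h3 : (leadingCoeff N α β (k + 1) : ℂ) ≠ 0 := by
      exact_mod_cast leadingCoeff_ne_zero H (by omega) (by omega) (hne.imp_right fun h => by omega)
    refine mul_left_cancel₀ h3 ?_
    rw [mul_zero, ← h2]
    ring
  obtain ⟨h1, h2⟩ := besselK_besselI_independent n _ _ key
  rcases L with _ | _
  · exact (mul_eq_zero.1 h1).resolve_right (Complex.exp_ne_zero _)
  · exact (mul_eq_zero.1 h2).resolve_right (Complex.exp_ne_zero _)

/-- The monodromy around `t₂ = 0` separates `f_1` from the other functions if `α₁ = α₂`. -/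
theorem coeff_first_eq_zero (H : Interlacing N α β) (h12 : α 1 = α 2)
    (hc : ∀ j ∈ Finset.Icc 1 N, c j ∈ Set.Ioo (-α j - 1) (-α j))
    (hh : ∀ j ∈ Finset.Icc 1 N, 0 < h j) {a μ : Fin N × Kind → ℂ}
    (hrel : ∀ ℓ₁ ℓ₂, ∑ i, a i * mellinBarnes N α β (c (i.1 + 1)) (h (i.1 + 1)) (i.1 + 1) i.2 ℓ₁
      (ℓ₂ + μ i) = 0) (k : Fin N) (hk0 : (k : ℕ) = 0) (L : Kind) : a (k, L) = 0 := by
  have h2N := H.two_le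
  obtain ⟨n, hn⟩ := H.int_alpha 2 (by omega) h2N
  have hmem : ∀ i : Fin N, (i : ℕ) + 1 ∈ Finset.Icc 1 N := fun i => by simp
  have hc1 := hc 1 (by simp; omega)
  have hh1 := hh 1 (by simp; omega)
  obtain ⟨κ, hκ, hmono⟩ := exists_monodromy H (H.loop_ne_int le_rfl (by omega) hc1) hh1
  -- As α₁ = α₂, the loop of f₁ is also an admissible loop for f₂.
  rw [h12] at hc1
  have key : ∀ ℓ₁,
      (a (k, Kind.K) * Complex.exp (-n * (μ (k, Kind.K) + Real.pi * Complex.I))) * besselK n ℓ₁ +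
      (a (k, Kind.I) * Complex.exp (-n * (μ (k, Kind.I) + Real.pi * Complex.I))) *
        besselI n ℓ₁ = 0 := by
    intro ℓ₁
    -- Each function is replaced by its increment under ℓ₂ ↦ ℓ₂ + 2πi. For f₁ the increment is a
    -- multiple of f₂, with a nonzero leading term of order α₂.
    have h1 : Filter.Tendsto (fun x : ℝ => ∑ i, a i * ((mellinBarnes N α β (c (i.1 + 1))
        (h (i.1 + 1)) (i.1 + 1) i.2 ℓ₁ (x + μ i + 2 * Real.pi * Complex.I) -
        mellinBarnes N α β (c (i.1 + 1)) (h (i.1 + 1)) (i.1 + 1) i.2 ℓ₁ (x + μ i)) *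
          Complex.exp (α 2 * x))) Filter.atBot
        (𝓝 (∑ i : Fin N × Kind, if i.1 = k then a i * (κ *
          (Complex.exp (-α 2 * (μ i + Real.pi * Complex.I)) *
          ((leadingCoeff N α β 2 : ℂ) * bessel i.2 (α 2) ℓ₁))) else 0)) := by
      refine tendsto_finsetSum _ fun i _ => ?_
      obtain ⟨i, L⟩ := i
      by_cases hik : i = k
      · subst hik
        simp only [if_true, hk0, zero_add]
        refine (((tendsto_mellinBarnes_mul_exp H (by omega) h2N (Or.inr le_rfl) hc1 hh1 L ℓ₁
          (μ (i, L) + Real.pi * Complex.I)).const_mul κ).const_mul (a (i, L))).congr fun x => ?_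
        rw [hmono, ← mul_assoc κ, add_assoc (x : ℂ)]
      · have hi1 : 1 ≤ (i : ℕ) := Nat.one_le_iff_ne_zero.2 fun h0 => hik (Fin.ext (h0.trans hk0.symm))
        simp only [hik, if_false]
        have h2 := fun ν => tendsto_mellinBarnes_mul_exp H (by omega) (by omega)
          (Or.inr (by omega)) (hc _ (hmem i)) (hh _ (hmem i)) L ℓ₁ ν
        obtain ⟨p, hp⟩ := H.int_alpha (i + 1) (by omega) (by omega)
        have h3 := (h2 (μ (i, L) + 2 * Real.pi * Complex.I)).sub (h2 (μ (i, L)))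
        -- The exponents are integers, so the leading terms of the functions with j ≥ 2 are
        -- single-valued and disappear from the increments.
        have e1 : Complex.exp (-(α (i + 1) : ℂ) * (μ (i, L) + 2 * Real.pi * Complex.I)) =
            Complex.exp (-(α (i + 1) : ℂ) * μ (i, L)) := by
          rw [hp, Complex.exp_eq_exp_iff_exists_int]
          exact ⟨-p, by push_cast; ring⟩
        rw [e1, sub_self] at h3
        have h4 : Filter.Tendsto (fun x : ℝ => (mellinBarnes N α β (c (i + 1)) (h (i + 1)) (i + 1)
            L ℓ₁ (x + (μ (i, L) + 2 * Real.pi * Complex.I)) * Complex.exp (α (i + 1) * x) -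
            mellinBarnes N α β (c (i + 1)) (h (i + 1)) (i + 1) L ℓ₁ (x + μ (i, L)) *
              Complex.exp (α (i + 1) * x)) *
            Complex.exp ((α 2 - α (i + 1) : ℝ) * x)) Filter.atBot (𝓝 0) := by
          rcases (H.alpha_le_of_le (show 1 ≤ 2 by omega) (show 2 ≤ (i : ℕ) + 1 by omega)
            (by omega)).eq_or_lt with h | h
          · simpa [h] using h3
          · exact tendsto_mul_exp_atBot_zero h3 (sub_pos.2 h)
        have h5 := h4.const_mul (a (i, L))
        rw [mul_zero] at h5
        refine h5.congr fun x => ?_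
        rw [← sub_mul, mul_assoc (_ - _), ← Complex.exp_add]
        push_cast
        ring_nf
    have h2 := tendsto_nhds_unique h1 ((tendsto_const_nhds (x := (0 : ℂ))).congr fun x : ℝ => by
      have h3 := hrel ℓ₁ x
      have h4 := hrel ℓ₁ (x + 2 * Real.pi * Complex.I)
      -- Zero is written as the relation at x + 2πi minus the relation at x.
      have h5 : (0 : ℂ) = (0 - 0) * Complex.exp (α 2 * x) := by ring
      rw [h5, ← h3]
      nth_rewrite 1 [h3, ← h4]
      rw [← Finset.sum_sub_distrib, Finset.sum_mul]
      refine Finset.sum_congr rfl fun i _ => ?_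
      rw [add_right_comm]
      ring)
    rw [Fintype.sum_prod_type, Finset.sum_eq_single k (fun i _ hik => by simp [hik])
      (fun h => absurd (Finset.mem_univ k) h), sum_kind] at h2
    simp only [if_true, hn, bessel, Complex.ofReal_intCast] at h2
    have h3 : (leadingCoeff N α β 2 : ℂ) ≠ 0 := by
      exact_mod_cast leadingCoeff_ne_zero H (by omega) h2N (Or.inr le_rfl)
    refine mul_left_cancel₀ (mul_ne_zero hκ h3) ?_
    rw [mul_zero, ← h2]
    ring
  obtain ⟨h1, h2⟩ := besselK_besselI_independent n _ _ key
  rcases L with _ | _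
  · exact (mul_eq_zero.1 h1).resolve_right (Complex.exp_ne_zero _)
  · exact (mul_eq_zero.1 h2).resolve_right (Complex.exp_ne_zero _)

/-- The coefficients vanish by induction on the index, in the order of decreasing leading exponent.
Only the first index with α₁ = α₂ needs the monodromy. -/
theorem coeff_eq_zero (H : Interlacing N α β)
    (hc : ∀ j ∈ Finset.Icc 1 N, c j ∈ Set.Ioo (-α j - 1) (-α j))
    (hh : ∀ j ∈ Finset.Icc 1 N, 0 < h j) {a μ : Fin N × Kind → ℂ}
    (hrel : ∀ ℓ₁ ℓ₂, ∑ i, a i * mellinBarnes N α β (c (i.1 + 1)) (h (i.1 + 1)) (i.1 + 1) i.2 ℓ₁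
      (ℓ₂ + μ i) = 0) (i : Fin N × Kind) : a i = 0 := by
  have h1 : ∀ k : Fin N, ∀ L, a (k, L) = 0 := by
    intro k
    induction k using WellFoundedLT.induction with
    | ind k ih =>
      intro L
      by_cases h12 : α 1 = α 2
      · rcases Nat.eq_zero_or_pos k with h0 | h0
        · exact coeff_first_eq_zero H h12 hc hh hrel k h0 L
        · exact coeff_eq_zero_of_lead H hc hh hrel k (Or.inr h0) ih L
      · exact coeff_eq_zero_of_lead H hc hh hrel k (Or.inl h12) ih L
  exact h1 i.1 i.2

theorem analyticOnNhd_mellinBarnes (H : Interlacing N α β) {j : ℕ} (hj : 1 ≤ j) (hjN : j ≤ N)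
    {c h : ℝ} (hc : ∀ n : ℤ, c ≠ n) (hh : 0 < h) (L : Kind) :
    AnalyticOnNhd ℂ (fun p : ℂ × ℂ => mellinBarnes N α β c h j L p.1 p.2) Set.univ := by
  obtain ⟨δ, hδ, hl⟩ := exists_loopIn hc hh
  exact analyticOnNhd_const.mul (analyticOnNhd_mbInt hδ hl (admissible_gammaQuotient H hδ hj hjN)
    (admissibleProfile_bessel hδ L) (admissibleProfile_besselDeriv hδ L)
    fun s hs => hasDerivAt_bessel L (sin_ne_zero_of_mem hδ hs))

theorem logBase_add (j : ℕ) (L : Kind) (x μ : ℂ) : logBase j L x (x + μ) = x + logBase j L 0 μ := by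
  rcases L with _ | _ <;> simp only [logBase] <;> split_ifs <;> simp

/-- The open set V need not approach t₂ = 0, so the relation is first rewritten as R(L₁, L₂) = 0
with R entire in the two logarithms. The pair (L₁, L₂) is locally inverse to the exponential map;
hence R vanishes on an open set and therefore everywhere. -/
theorem linearIndependent_solutionFamily (H : Interlacing N α β)
    (hc : ∀ j ∈ Finset.Icc 1 N, c j ∈ Set.Ioo (-α j - 1) (-α j))
    (hh : ∀ j ∈ Finset.Icc 1 N, 0 < h j) (V : TopologicalSpace.Opens (ℂ × ℂ))
    (hV : (V : Set (ℂ × ℂ)).Nonempty) {L₁ L₂ L₂' : ℂ × ℂ → ℂ} (h1 : ContinuousOn L₁ V)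
    (h2 : ContinuousOn L₂ V) (h2' : ContinuousOn L₂' V) (e1 : ∀ t ∈ V, Complex.exp (L₁ t) = t.1)
    (e2 : ∀ t ∈ V, Complex.exp (L₂ t) = t.2) (e2' : ∀ t ∈ V, Complex.exp (L₂' t) = -t.2) :
    LinearIndependent ℂ (solutionFamily N α β c h V L₁ L₂ L₂') := by
  rw [Fintype.linearIndependent_iff]
  intro a ha
  obtain ⟨t₀, ht₀⟩ := hV
  have hVn : (V : Set (ℂ × ℂ)) ∈ 𝓝 t₀ := V.isOpen.mem_nhds ht₀
  set κ := L₂' t₀ - L₂ t₀ with hκ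
  -- The two logarithms differ by a locally constant number, so all functions can be expressed in
  -- the single variable L₂.
  have hL2 : ∀ᶠ t in 𝓝 t₀, L₂' t = L₂ t + κ := by
    refine eventuallyEq_of_exp_eq (h2'.continuousAt hVn)
      ((h2.continuousAt hVn).add continuousAt_const) (by simp [hκ]) ?_
    filter_upwards [hVn] with t ht
    rw [e2' t ht, Complex.exp_add, e2 t ht, hκ, Complex.exp_sub, e2' t₀ ht₀, e2 t₀ ht₀]
    have : t₀.2 ≠ 0 := e2 t₀ ht₀ ▸ Complex.exp_ne_zero _
    field_simp
  set μ : Fin N × Kind → ℂ := fun i => logBase (i.1 + 1) i.2 0 κ with hμ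
  set R : ℂ × ℂ → ℂ := fun p => ∑ i, a i * mellinBarnes N α β (c (i.1 + 1)) (h (i.1 + 1))
    (i.1 + 1) i.2 p.1 (p.2 + μ i) with hR
  have hRa : AnalyticOnNhd ℂ R Set.univ := fun p _ =>
    Finset.analyticAt_fun_sum _ fun i _ => analyticAt_const.mul (AnalyticAt.comp
      (f := fun p : ℂ × ℂ => (p.1, p.2 + μ i))
      (analyticOnNhd_mellinBarnes H (by omega) (by omega)
        (H.loop_ne_int (by omega) (by omega) (hc _ (by simp))) (hh _ (by simp)) i.2 _ trivial)
      (analyticAt_fst.prod (analyticAt_snd.add analyticAt_const)))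
  have hRV : ∀ᶠ t in 𝓝 t₀, R (L₁ t, L₂ t) = 0 := by
    filter_upwards [hVn, hL2] with t ht ht2
    have h3 := congrFun ha ⟨t, ht⟩
    simp only [Finset.sum_apply, Pi.smul_apply, smul_eq_mul, Pi.zero_apply, solutionFamily, ht2,
      logBase_add] at h3
    exact h3
  have hE : Filter.Tendsto (fun p : ℂ × ℂ => (Complex.exp p.1, Complex.exp p.2))
      (𝓝 (L₁ t₀, L₂ t₀)) (𝓝 t₀) := by
    have : ContinuousAt (fun p : ℂ × ℂ => (Complex.exp p.1, Complex.exp p.2)) (L₁ t₀, L₂ t₀) := by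
      fun_prop
    rw [ContinuousAt, e1 t₀ ht₀, e2 t₀ ht₀] at this
    exact this
  have hE0 : (Complex.exp (L₁ t₀), Complex.exp (L₂ t₀)) = t₀ := by rw [e1 t₀ ht₀, e2 t₀ ht₀]
  have hp1 : ∀ᶠ p : ℂ × ℂ in 𝓝 (L₁ t₀, L₂ t₀), L₁ (Complex.exp p.1, Complex.exp p.2) = p.1 := by
    refine eventuallyEq_of_exp_eq ?_ continuousAt_fst (by simp [hE0])
      ((hE.eventually hVn).mono fun p hp => e1 _ hp)
    exact ContinuousAt.comp_of_eq (f := fun p : ℂ × ℂ => (Complex.exp p.1, Complex.exp p.2))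
      (h1.continuousAt hVn) (by fun_prop) hE0
  have hp2 : ∀ᶠ p : ℂ × ℂ in 𝓝 (L₁ t₀, L₂ t₀), L₂ (Complex.exp p.1, Complex.exp p.2) = p.2 := by
    refine eventuallyEq_of_exp_eq ?_ continuousAt_snd (by simp [hE0])
      ((hE.eventually hVn).mono fun p hp => e2 _ hp)
    exact ContinuousAt.comp_of_eq (f := fun p : ℂ × ℂ => (Complex.exp p.1, Complex.exp p.2))
      (h2.continuousAt hVn) (by fun_prop) hE0
  have hR0 : R =ᶠ[𝓝 (L₁ t₀, L₂ t₀)] 0 := by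
    filter_upwards [hE.eventually hRV, hp1, hp2] with p h3 h4 h5
    rwa [h4, h5] at h3
  have hRz := hRa.eqOn_zero_of_preconnected_of_eventuallyEq_zero isPreconnected_univ trivial hR0
  exact coeff_eq_zero H hc hh fun ℓ₁ ℓ₂ => hRz (x := (ℓ₁, ℓ₂)) trivial

/-- The 2N independent solutions span a subspace whose dimension already reaches the upper bound for
the solution space. -/
theorem span_solutionFamily (H : Interlacing N α β)
    (hc : ∀ j ∈ Finset.Icc 1 N, c j ∈ Set.Ioo (-α j - 1) (-α j))
    (hh : ∀ j ∈ Finset.Icc 1 N, 0 < h j) (V : TopologicalSpace.Opens (ℂ × ℂ))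
    (hV : IsConnected (V : Set (ℂ × ℂ))) {L₁ L₂ L₂' : ℂ × ℂ → ℂ} (h1 : ContinuousOn L₁ V)
    (h2 : ContinuousOn L₂ V) (h2' : ContinuousOn L₂' V) (e1 : ∀ t ∈ V, Complex.exp (L₁ t) = t.1)
    (e2 : ∀ t ∈ V, Complex.exp (L₂ t) = t.2) (e2' : ∀ t ∈ V, Complex.exp (L₂' t) = -t.2) :
    Submodule.span ℂ (Set.range (solutionFamily N α β c h V L₁ L₂ L₂')) = solutionSpace N α β V ∧
      Module.finrank ℂ (solutionSpace N α β V) = 2 * N := by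
  have hli := linearIndependent_solutionFamily H hc hh V hV.nonempty h1 h2 h2' e1 e2 e2'
  obtain ⟨hfin, hle⟩ := finite_solutionSpace (α := α) (β := β) H.two_le V hV fun t ht =>
    ⟨e1 t ht ▸ Complex.exp_ne_zero _, e2 t ht ▸ Complex.exp_ne_zero _⟩
  have hsub : Submodule.span ℂ (Set.range (solutionFamily N α β c h V L₁ L₂ L₂')) ≤
      solutionSpace N α β V := by
    rw [Submodule.span_le]
    rintro _ ⟨i, rfl⟩
    exact ⟨_, (logChart_logBase V.isOpen h1 h2 h2' e1 e2 e2' (i.1 + 1) i.2).isSolutionOn_mellinBarnes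
      H (by omega) (by omega) (hc _ (by simp)) (hh _ (by simp)) i.2 rfl, fun t => rfl⟩
  have hspan := finrank_span_eq_card hli
  have hcard : Fintype.card (Fin N × Kind) = 2 * N := by
    rw [Fintype.card_prod, Fintype.card_fin, mul_comm]
    rfl
  rw [hcard] at hspan
  have heq := Submodule.eq_of_le_of_finrank_le hsub (by rw [hspan]; exact hle)
  exact ⟨heq, by rw [← heq, hspan]⟩

end Independence

end SpinWhittaker

theorem mainTheorem5 (n m m' : ℕ) (hm : 2 ≤ m) (hmn : m ≤ n) (hmm' : m ≤ m' + 1) (hm'n : m' + 1 ≤ n)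
    (ε : ℝ) (hε : ε = 1 ∨ ε = -1) (Λ : ℕ → ℝ) (hΛ : IsHarishChandra n m ε Λ)
    (q : ℕ → ℕ → ℝ) (hq : IsGelfandTsetlin n (blattner n m Λ) q)
    (hQ : IsSpecial n m m' (blattner n m Λ) q)
    (N : ℕ) (hN : N = N₂ n m m' (blattner n m Λ) q)
    (α β : ℕ → ℝ) (hα : α = alpha n m m' ε Λ q) (hβ : β = beta n m m' ε Λ q)
    (c h : ℕ → ℝ) (hc : ∀ j ∈ Finset.Icc 1 N, c j ∈ Set.Ioo (-α j - 1) (-α j))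
    (hh : ∀ j ∈ Finset.Icc 1 N, 0 < h j) :
    -- absolute convergence of all the integrals
    (∀ j ∈ Finset.Icc 1 N, ∀ (L : Kind) (ℓ₁ ℓ₂ : ℂ),
      LoopIntegrable (c j) (h j) (integrand N α β j L ℓ₁ ℓ₂)) ∧
    -- on every connected open set with branches of `log t₁`, `log t₂`, `log (-t₂)`, the functions
    -- form a basis of the space of solutions, which is `2 N₂`-dimensional
    (∀ (V : TopologicalSpace.Opens (ℂ × ℂ)), IsConnected (V : Set (ℂ × ℂ)) →
      ∀ L₁ L₂ L₂' : ℂ × ℂ → ℂ,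
      ContinuousOn L₁ V → ContinuousOn L₂ V → ContinuousOn L₂' V →
      (∀ t ∈ V, Complex.exp (L₁ t) = t.1) → (∀ t ∈ V, Complex.exp (L₂ t) = t.2) →
      (∀ t ∈ V, Complex.exp (L₂' t) = -t.2) →
      LinearIndependent ℂ (solutionFamily N α β c h V L₁ L₂ L₂') ∧
        Submodule.span ℂ (Set.range (solutionFamily N α β c h V L₁ L₂ L₂')) =
          solutionSpace N α β V ∧
        Module.finrank ℂ (solutionSpace N α β V) = 2 * N) ∧
    -- leading terms at `t₂ = 0`, locally uniformly in `t₁`, with `arg t₂` bounded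
    (α 1 ≠ α 2 → ∀ j ∈ Finset.Icc 1 N, ∀ (L : Kind) (M : ℝ),
      TendstoLocallyUniformly
        (fun ℓ₂ ℓ₁ : ℂ =>
          mellinBarnes N α β (c j) (h j) j L ℓ₁ ℓ₂ / Complex.exp (-(α j : ℂ) * ℓ₂))
        (fun ℓ₁ : ℂ => (leadingCoeff N α β j : ℂ) * bessel L (α j) ℓ₁)
        (Filter.comap Complex.re Filter.atBot ⊓ Filter.principal {ℓ₂ : ℂ | |ℓ₂.im| ≤ M})) := by
  subst hN hα hβ
  -- From here on only the integrality and the interlacing of the exponents matter.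
  have H := interlacing_of_pattern hm hmn hmm' hm'n hε hΛ hq hQ
  refine ⟨fun j hj L ℓ₁ ℓ₂ => ?_, fun V hV L₁ L₂ L₂' h1 h2 h2' e1 e2 e2' => ?_,
    fun hne j hj L M => ?_⟩
  · obtain ⟨hj1, hjN⟩ := Finset.mem_Icc.1 hj
    exact loopIntegrable_integrand H hj1 hjN (H.loop_ne_int hj1 hjN (hc j hj)) (hh j hj) L ℓ₁ ℓ₂
  · exact ⟨linearIndependent_solutionFamily H hc hh V hV.nonempty h1 h2 h2' e1 e2 e2',
      span_solutionFamily H hc hh V hV h1 h2 h2' e1 e2 e2'⟩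
  · obtain ⟨hj1, hjN⟩ := Finset.mem_Icc.1 hj
    exact tendsto_mellinBarnes_leading H hj1 hjN (Or.inl hne) (hc j hj) (hh j hj) L M
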